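/- Let $0<q<1$, and let $\mathcal A=C(SU_q(2))$ be the $C^*$-algebra generated by $\alpha,\beta$ with $\alpha^*\alpha+\beta^*\beta=I$, $\alpha\alpha^*+q^2\beta\beta^*=I$, $\alpha\beta=q\beta\alpha$, $\alpha\beta^*=q\beta^*\alpha$, $\beta^*\beta=\beta\beta^*$, with coproduct $\Delta(\alpha)=\alpha\otimes\alpha-q\beta^*\otimes\beta$, $\Delta(\beta)=\beta\otimes\alpha+\alpha^*\otimes\beta$; let $\mathcal A_f$ be the $*$-subalgebra generated by $\alpha,\beta$. The GNS space $\mathcal H=L_2(h)$ of the Haar state $h$ is realised as the Hilbert space with orthonormal basis $e^{(n)}_{ij}$ ($n\in\{0,\frac12,1,\dots\}$, $i,j\in\{-n,-n+1,\dots,n\}$) on which $$\alpha e^{(n)}_{ij}=a_+(n,i,j)\,e^{(n+1/2)}_{i-1/2,\,j-1/2}+a_-(n,i,j)\,e^{(n-1/2)}_{i-1/2,\,j-1/2},\qquad \beta e^{(n)}_{ij}=b_+(n,i,j)\,e^{(n+1/2)}_{i+1/2,\,j-1/2}+b_-(n,i,j)\,e^{(n-1/2)}_{i+1/2,\,j-1/2},$$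 $$a_+=\Bigl(q^{2(n+i)+2(n+j)+2}\tfrac{(1-q^{2n-2j+2})(1-q^{2n-2i+2})}{(1-q^{4n+2})(1-q^{4n+4})}\Bigr)^{1/2},\quad a_-=\Bigl(\tfrac{(1-q^{2n+2j})(1-q^{2n+2i})}{(1-q^{4n})(1-q^{4n+2})}\Bigr)^{1/2},$$ $$b_+=-\Bigl(q^{2(n+j)}\tfrac{(1-q^{2n-2j+2})(1-q^{2n+2i+2})}{(1-q^{4n+2})(1-q^{4n+4})}\Bigr)^{1/2},\quad b_-=\Bigl(q^{2(n+i)}\tfrac{(1-q^{2n+2j})(1-q^{2n-2i})}{(1-q^{4n})(1-q^{4n+2})}\Bigr)^{1/2}$$ ($a_-=b_-=0$ for $n=0$). These operators satisfy the relations above, $e^{(0)}_{00}$ is a cyclic unit vector, and its vector state is left and right invariant, i.e. it is $h$. An *equivariant spectral triple* is a self-adjoint operator $D$ on $\mathcal H$ with compact resolvent such that every $a\in\mathcal A_f$ preserves the domain of $D$ and $[D,a]$ is bounded, and such that $D$ preserves the linear span of the $e^{(n)}_{ij}$ and commutes there with $A_0:e^{(n)}_{ij}\mapsto q^je^{(n)}_{ij}$,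 with $A_1:e^{(n)}_{ij}\mapsto(q^{-2n}+q^{2n+2}-q^{-2j}-q^{2j+2})^{1/2}e^{(n)}_{i,j+1}$ (and $0$ for $j=n$), and with $A_1^*$. The pairing of the $K_1$-class of an invertible $u\in\mathcal A$ with $D$ is the index of the Fredholm operator $QuQ$ on $Q\mathcal H$, where $Q=\chi_{[0,\infty)}(D)$. Let $P_k$ ($k\in\mathbb N=\{0,1,2,\dots\}$) be the projection onto the closed span of all $e^{(n)}_{n-k,j}$. **Proposition.** Let $r\in\mathbb N$ with $q^{2r}<\frac12$ and $\gamma_r=(\beta^*\beta)^r(\beta-I)+I$. Then $\gamma_r$ is invertible in $\mathcal A$, and: 1. For every $m\in\mathbb Z$ there is an equivariant spectral triple $D$ on $\mathcal H$ with $\langle\gamma_r,D\rangle=m$. 2. More precisely, let $m\in\mathbb Z$ and let $F\subset\mathbb N$ be finite with $|F|=|m|$; put $S=I-2\sum_{k\in F}P_k$ if $m\ge0$ and $S=-(I-2\sum_{k\in F}P_k)$ if $m<0$. Then there is an equivariant spectral triple $D$ with $\operatorname{sign}D=S$, and every such $D$ satisfies $\langle\gamma_r,D\rangle=m$. 3.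 For every $k\in\mathbb N$ the compression $P_k\gamma_rP_k$, as an operator on $P_k\mathcal H$, is Fredholm of index $-1$. 4. $P_{k+l}\gamma_rP_k$ is compact for all $k\in\mathbb N$ and all integers $l\ne0$ with $k+l\ge0$. -/

import Mathlib

open scoped ENNReal TensorProduct InnerProductSpace

noncomputable section

namespace SUq2

/-! ### Odd spectral triples, sign and index pairing on a Hilbert space -/

section General

variable {H : Type*} [NormedAddCommGroup H] [InnerProductSpace ℂ H] [CompleteSpace H]

/-- `(B, H, D)` is an odd spectral triple: `D` is a (densely defined, unbounded) self-adjoint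
operator with compact resolvent, and every `a` in the `*`-algebra `B` of bounded operators maps
`dom D` to itself and has a bounded commutator with `D`. -/
structure IsOddSpectralTriple (B : StarSubalgebra ℂ (H →L[ℂ] H)) (D : H →ₗ.[ℂ] H) : Prop where
  selfAdjoint : IsSelfAdjoint D
  /-- `(D - i)⁻¹` is a compact operator -/
  compactResolvent : ∃ R : H →L[ℂ] H, IsCompactOperator R ∧
    (∀ y : H, ∃ h : R y ∈ D.domain, D ⟨R y, h⟩ - Complex.I • R y = y) ∧
    (∀ x : D.domain, R (D x - Complex.I • (x : H)) = x)
  boundedCommutators : ∀ a ∈ B, ∃ C : ℝ, ∀ x : D.domain,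
    ∃ h : a x ∈ D.domain, ‖D ⟨a x, h⟩ - a (D x)‖ ≤ C * ‖(x : H)‖

/-- The closed span of the eigenvectors of `D` with eigenvalue in `Λ ⊆ ℝ`. For a self-adjoint `D`
with compact resolvent this is the range of the spectral projection `χ_Λ(D)`. -/
def spectralSubspace (D : H →ₗ.[ℂ] H) (Λ : Set ℝ) : Submodule ℂ H :=
  (Submodule.span ℂ {x : H | ∃ h : x ∈ D.domain, ∃ c ∈ Λ,
    D ⟨x, h⟩ = (c : ℂ) • x}).topologicalClosure

instance (D : H →ₗ.[ℂ] H) (Λ : Set ℝ) : CompleteSpace (spectralSubspace D Λ) :=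
  Submodule.topologicalClosure.completeSpace _

/-- `sign D = χ_{(0,∞)}(D) - χ_{(-∞,0)}(D)`, for `D` self-adjoint with compact resolvent. -/
def signOp (D : H →ₗ.[ℂ] H) : H →L[ℂ] H :=
  (spectralSubspace D (Set.Ioi 0)).starProjection -
    (spectralSubspace D (Set.Iio 0)).starProjection

/-- The compression `x ↦ P_K (T x)` of `T` to a closed subspace `K`, as an operator on `K`. -/
def compress (K : Submodule ℂ H) [K.HasOrthogonalProjection] (T : H →L[ℂ] H) : K →L[ℂ] K :=
  K.orthogonalProjectionOnto ∘L T ∘L K.subtypeL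

/-- `T` is a Fredholm operator with `dim ker T - dim coker T = m`. -/
def HasFredholmIndex {E F : Type*} [NormedAddCommGroup E] [NormedSpace ℂ E]
    [NormedAddCommGroup F] [NormedSpace ℂ F] (T : E →L[ℂ] F) (m : ℤ) : Prop :=
  T.IsFredholm ∧
    (Module.finrank ℂ T.ker : ℤ) - (Module.finrank ℂ (F ⧸ T.range) : ℤ) = m

/-- The pairing of the `K₁`-class of an invertible element `u` of a `C*`-algebra `A` of operators
on `H` with the `K`-homology class of `(A, H, D)` is defined and equal to `m`: with
`P = χ_{[0,∞)}(D)`, the compression `P u P` on `P H` is Fredholm of index `m`. -/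
def PairingEq {A : StarSubalgebra ℂ (H →L[ℂ] H)} (u : Aˣ) (D : H →ₗ.[ℂ] H) (m : ℤ) : Prop :=
  HasFredholmIndex (compress (spectralSubspace D (Set.Ici 0)) ((u : A) : H →L[ℂ] H)) m

end General

/-! ### The Hopf `*`-algebra structure and the Haar state -/

/-- Names of the four generators `α, α*, β, β*`. -/
inductive Gen
  | a
  | aStar
  | b
  | bStar

/-- Noncommutative polynomials in `α, α*, β, β*`. -/
abbrev Poly : Type := FreeAlgebra ℂ Gen

/-- The coproduct `Δ(α) = α ⊗ α - q β* ⊗ β`, `Δ(β) = β ⊗ α + α* ⊗ β` (a `*`-homomorphism),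
on the level of noncommutative polynomials. -/
def coproduct (q : ℝ) : Poly →ₐ[ℂ] Poly ⊗[ℂ] Poly :=
  FreeAlgebra.lift ℂ fun g =>
    let x : Gen → Poly := FreeAlgebra.ι ℂ
    match g with
    | .a => x .a ⊗ₜ[ℂ] x .a - (q : ℂ) • (x .bStar ⊗ₜ[ℂ] x .b)
    | .aStar => x .aStar ⊗ₜ[ℂ] x .aStar - (q : ℂ) • (x .b ⊗ₜ[ℂ] x .bStar)
    | .b => x .b ⊗ₜ[ℂ] x .a + x .aStar ⊗ₜ[ℂ] x .b
    | .bStar => x .bStar ⊗ₜ[ℂ] x .aStar + x .a ⊗ₜ[ℂ] x .bStar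

section Haar

variable {H : Type*} [NormedAddCommGroup H] [InnerProductSpace ℂ H] [CompleteSpace H]

/-- Evaluation of noncommutative polynomials at operators `α, β` and their adjoints. -/
def evalPoly (α β : H →L[ℂ] H) : Poly →ₐ[ℂ] (H →L[ℂ] H) :=
  FreeAlgebra.lift ℂ fun g =>
    match g with
    | .a => α
    | .aStar => star α
    | .b => β
    | .bStar => star β

/-- The functional `p ↦ ⟨Ω, p(α, β) Ω⟩`. -/
def vectorFunctional (α β : H →L[ℂ] H) (Ω : H) : Poly →ₗ[ℂ] ℂ :=
  (innerSL ℂ Ω).toLinearMap ∘ₗ (ContinuousLinearMap.apply ℂ H Ω).toLinearMap ∘ₗ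
    (evalPoly α β).toLinearMap

/-- `(H, α, β, Ω)` is the GNS representation of the Haar state `h` of `SU_q(2)`: `α` and `β`
satisfy the defining relations of `C(SU_q(2))`, the unit vector `Ω` is cyclic, and its vector
state is left and right invariant, `(h ⊗ id) Δ(p) = h(p) 1 = (id ⊗ h) Δ(p)`. -/
structure IsHaarGNS (q : ℝ) (α β : H →L[ℂ] H) (Ω : H) : Prop where
  rel₁ : star α * α + star β * β = 1
  rel₂ : α * star α + (q : ℂ) ^ 2 • (β * star β) = 1
  rel₃ : α * β - (q : ℂ) • (β * α) = 0
  rel₄ : α * star β - (q : ℂ) • (star β * α) = 0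
  rel₅ : star β * β = β * star β
  norm_vector : ‖Ω‖ = 1
  cyclic : (Submodule.span ℂ (Set.range fun p : Poly => evalPoly α β p Ω)).topologicalClosure = ⊤
  left_invariant : ∀ p : Poly,
    TensorProduct.lid ℂ (H →L[ℂ] H) (TensorProduct.map (vectorFunctional α β Ω)
      (evalPoly α β).toLinearMap (coproduct q p)) = vectorFunctional α β Ω p • 1
  right_invariant : ∀ p : Poly,
    TensorProduct.rid ℂ (H →L[ℂ] H) (TensorProduct.map (evalPoly α β).toLinearMap
      (vectorFunctional α β Ω) (coproduct q p)) = vectorFunctional α β Ω p • 1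

end Haar

/-! ### The Hilbert space `L₂(h)` -/

/-- Labels of the orthonormal basis vectors `e^{(n)}_{ij}`, `n ∈ {0, 1/2, 1, …}`,
`i, j ∈ {-n, …, n}`, through the natural numbers `N = 2n`, `I = n + i`, `J = n + j`. -/
@[ext]
structure Idx where
  N : ℕ
  I : ℕ
  J : ℕ
  hI : I ≤ N
  hJ : J ≤ N

/-- The Hilbert space with orthonormal basis `e^{(n)}_{ij}`. -/
abbrev L2h : Type := lp (fun _ : Idx => ℂ) 2

open scoped Classical in
/-- The basis vector `e^{(n)}_{ij}`. -/
def e (x : Idx) : L2h := lp.single 2 x 1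

theorem orthonormal_e : Orthonormal ℂ e := by
  classical
  rw [orthonormal_iff_ite]
  intro x y
  rw [e, e, lp.inner_single_left, lp.single_apply]
  by_cases h : x = y
  · subst h; simp
  · simp [h]

/-- The isometry `e x ↦ e (f x)` for an injective map `f` of labels. -/
def isometryOf (f : Idx → Idx) (hf : Function.Injective f) : L2h →ₗᵢ[ℂ] L2h :=
  (orthonormal_e.comp f hf).orthogonalFamily.linearIsometry

theorem isometryOf_e (f : Idx → Idx) (hf : Function.Injective f) (x : Idx) :
    isometryOf f hf (e x) = e (f x) := by
  classical
  rw [isometryOf, e, OrthogonalFamily.linearIsometry_apply_single]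
  simp

theorem adjoint_isometryOf_e (f : Idx → Idx) (hf : Function.Injective f) (x : Idx) :
    ContinuousLinearMap.adjoint (isometryOf f hf).toContinuousLinearMap (e (f x)) = e x := by
  rw [← isometryOf_e f hf x]
  have h := (ContinuousLinearMap.norm_map_iff_adjoint_comp_self
    (isometryOf f hf).toContinuousLinearMap).1 (fun y => (isometryOf f hf).norm_map y)
  exact congrArg (fun T : L2h →L[ℂ] L2h => T (e x)) h

theorem adjoint_isometryOf_e_of_notMem (f : Idx → Idx) (hf : Function.Injective f) (y : Idx)
    (hy : y ∉ Set.range f) :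
    ContinuousLinearMap.adjoint (isometryOf f hf).toContinuousLinearMap (e y) = 0 := by
  classical
  ext x
  have h1 : ∀ v : L2h, inner ℂ (e x) v = v x := by
    intro v
    rw [e, lp.inner_single_left]
    simp
  rw [← h1, ContinuousLinearMap.adjoint_inner_right]
  have h2 : (isometryOf f hf).toContinuousLinearMap (e x) = e (f x) := isometryOf_e f hf x
  rw [h2, orthonormal_e.2 (fun h => hy ⟨x, h⟩)]
  simp

/-- The label map `(n, i, j) ↦ (n + 1/2, i ± 1/2, j ± 1/2)`; the signs are `+` for `s = 1`,
`t = 1` and `-` for `s = 0`, `t = 0`. -/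
def up (s t : Fin 2) (x : Idx) : Idx :=
  ⟨x.N + 1, x.I + s, x.J + t, by have := x.hI; omega, by have := x.hJ; omega⟩

theorem up_injective (s t : Fin 2) : Function.Injective (up s t) := by
  intro x y h
  simp only [up, Idx.mk.injEq] at h
  ext <;> omega

/-- The shift `e^{(n)}_{ij} ↦ e^{(n+1/2)}_{i ± 1/2, j ± 1/2}`. Its adjoint maps
`e^{(n)}_{ij}` to `e^{(n-1/2)}_{i ∓ 1/2, j ∓ 1/2}`, or to `0` if there is no such vector. -/
def shift (s t : Fin 2) : L2h →L[ℂ] L2h :=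
  (isometryOf (up s t) (up_injective s t)).toContinuousLinearMap

theorem memℓp_mul {w : Idx → ℝ} {C : ℝ} (hw : ∀ x, |w x| ≤ C) (v : L2h) :
    Memℓp (fun x => (w x : ℂ) * v x) 2 := by
  refine Memℓp.mono' (g := fun x => ((C : ℂ) • v : L2h) x) (lp.memℓp _) fun x => ?_
  rw [lp.coeFn_smul, Pi.smul_apply, smul_eq_mul, norm_mul, norm_mul]
  refine mul_le_mul_of_nonneg_right ?_ (norm_nonneg _)
  rw [Complex.norm_real, Complex.norm_real]
  exact (hw x).trans (le_abs_self C)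

open scoped Classical in
/-- The diagonal operator `e x ↦ w x • e x` for a bounded family `w` of real numbers
(with the value `0` if `w` is unbounded, which does not occur below). -/
def diagOp (w : Idx → ℝ) : L2h →L[ℂ] L2h :=
  if h : ∃ C, ∀ x, |w x| ≤ C then
    LinearMap.mkContinuous
      { toFun := fun v => (⟨fun x => (w x : ℂ) * v x, memℓp_mul h.choose_spec v⟩ : L2h)
        map_add' := fun u v => by
          ext x
          exact mul_add _ _ _
        map_smul' := fun c v => by
          ext x
          exact mul_left_comm _ _ _ }
      |h.choose|
      (fun v => by
        rw [← Real.norm_eq_abs, ← Complex.norm_real, ← lp.norm_const_smul (by simp)]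
        refine lp.norm_mono (by simp) fun x => ?_
        rw [lp.coeFn_smul, Pi.smul_apply, smul_eq_mul]
        simp only [LinearMap.coe_mk, AddHom.coe_mk, norm_mul]
        refine mul_le_mul_of_nonneg_right ?_ (norm_nonneg _)
        rw [Complex.norm_real, Complex.norm_real]
        exact (h.choose_spec x).trans (le_abs_self _))
  else 0

theorem diagOp_e {w : Idx → ℝ} (h : ∃ C, ∀ x, |w x| ≤ C) (x : Idx) :
    diagOp w (e x) = (w x : ℂ) • e x := by
  classical
  rw [diagOp, dif_pos h]
  ext y
  rw [lp.coeFn_smul, Pi.smul_apply, smul_eq_mul, LinearMap.mkContinuous_apply]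
  change (w y : ℂ) * e x y = (w x : ℂ) * e x y
  by_cases hy : y = x
  · rw [hy]
  · rw [e, lp.single_apply_ne _ _ _ hy, mul_zero, mul_zero]

/-! ### The operators `α` and `β` and the algebras they generate -/

/-- `a₊(n,i,j) = (q^{2(n+i)+2(n+j)+2} (1-q^{2n-2j+2}) (1-q^{2n-2i+2}) /
((1-q^{4n+2}) (1-q^{4n+4})))^{1/2}`. -/
def aPlus (q : ℝ) (x : Idx) : ℝ :=
  Real.sqrt (q ^ (2 * x.I + 2 * x.J + 2) *
    ((1 - q ^ (2 * (x.N - x.J) + 2)) * (1 - q ^ (2 * (x.N - x.I) + 2)) /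
      ((1 - q ^ (2 * x.N + 2)) * (1 - q ^ (2 * x.N + 4)))))

/-- `a₋(n,i,j) = ((1-q^{2n+2j}) (1-q^{2n+2i}) / ((1-q^{4n}) (1-q^{4n+2})))^{1/2}`,
which is `0` for `n = 0`. -/
def aMinus (q : ℝ) (x : Idx) : ℝ :=
  Real.sqrt ((1 - q ^ (2 * x.J)) * (1 - q ^ (2 * x.I)) /
    ((1 - q ^ (2 * x.N)) * (1 - q ^ (2 * x.N + 2))))

/-- `b₊(n,i,j) = -(q^{2(n+j)} (1-q^{2n-2j+2}) (1-q^{2n+2i+2}) /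
((1-q^{4n+2}) (1-q^{4n+4})))^{1/2}`. -/
def bPlus (q : ℝ) (x : Idx) : ℝ :=
  -Real.sqrt (q ^ (2 * x.J) *
    ((1 - q ^ (2 * (x.N - x.J) + 2)) * (1 - q ^ (2 * x.I + 2)) /
      ((1 - q ^ (2 * x.N + 2)) * (1 - q ^ (2 * x.N + 4)))))

/-- `b₋(n,i,j) = (q^{2(n+i)} (1-q^{2n+2j}) (1-q^{2n-2i}) /
((1-q^{4n}) (1-q^{4n+2})))^{1/2}`, which is `0` for `n = 0`. -/
def bMinus (q : ℝ) (x : Idx) : ℝ :=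
  Real.sqrt (q ^ (2 * x.I) *
    ((1 - q ^ (2 * x.J)) * (1 - q ^ (2 * (x.N - x.I))) /
      ((1 - q ^ (2 * x.N)) * (1 - q ^ (2 * x.N + 2)))))

/-- `α : e^{(n)}_{ij} ↦ a₊(n,i,j) e^{(n+1/2)}_{i-1/2,j-1/2} + a₋(n,i,j) e^{(n-1/2)}_{i-1/2,j-1/2}`. -/
def alpha (q : ℝ) : L2h →L[ℂ] L2h :=
  shift 0 0 ∘L diagOp (aPlus q) +
    ContinuousLinearMap.adjoint (shift 1 1) ∘L diagOp (aMinus q)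

/-- `β : e^{(n)}_{ij} ↦ b₊(n,i,j) e^{(n+1/2)}_{i+1/2,j-1/2} + b₋(n,i,j) e^{(n-1/2)}_{i+1/2,j-1/2}`. -/
def beta (q : ℝ) : L2h →L[ℂ] L2h :=
  shift 1 0 ∘L diagOp (bPlus q) +
    ContinuousLinearMap.adjoint (shift 0 1) ∘L diagOp (bMinus q)

theorem coeff_le_one {p x y z w : ℝ} (hp : p ≤ 1) (hx : 0 ≤ x) (hxz : x ≤ z)
    (hy : 0 ≤ y) (hyw : y ≤ w) : |Real.sqrt (p * (x * y / (z * w)))| ≤ 1 := by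
  rw [abs_of_nonneg (Real.sqrt_nonneg _), Real.sqrt_le_one]
  have h1 : x * y / (z * w) ≤ 1 :=
    div_le_one_of_le₀ (mul_le_mul hxz hyw hy (hx.trans hxz))
      (mul_nonneg (hx.trans hxz) (hy.trans hyw))
  exact mul_le_one₀ hp (div_nonneg (mul_nonneg hx hy)
      (mul_nonneg (hx.trans hxz) (hy.trans hyw))) h1

theorem one_sub_pow_nonneg {q : ℝ} (h0 : 0 < q) (h1 : q < 1) (k : ℕ) : 0 ≤ 1 - q ^ k :=
  sub_nonneg.2 (pow_le_one₀ h0.le h1.le)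

theorem one_sub_pow_le {q : ℝ} (h0 : 0 < q) (h1 : q < 1) {k l : ℕ} (h : k ≤ l) :
    1 - q ^ k ≤ 1 - q ^ l :=
  sub_le_sub_left (pow_le_pow_of_le_one h0.le h1.le h) 1

theorem coefficients_bounded {q : ℝ} (h0 : 0 < q) (h1 : q < 1) (x : Idx) :
    |aPlus q x| ≤ 1 ∧ |aMinus q x| ≤ 1 ∧ |bPlus q x| ≤ 1 ∧ |bMinus q x| ≤ 1 := by
  have hI := x.hI
  have hJ := x.hJ
  have n := one_sub_pow_nonneg h0 h1
  have p1 := fun k : ℕ => pow_le_one₀ (n := k) h0.le h1.le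
  refine ⟨?_, ?_, ?_, ?_⟩
  · exact coeff_le_one (p1 _) (n _) (one_sub_pow_le h0 h1 (by omega)) (n _)
      (one_sub_pow_le h0 h1 (by omega))
  · rw [aMinus, ← one_mul (_ / _)]
    exact coeff_le_one le_rfl (n _) (one_sub_pow_le h0 h1 (by omega)) (n _)
      (one_sub_pow_le h0 h1 (by omega))
  · rw [bPlus, abs_neg]
    exact coeff_le_one (p1 _) (n _) (one_sub_pow_le h0 h1 (by omega)) (n _)
      (one_sub_pow_le h0 h1 (by omega))
  · exact coeff_le_one (p1 _) (n _) (one_sub_pow_le h0 h1 (by omega)) (n _)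
      (one_sub_pow_le h0 h1 (by omega))

theorem shift_e (s t : Fin 2) (x : Idx) : shift s t (e x) = e (up s t x) :=
  isometryOf_e (up s t) (up_injective s t) x

theorem adjoint_shift_e_up (s t : Fin 2) (x : Idx) :
    ContinuousLinearMap.adjoint (shift s t) (e (up s t x)) = e x :=
  adjoint_isometryOf_e (up s t) (up_injective s t) x

theorem adjoint_shift_e_of_notMem (s t : Fin 2) (x : Idx) (hx : x ∉ Set.range (up s t)) :
    ContinuousLinearMap.adjoint (shift s t) (e x) = 0 :=
  adjoint_isometryOf_e_of_notMem (up s t) (up_injective s t) x hx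

/-- The action of `α` on the basis. -/
theorem alpha_e {q : ℝ} (h0 : 0 < q) (h1 : q < 1) (x : Idx) :
    alpha q (e x) = (aPlus q x : ℂ) • e (up 0 0 x) +
      (aMinus q x : ℂ) • ContinuousLinearMap.adjoint (shift 1 1) (e x) := by
  have h := coefficients_bounded h0 h1
  rw [alpha, _root_.add_apply, ContinuousLinearMap.comp_apply,
    ContinuousLinearMap.comp_apply, diagOp_e ⟨1, fun x => (h x).1⟩,
    diagOp_e ⟨1, fun x => (h x).2.1⟩, map_smul, map_smul, shift_e]

/-- The action of `β` on the basis. -/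
theorem beta_e {q : ℝ} (h0 : 0 < q) (h1 : q < 1) (x : Idx) :
    beta q (e x) = (bPlus q x : ℂ) • e (up 1 0 x) +
      (bMinus q x : ℂ) • ContinuousLinearMap.adjoint (shift 0 1) (e x) := by
  have h := coefficients_bounded h0 h1
  rw [beta, _root_.add_apply, ContinuousLinearMap.comp_apply,
    ContinuousLinearMap.comp_apply, diagOp_e ⟨1, fun x => (h x).2.2.1⟩,
    diagOp_e ⟨1, fun x => (h x).2.2.2⟩, map_smul, map_smul, shift_e]

/-- The `*`-algebra `A_f` generated by `α` and `β`. -/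
def polyAlg (q : ℝ) : StarSubalgebra ℂ (L2h →L[ℂ] L2h) :=
  StarAlgebra.adjoin ℂ {alpha q, beta q}

/-- The `C*`-algebra `A = C(SU_q(2))`, acting on `L₂(h)`: the norm closure of `A_f`. -/
def contAlg (q : ℝ) : StarSubalgebra ℂ (L2h →L[ℂ] L2h) :=
  (polyAlg q).topologicalClosure

/-- The element `γ_r = (β*β)^r (β - I) + I`. -/
def gamma (q : ℝ) (r : ℕ) : L2h →L[ℂ] L2h :=
  (star (beta q) * beta q) ^ r * (beta q - 1) + 1

/-! ### Equivariance -/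

/-- The inclusion into `L₂(h)` of the algebraic span of the basis vectors. -/
def ofFinsupp : (Idx →₀ ℂ) →ₗ[ℂ] L2h := Finsupp.linearCombination ℂ e

/-- The operator on the algebraic span of the basis with the given values on the basis vectors. -/
def onBasis (f : Idx → (Idx →₀ ℂ)) : (Idx →₀ ℂ) →ₗ[ℂ] (Idx →₀ ℂ) := Finsupp.linearCombination ℂ f

/-- `A₀ : e^{(n)}_{ij} ↦ q^j e^{(n)}_{ij}`. -/
def A₀ (q : ℝ) : (Idx →₀ ℂ) →ₗ[ℂ] (Idx →₀ ℂ) :=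
  onBasis fun x => Finsupp.single x ((q ^ ((x.J : ℝ) - (x.N : ℝ) / 2) : ℝ) : ℂ)

/-- `(q^{-2n} + q^{2n+2} - q^{-2j} - q^{2j+2})^{1/2}` with `2n = N` and `n + j = J`. -/
def ladderCoeff (q : ℝ) (N J : ℕ) : ℝ :=
  Real.sqrt (q ^ (-(N : ℤ)) + q ^ ((N : ℤ) + 2) - q ^ ((N : ℤ) - 2 * J) -
    q ^ (2 * (J : ℤ) - N + 2))

/-- `A₁ : e^{(n)}_{ij} ↦ (q^{-2n} + q^{2n+2} - q^{-2j} - q^{2j+2})^{1/2} e^{(n)}_{i,j+1}` for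
`j < n`, and `e^{(n)}_{in} ↦ 0`. -/
def A₁ (q : ℝ) : (Idx →₀ ℂ) →ₗ[ℂ] (Idx →₀ ℂ) :=
  onBasis fun x => if h : x.J + 1 ≤ x.N then
    Finsupp.single ⟨x.N, x.I, x.J + 1, x.hI, h⟩ (ladderCoeff q x.N x.J : ℂ) else 0

/-- The adjoint of `A₁` on the span of the basis. -/
def A₁Star (q : ℝ) : (Idx →₀ ℂ) →ₗ[ℂ] (Idx →₀ ℂ) :=
  onBasis fun x => if 1 ≤ x.J then
    Finsupp.single ⟨x.N, x.I, x.J - 1, x.hI, (Nat.sub_le _ _).trans x.hJ⟩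
      (ladderCoeff q x.N (x.J - 1) : ℂ) else 0

/-- `D` is equivariant: it commutes with the (unbounded) operators `A₀`, `A₁`, `A₁*`, that is,
`D` is defined on their common invariant domain, the span of the `e^{(n)}_{ij}`, maps this span
to itself, and commutes with them there. -/
def IsEquivariant (q : ℝ) (D : L2h →ₗ.[ℂ] L2h) : Prop :=
  ∃ T : (Idx →₀ ℂ) →ₗ[ℂ] (Idx →₀ ℂ),
    (∀ f, ∃ h : ofFinsupp f ∈ D.domain, D ⟨ofFinsupp f, h⟩ = ofFinsupp (T f)) ∧
    T ∘ₗ A₀ q = A₀ q ∘ₗ T ∧ T ∘ₗ A₁ q = A₁ q ∘ₗ T ∧ T ∘ₗ A₁Star q = A₁Star q ∘ₗ T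

/-- `D` is (the Dirac operator of) an equivariant spectral triple on `L₂(h)`. -/
structure IsEquivariantSpectralTriple (q : ℝ) (D : L2h →ₗ.[ℂ] L2h) : Prop where
  spectralTriple : IsOddSpectralTriple (polyAlg q) D
  equivariant : IsEquivariant q D

/-- The closed span of the vectors `e^{(n)}_{n-k,j}`. -/
def rowSpace (k : ℕ) : Submodule ℂ L2h :=
  (Submodule.span ℂ {v : L2h | ∃ x : Idx, x.I + k = x.N ∧ v = e x}).topologicalClosure

instance (k : ℕ) : CompleteSpace (rowSpace k) :=
  Submodule.topologicalClosure.completeSpace _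

/-- `P_k`, the orthogonal projection onto the closed span of the vectors `e^{(n)}_{n-k,j}`. -/
def P (k : ℕ) : L2h →L[ℂ] L2h := (rowSpace k).starProjection


end SUq2

end

open SUq2

/-! Write N = 2n, I = n + i, J = n + j, and call the labels with n - i = k the k-th row.

Index. On a fixed row I tends to infinity with N, and each N carries finitely many labels, so
weights of size O(q^I) define compact operators there. The coefficient b_- is O(q^I), and b_+
differs from -q^J by O(q^I). Modulo compacts, β therefore acts on a row as -q^J S, where S raises N
and I by one and preserves both the row and J (`asympOn_beta`, `asympOn_star_beta`). Hence γ_r is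
asymptotic to 1 - q^{2Jr}(1 + q^J S). For J = 0 this is -S, a unilateral shift up to sign. For J ≥ 1
it differs from 1 by norm at most 2q^{2r} < 1 and is invertible. Each row thus contributes index -1
(`hasFredholmIndex_gammaModel_row`), and the cross terms are compact because the model preserves
rows. For the projection p onto finitely many rows the compression has index -|F|. As γ_r is
invertible and (1-p)γ_r p is compact, a block triangular factorisation gives index +|F| on the
complement (`hasFredholmIndex_gamma_compl_rows`). The sign of D determines whether χ_{[0,∞)}(D) is p
or 1-p (`pairingEq_of_signOp`). The index calculus rests on additivity and on the equality of the
indices of 1 + AB and 1 + BA; compactness is carried along as being a norm limit of finite rank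
operators.

Invertibility. Since α*α = 1 - β*β and αα* = 1 - q²β*β have the same nonzero spectrum, the spectrum
of β*β lies in {0} ∪ {q^{2n}}. The continuous functional calculus of the normal operator β then
shows that |z|^{2r}(z - 1) + 1 has no zero on its spectrum (`isUnit_of_rel`).

Dirac operators. Take D diagonal with eigenvalues ±(2n + 1), the sign depending on whether n - i ∈
F. They do not depend on j, whence equivariance. The parts of α and β that change n - i have
coefficients O(q^I); a sign flip occurs only near the rows of F, where (2n + 1)q^I is bounded, so
commutators are bounded (`isOddSpectralTriple_diracWeight`).

Haar state. Rescaling the basis by `modelNorm` removes the square roots: the generators become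
ladder operators whose coefficients are rational in q^N, q^I, q^J, and the relations become rational
identities. A mirrored family of ladders, playing the role of right multiplication, commutes with
the generators. The vacuum vector is cyclic for both families, hence also separating
(`modelRep_eq_zero`). A matrix-type coproduct on the model intertwines the generators with Δ
(`coprod_genOp`) and maps level N into level N ⊗ level N. Only level 0 survives the vacuum
functional, which gives invariance on the vacuum; separation lifts it to operators. -/

namespace SUq2

/-! ### Index of linear maps, without topology -/

section LinearIndex

variable {V W Z : Type*} [AddCommGroup V] [Module ℂ V] [AddCommGroup W] [Module ℂ W]
  [AddCommGroup Z] [Module ℂ Z]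

/-- `T` has finite-dimensional kernel and cokernel, with `dim ker T - dim coker T = m`. -/
structure HasLinearIndex (T : V →ₗ[ℂ] W) (m : ℤ) : Prop where
  finite_ker : FiniteDimensional ℂ T.ker
  finite_coker : FiniteDimensional ℂ (W ⧸ T.range)
  index_eq : (Module.finrank ℂ T.ker : ℤ) - (Module.finrank ℂ (W ⧸ T.range) : ℤ) = m

/-- T maps the kernel of ST onto ran T ∩ ker S, and the kernel of this restriction is ker T;
rank-nullity finishes. -/
theorem finrank_ker_comp (T : V →ₗ[ℂ] W) (S : W →ₗ[ℂ] Z) [FiniteDimensional ℂ T.ker]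
    [FiniteDimensional ℂ S.ker] :
    FiniteDimensional ℂ (S ∘ₗ T).ker ∧
    Module.finrank ℂ (S ∘ₗ T).ker =
      Module.finrank ℂ T.ker + Module.finrank ℂ (T.range ⊓ S.ker : Submodule ℂ W) := by
  let f : (S ∘ₗ T).ker →ₗ[ℂ] S.ker := T.restrict fun x hx => hx
  have hk : Module.Finite ℂ f.ker := by
    let g : f.ker →ₗ[ℂ] T.ker := ((S ∘ₗ T).ker.subtype ∘ₗ f.ker.subtype).codRestrict _
      (fun x => congrArg Subtype.val x.2)
    exact Module.Finite.of_injective g fun x y h => by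
      ext; exact congrArg (fun z : T.ker => (z : V)) h
  have hfin : FiniteDimensional ℂ (S ∘ₗ T).ker := by
    have := hk
    have h1 : Module.Finite ℂ ((S ∘ₗ T).ker ⧸ f.ker) :=
      Module.Finite.equiv f.quotKerEquivRange.symm
    exact Module.Finite.of_submodule_quotient f.ker
  refine ⟨hfin, ?_⟩
  rw [← f.finrank_range_add_finrank_ker, add_comm]
  congr 1
  · refine LinearEquiv.finrank_eq (LinearEquiv.ofBijective
      (((S ∘ₗ T).ker.subtype ∘ₗ f.ker.subtype).codRestrict T.ker
        (fun x => congrArg Subtype.val x.2)) ⟨fun x y h => ?_, fun y => ?_⟩)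
    · ext; exact congrArg (fun z : T.ker => (z : V)) h
    · refine ⟨⟨⟨y, ?_⟩, ?_⟩, rfl⟩
      · change S (T y) = 0
        rw [show T y = 0 from y.2, map_zero]
      · ext; exact y.2
  · refine LinearEquiv.finrank_eq (LinearEquiv.ofBijective
      ((S.ker.subtype ∘ₗ f.range.subtype).codRestrict (T.range ⊓ S.ker) ?_) ⟨fun x y h => ?_,
        fun y => ?_⟩)
    · rintro ⟨_, x, rfl⟩
      exact ⟨⟨x, rfl⟩, x.2⟩
    · ext; exact congrArg (fun z : (T.range ⊓ S.ker : Submodule ℂ W) => (z : W)) h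
    · obtain ⟨_, ⟨v, rfl⟩, hv⟩ := y
      exact ⟨⟨⟨T v, hv⟩, ⟨⟨v, hv⟩, rfl⟩⟩, rfl⟩

/-- The image of B in W/A has dimension dim B - dim(A ∩ B) and quotient W/(A + B). With A = ran T
and B = ker S this balances the correction terms for kernel and cokernel of ST. -/
theorem finrank_quotient_sup (A B : Submodule ℂ W) [FiniteDimensional ℂ (W ⧸ A)]
    [FiniteDimensional ℂ B] :
    Module.finrank ℂ (W ⧸ A) + Module.finrank ℂ (A ⊓ B : Submodule ℂ W) =
      Module.finrank ℂ (W ⧸ (A ⊔ B)) + Module.finrank ℂ B := by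
  have h1 := (B.map A.mkQ).finrank_quotient_add_finrank
  have h2 : Module.finrank ℂ ((W ⧸ A) ⧸ B.map A.mkQ) = Module.finrank ℂ (W ⧸ (A ⊔ B)) := by
    have := (Submodule.quotientQuotientEquivQuotient A (A ⊔ B) le_sup_left).finrank_eq
    rwa [Submodule.map_sup, Submodule.mkQ_map_self, bot_sup_eq] at this
  have h3 := (A.mkQ ∘ₗ B.subtype).finrank_range_add_finrank_ker
  have h4 : (A.mkQ ∘ₗ B.subtype).range = B.map A.mkQ := by
    rw [LinearMap.range_comp, Submodule.range_subtype]
  have h5 : Module.finrank ℂ (A.mkQ ∘ₗ B.subtype).ker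
      = Module.finrank ℂ (A ⊓ B : Submodule ℂ W) := by
    have h6 : A.comap B.subtype = (A ⊓ B).comap B.subtype := by simp [Submodule.comap_inf]
    rw [LinearMap.ker_comp, Submodule.ker_mkQ, h6, (Submodule.comapSubtypeEquivOfLe inf_le_right).finrank_eq]
  rw [h4, h5] at h3
  omega

/-- S induces an isomorphism of W/(ran T + ker S) with ran S/ran ST, and the latter sits in Z/ran ST
with quotient Z/ran S. -/
theorem finrank_coker_comp (T : V →ₗ[ℂ] W) (S : W →ₗ[ℂ] Z) [FiniteDimensional ℂ (W ⧸ T.range)]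
    [FiniteDimensional ℂ (Z ⧸ S.range)] :
    FiniteDimensional ℂ (Z ⧸ (S ∘ₗ T).range) ∧
    Module.finrank ℂ (Z ⧸ (S ∘ₗ T).range) =
      Module.finrank ℂ (Z ⧸ S.range) + Module.finrank ℂ (W ⧸ (T.range ⊔ S.ker)) := by
  have hle : (S ∘ₗ T).range ≤ S.range := LinearMap.range_comp_le_range _ _
  set M := (S ∘ₗ T).range with hM
  let g : W →ₗ[ℂ] Z ⧸ M := M.mkQ ∘ₗ S
  have hgk : g.ker = T.range ⊔ S.ker := by
    rw [LinearMap.ker_comp, Submodule.ker_mkQ, hM, LinearMap.range_comp, Submodule.comap_map_eq]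
  have hgr : g.range = S.range.map M.mkQ := LinearMap.range_comp _ _
  have e1 : (W ⧸ (T.range ⊔ S.ker)) ≃ₗ[ℂ] (S.range.map M.mkQ) :=
    (Submodule.quotEquivOfEq _ _ hgk.symm).trans
      (g.quotKerEquivRange.trans (LinearEquiv.ofEq _ _ hgr))
  have e2 := Submodule.quotientQuotientEquivQuotient M S.range hle
  have f0 : Module.Finite ℂ (W ⧸ (T.range ⊔ S.ker)) :=
    Module.Finite.of_surjective (Submodule.factor (le_sup_left : T.range ≤ T.range ⊔ S.ker))
      (Submodule.factor_surjective _)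
  have f1 : Module.Finite ℂ (S.range.map M.mkQ) := Module.Finite.equiv e1
  have f2 : Module.Finite ℂ ((Z ⧸ M) ⧸ S.range.map M.mkQ) := Module.Finite.equiv e2.symm
  have f3 : FiniteDimensional ℂ (Z ⧸ M) := Module.Finite.of_submodule_quotient (S.range.map M.mkQ)
  refine ⟨f3, ?_⟩
  rw [← (S.range.map M.mkQ).finrank_quotient_add_finrank, e2.finrank_eq, e1.finrank_eq]

/-- The index is additive under composition. -/
theorem HasLinearIndex.comp {S : W →ₗ[ℂ] Z} {T : V →ₗ[ℂ] W} {m n : ℤ} (hS : HasLinearIndex S m)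
    (hT : HasLinearIndex T n) : HasLinearIndex (S ∘ₗ T) (m + n) := by
  have := hS.finite_ker
  have := hS.finite_coker
  have := hT.finite_ker
  have := hT.finite_coker
  obtain ⟨h1, h2⟩ := finrank_ker_comp T S
  obtain ⟨h3, h4⟩ := finrank_coker_comp T S
  have h5 := finrank_quotient_sup T.range S.ker
  refine ⟨h1, h3, ?_⟩
  have h6 := hS.index_eq
  have h7 := hT.index_eq
  omega

theorem hasLinearIndex_of_bijective {T : V →ₗ[ℂ] W} (h : Function.Bijective T) :
    HasLinearIndex T 0 := by
  have hk := LinearMap.ker_eq_bot.2 h.1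
  have hr := LinearMap.range_eq_top.2 h.2
  refine ⟨?_, ?_, ?_⟩
  · rw [hk]; infer_instance
  · rw [hr]; infer_instance
  · rw [hk, hr]
    have : Module.finrank ℂ (W ⧸ (⊤ : Submodule ℂ W)) = 0 := Module.finrank_zero_of_subsingleton
    simp [this]

theorem hasLinearIndex_of_finiteDimensional [FiniteDimensional ℂ V] (T : V →ₗ[ℂ] V) :
    HasLinearIndex T 0 := by
  refine ⟨inferInstance, inferInstance, ?_⟩
  have h1 := T.finrank_range_add_finrank_ker
  have h2 := T.range.finrank_quotient_add_finrank
  omega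

theorem HasLinearIndex.of_equiv {V' W' : Type*} [AddCommGroup V'] [Module ℂ V'] [AddCommGroup W']
    [Module ℂ W'] {T : V →ₗ[ℂ] W} {T' : V' →ₗ[ℂ] W'} {m : ℤ} (h : HasLinearIndex T m)
    (e₁ : T.ker ≃ₗ[ℂ] T'.ker) (e₂ : (W ⧸ T.range) ≃ₗ[ℂ] (W' ⧸ T'.range)) :
    HasLinearIndex T' m := by
  have := h.finite_ker
  have := h.finite_coker
  refine ⟨Module.Finite.equiv e₁, Module.Finite.equiv e₂, ?_⟩
  rw [← e₁.finrank_eq, ← e₂.finrank_eq, h.index_eq]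

/-- `1 + BA` and `1 + AB` have the same index. -/
theorem HasLinearIndex.id_add_comp_comm {A : W →ₗ[ℂ] V} {B : V →ₗ[ℂ] W} {m : ℤ}
    (h : HasLinearIndex (LinearMap.id + B ∘ₗ A) m) : HasLinearIndex (LinearMap.id + A ∘ₗ B) m := by
  have hAB : ∀ v, (LinearMap.id + A ∘ₗ B : V →ₗ[ℂ] V) v = v + A (B v) := fun v => rfl
  have hBA : ∀ w, (LinearMap.id + B ∘ₗ A : W →ₗ[ℂ] W) w = w + B (A w) := fun w => rfl
  -- A and -B induce mutually inverse maps: v + ABv = 0 means v = A(-Bv) on kernels, and v is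
  -- congruent to A(-Bv) modulo the range of 1 + AB on cokernels.
  refine h.of_equiv
    (LinearEquiv.ofLinearMap (A.restrict (fun w hw => ?_)) (-(B.restrict (fun v hv => ?_))) ?_ ?_)
    (LinearEquiv.ofLinearMap
      (Submodule.mapQ _ _ A ?_) (-(Submodule.mapQ _ _ B ?_)) ?_ ?_)
  · rw [LinearMap.mem_ker, hBA] at hw
    rw [LinearMap.mem_ker, hAB, ← map_add, hw, map_zero]
  · rw [LinearMap.mem_ker, hAB] at hv
    rw [LinearMap.mem_ker, hBA, ← map_add, hv, map_zero]
  · ext ⟨v, hv⟩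
    rw [LinearMap.mem_ker, hAB] at hv
    simpa using (eq_neg_of_add_eq_zero_left hv).symm
  · ext ⟨w, hw⟩
    rw [LinearMap.mem_ker, hBA] at hw
    simpa using (eq_neg_of_add_eq_zero_left hw).symm
  · rintro _ ⟨w, rfl⟩
    exact ⟨A w, by rw [hAB, hBA, map_add]⟩
  · rintro _ ⟨v, rfl⟩
    exact ⟨B v, by rw [hAB, hBA, map_add]⟩
  · ext v
    simp only [LinearMap.comp_neg, LinearMap.neg_apply, LinearMap.comp_apply,
      Submodule.mkQ_apply, Submodule.mapQ_apply, LinearMap.id_apply]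
    rw [← Submodule.Quotient.mk_neg, Submodule.Quotient.eq]
    refine ⟨-v, ?_⟩
    rw [hAB, map_neg, map_neg]; abel
  · ext w
    simp only [LinearMap.neg_comp, LinearMap.neg_apply, LinearMap.comp_apply,
      Submodule.mkQ_apply, Submodule.mapQ_apply, LinearMap.id_apply]
    rw [← Submodule.Quotient.mk_neg, Submodule.Quotient.eq]
    refine ⟨-w, ?_⟩
    rw [hBA, map_neg, map_neg]; abel

/-- Factor F through its range and exchange the factors: 1 + F has the index of an endomorphism of a
finite-dimensional space, which is 0. -/
theorem hasLinearIndex_id_add {F : V →ₗ[ℂ] V} (hF : F.HasFiniteRange) :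
    HasLinearIndex (LinearMap.id + F) 0 := by
  rw [LinearMap.hasFiniteRange_iff_range] at hF
  have := Module.Finite.iff_fg.2 hF
  have h : F = F.range.subtype ∘ₗ F.rangeRestrict := rfl
  rw [h]
  exact (hasLinearIndex_of_finiteDimensional _).id_add_comp_comm

end LinearIndex

/-! ### Fredholm index and its stability under limits of finite rank operators -/

section Fredholm

variable {X Y Z : Type*} [NormedAddCommGroup X] [NormedSpace ℂ X] [NormedAddCommGroup Y]
  [NormedSpace ℂ Y] [NormedAddCommGroup Z] [NormedSpace ℂ Z]

theorem hasFredholmIndex_iff {T : X →L[ℂ] Y} {m : ℤ} :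
    HasFredholmIndex T m ↔ T.IsFredholm ∧ HasLinearIndex T.toLinearMap m := by
  refine ⟨fun h => ⟨h.1, h.1.finite_ker, ?_, h.2⟩, fun h => ⟨h.1, h.2.3⟩⟩
  exact h.1.finite_coker

theorem HasFredholmIndex.comp {S : Y →L[ℂ] Z} {T : X →L[ℂ] Y} {m n : ℤ}
    (hS : HasFredholmIndex S m) (hT : HasFredholmIndex T n) :
    HasFredholmIndex (S ∘L T) (m + n) := by
  rw [hasFredholmIndex_iff] at *
  obtain ⟨s, hs⟩ := hS.1.exists_isQuasiInverse
  obtain ⟨t, ht⟩ := hT.1.exists_isQuasiInverse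
  exact ⟨ContinuousLinearMap.IsFredholm.of_isQuasiInverse (v := t ∘L s) (ht.comp hs),
    hS.2.comp hT.2⟩

/-- If w is a quasi-inverse of ST, then Tw is one of S because T is invertible modulo finite rank;
additivity is then solved for the index of S. -/
theorem HasFredholmIndex.of_comp {S : Y →L[ℂ] Z} {T : X →L[ℂ] Y} {m n : ℤ}
    (hST : HasFredholmIndex (S ∘L T) m) (hT : HasFredholmIndex T n) :
    HasFredholmIndex S (m - n) := by
  obtain ⟨w, hw⟩ := hST.1.exists_isQuasiInverse
  obtain ⟨t, ht⟩ := hT.1.exists_isQuasiInverse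
  have hf : S.IsFredholm := ContinuousLinearMap.IsFredholm.of_isQuasiInverse (v := T ∘L w)
    (LinearMap.IsQuasiInverse.of_comp_left ht hw)
  refine ⟨hf, ?_⟩
  have h1 := HasFredholmIndex.comp (⟨hf, rfl⟩ : HasFredholmIndex S _) hT
  have h2 := hST.2.symm.trans h1.2
  omega

theorem hasFredholmIndex_equiv (T : X ≃L[ℂ] Y) : HasFredholmIndex (T : X →L[ℂ] Y) 0 :=
  hasFredholmIndex_iff.2 ⟨ContinuousLinearMap.IsFredholm.of_isQuasiInverse (v := T.symm.toContinuousLinearMap)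
    T.toLinearEquiv.isQuasiInverse, hasLinearIndex_of_bijective T.bijective⟩

theorem IsUnit.hasFredholmIndex {T : X →L[ℂ] X} (h : IsUnit T) : HasFredholmIndex T 0 := by
  obtain ⟨u, rfl⟩ := h
  exact hasFredholmIndex_equiv (ContinuousLinearEquiv.ofUnit u)

theorem hasFredholmIndex_one_add {F : X →L[ℂ] X} (hF : F.toLinearMap.HasFiniteRange) :
    HasFredholmIndex (1 + F) 0 := by
  refine hasFredholmIndex_iff.2 ⟨ContinuousLinearMap.IsFredholm.of_isQuasiInverse (v := 1) ?_,
    hasLinearIndex_id_add hF⟩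
  have h1 : (1 + F).toLinearMap - LinearMap.id = F.toLinearMap := by
    ext x
    simp
  exact ⟨LinearMap.FiniteRangeSetoid.equiv_iff_hasFiniteRange.2 (h1 ▸ hF),
    LinearMap.FiniteRangeSetoid.equiv_iff_hasFiniteRange.2 (h1 ▸ hF)⟩

/-- The norm limits of finite rank operators. -/
def IsApproxFinite (K : X →L[ℂ] Y) : Prop :=
  K ∈ closure {F : X →L[ℂ] Y | F.toLinearMap.HasFiniteRange}

theorem isApproxFinite_iff {K : X →L[ℂ] Y} :
    IsApproxFinite K ↔ ∀ ε > 0, ∃ F : X →L[ℂ] Y, F.toLinearMap.HasFiniteRange ∧ ‖K - F‖ < ε := by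
  simp only [IsApproxFinite, Metric.mem_closure_iff, dist_eq_norm]
  rfl

theorem isApproxFinite_of_finiteRange {F : X →L[ℂ] Y} (hF : F.toLinearMap.HasFiniteRange) :
    IsApproxFinite F :=
  subset_closure hF

theorem isApproxFinite_zero : IsApproxFinite (0 : X →L[ℂ] Y) :=
  isApproxFinite_of_finiteRange LinearMap.HasFiniteRange.zero

theorem IsApproxFinite.add {K L : X →L[ℂ] Y} (hK : IsApproxFinite K) (hL : IsApproxFinite L) :
    IsApproxFinite (K + L) :=
  map_mem_closure₂ continuous_add hK hL fun _ ha _ hb => LinearMap.HasFiniteRange.add ha hb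

theorem IsApproxFinite.neg {K : X →L[ℂ] Y} (hK : IsApproxFinite K) : IsApproxFinite (-K) :=
  map_mem_closure continuous_neg hK fun _ ha => LinearMap.HasFiniteRange.neg ha

theorem IsApproxFinite.sub {K L : X →L[ℂ] Y} (hK : IsApproxFinite K) (hL : IsApproxFinite L) :
    IsApproxFinite (K - L) := by
  rw [sub_eq_add_neg]; exact hK.add hL.neg

theorem IsApproxFinite.comp_left {K : X →L[ℂ] Y} (hK : IsApproxFinite K) (A : Y →L[ℂ] Z) :
    IsApproxFinite (A ∘L K) :=
  map_mem_closure (f := fun T => A ∘L T) (by fun_prop) hK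
    fun F hF => LinearMap.HasFiniteRange.comp_left hF A.toLinearMap

theorem IsApproxFinite.comp_right {K : Y →L[ℂ] Z} (hK : IsApproxFinite K) (A : X →L[ℂ] Y) :
    IsApproxFinite (K ∘L A) :=
  map_mem_closure (f := fun T => T ∘L A) (by fun_prop) hK
    fun F hF => LinearMap.HasFiniteRange.comp_right hF A.toLinearMap

theorem IsApproxFinite.isCompactOperator [CompleteSpace Y] {K : X →L[ℂ] Y}
    (hK : IsApproxFinite K) : IsCompactOperator K := by
  have h := isClosed_setOfPred_isCompactOperator (σ₁₂ := RingHom.id ℂ) (M₁ := X) (M₂ := Y)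
  refine closure_minimal (fun F hF => ?_) h hK
  have hF' := LinearMap.hasFiniteRange_iff_range.1 hF
  have := Module.Finite.iff_fg.2 hF'
  have hc : IsCompactOperator (F.codRestrict F.range fun x => ⟨x, rfl⟩) :=
    isCompactOperator_of_locallyCompactSpace_dom _
  exact hc.clm_comp F.range.subtypeL

/-- Choose F of finite rank with ‖K - F‖ < 1. Then u = 1 + (K - F) is invertible by the Neumann
series and 1 + K = u(1 + u⁻¹F). -/
theorem IsApproxFinite.hasFredholmIndex_one_add [CompleteSpace X] {K : X →L[ℂ] X}
    (hK : IsApproxFinite K) : HasFredholmIndex (1 + K) 0 := by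
  obtain ⟨F, hF, hKF⟩ := isApproxFinite_iff.1 hK 1 one_pos
  have hu : IsUnit (1 + (K - F)) := by
    have h := isUnit_one_sub_of_norm_lt_one (x := -(K - F)) (by rwa [norm_neg])
    rwa [sub_neg_eq_add] at h
  obtain ⟨u, hu'⟩ := hu
  have h1 : 1 + K = (1 + (K - F)) ∘L (1 + (↑u⁻¹ : X →L[ℂ] X) ∘L F) := by
    change 1 + K = (1 + (K - F)) * (1 + (↑u⁻¹ : X →L[ℂ] X) * F)
    rw [← hu', mul_add, mul_one, Units.mul_inv_cancel_left, hu']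
    abel
  rw [h1]
  exact (IsUnit.hasFredholmIndex ⟨u, hu'⟩).comp
    (SUq2.hasFredholmIndex_one_add (LinearMap.HasFiniteRange.comp_left hF (↑u⁻¹ : X →L[ℂ] X).toLinearMap))

theorem HasFredholmIndex.exists_parametrix {T : X →L[ℂ] Y} {m : ℤ} (hT : HasFredholmIndex T m) :
    ∃ L : Y →L[ℂ] X, HasFredholmIndex L (-m) ∧
      (T ∘L L - 1).toLinearMap.HasFiniteRange := by
  obtain ⟨L, hL⟩ := hT.1.exists_isQuasiInverse
  have hfin : (T ∘L L - 1).toLinearMap.HasFiniteRange :=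
    LinearMap.FiniteRangeSetoid.equiv_iff_hasFiniteRange.1 hL.2
  have hLf : L.IsFredholm := ContinuousLinearMap.IsFredholm.of_isQuasiInverse hL.symm
  refine ⟨L, ⟨hLf, ?_⟩, hfin⟩
  have h0 := SUq2.hasFredholmIndex_one_add hfin
  rw [add_sub_cancel] at h0
  have h1 := hT.comp (⟨hLf, rfl⟩ : HasFredholmIndex L _)
  have h2 := h0.2.symm.trans h1.2
  omega

/-- The Fredholm index is stable under limits of finite rank operators. -/
theorem HasFredholmIndex.add_isApproxFinite [CompleteSpace X] [CompleteSpace Y] {T K : X →L[ℂ] Y}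
    {m : ℤ} (hT : HasFredholmIndex T m) (hK : IsApproxFinite K) : HasFredholmIndex (T + K) m := by
  obtain ⟨L, hL, hfin⟩ := hT.exists_parametrix
  -- For a parametrix L of T, (T + K)L is 1 plus a finite rank operator plus KL, hence has index 0;
  -- L has index -m.
  have h0 : HasFredholmIndex ((T + K) ∘L L) 0 := by
    have h := ((isApproxFinite_of_finiteRange hfin).add
      (hK.comp_right L)).hasFredholmIndex_one_add
    convert h using 1
    rw [ContinuousLinearMap.add_comp]; abel
  simpa using h0.of_comp hL

end Fredholm

/-! ### Compressions to closed subspaces -/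

section Compression

variable {H : Type*} [NormedAddCommGroup H] [InnerProductSpace ℂ H]

/-- A compression has the index of its extension by the identity. -/
theorem HasFredholmIndex.compress {K : Submodule ℂ H} [K.HasOrthogonalProjection]
    {T : H →L[ℂ] H} {m : ℤ}
    (h : HasFredholmIndex (K.starProjection * T * K.starProjection + (1 - K.starProjection)) m) :
    HasFredholmIndex (SUq2.compress K T) m := by
  set ι := K.subtypeL with hι
  set π := K.orthogonalProjectionOnto with hπ
  set C := SUq2.compress K T with hC
  set E := K.starProjection * T * K.starProjection + (1 - K.starProjection) with hE
  have hπι : ∀ x, π (ι x) = x := fun x => K.orthogonalProjectionOnto_mem_subspace_eq_self x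
  -- The inclusion and the projection intertwine E with the compression C, so a quasi-inverse w of E
  -- compresses to the quasi-inverse π w ι of C.
  have hEι : ∀ x, E (ι x) = ι (C x) := fun x => by
    have h1 : K.starProjection (ι x) = ι x := K.starProjection_mem_subspace_eq_self x
    change K.starProjection (T (K.starProjection (ι x))) + (ι x - K.starProjection (ι x)) = _
    rw [h1, sub_self, add_zero]
    rfl
  have hπE : ∀ x, π (E x) = C (π x) := fun x => by
    have h1 : π (K.starProjection x) = π x := hπι _
    change π (K.starProjection (T (K.starProjection x)) + (x - K.starProjection x)) = _
    rw [map_add, map_sub, h1, sub_self, add_zero]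
    exact hπι _
  rw [hasFredholmIndex_iff] at h ⊢
  obtain ⟨w, hw⟩ := h.1.exists_isQuasiInverse
  have hw1 : (w ∘L E - 1).toLinearMap.HasFiniteRange :=
    LinearMap.FiniteRangeSetoid.equiv_iff_hasFiniteRange.1 hw.1
  have hw2 : (E ∘L w - 1).toLinearMap.HasFiniteRange :=
    LinearMap.FiniteRangeSetoid.equiv_iff_hasFiniteRange.1 hw.2
  refine ⟨ContinuousLinearMap.IsFredholm.of_isQuasiInverse (v := π ∘L w ∘L ι)
    ⟨LinearMap.FiniteRangeSetoid.equiv_iff_hasFiniteRange.2 ?_,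
      LinearMap.FiniteRangeSetoid.equiv_iff_hasFiniteRange.2 ?_⟩, ?_⟩
  · have h1 : (π ∘L w ∘L ι).toLinearMap ∘ₗ C.toLinearMap - LinearMap.id =
        π.toLinearMap ∘ₗ (w ∘L E - 1).toLinearMap ∘ₗ ι.toLinearMap := by
      refine LinearMap.ext fun x => ?_
      change π (w (ι (C x))) - x = π (w (E (ι x)) - ι x)
      rw [map_sub, hπι, hEι]
    rw [h1]
    exact (hw1.comp_right _).comp_left _
  · have h1 : C.toLinearMap ∘ₗ (π ∘L w ∘L ι).toLinearMap - LinearMap.id =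
        π.toLinearMap ∘ₗ (E ∘L w - 1).toLinearMap ∘ₗ ι.toLinearMap := by
      refine LinearMap.ext fun x => ?_
      change C (π (w (ι x))) - x = π (E (w (ι x)) - ι x)
      rw [map_sub, hπι, hπE]
    rw [h1]
    exact (hw2.comp_right _).comp_left _
  -- E = 1 + ι((C - 1)π) while C = 1 + ((C - 1)π)ι, so exchanging the two factors identifies the
  -- indices.
  · have h1 : E.toLinearMap = LinearMap.id + ι.toLinearMap ∘ₗ ((C - 1) ∘L π).toLinearMap := by
      refine LinearMap.ext fun x => ?_
      change E x = x + ι (C (π x) - π x)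
      rw [map_sub, ← hEι]
      have h2 : ι (π x) = K.starProjection x := rfl
      have h3 : K.starProjection (K.starProjection x) = K.starProjection x :=
        K.starProjection_mem_subspace_eq_self (π x)
      rw [h2]
      change K.starProjection (T (K.starProjection x)) + (x - K.starProjection x) = x +
        ((K.starProjection (T (K.starProjection (K.starProjection x))) +
          (K.starProjection x - K.starProjection (K.starProjection x))) - K.starProjection x)
      rw [h3]; abel
    have h2 : C.toLinearMap = LinearMap.id + ((C - 1) ∘L π).toLinearMap ∘ₗ ι.toLinearMap := by
      refine LinearMap.ext fun x => ?_
      change C x = x + (C (π (ι x)) - π (ι x))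
      rw [hπι]; abel
    rw [h2]
    exact HasLinearIndex.id_add_comp_comm (h1 ▸ h.2)

end Compression

/-! ### Diagonal operators, shifts and row projections in coordinates -/

theorem inner_e (x : Idx) (v : L2h) : inner ℂ (e x) v = v x := by
  classical
  rw [e, lp.inner_single_left]
  simp

theorem e_apply [DecidableEq Idx] (x y : Idx) : e x y = if y = x then 1 else 0 := by
  rw [← inner_e, orthonormal_iff_ite.1 orthonormal_e]

theorem hasSum_e (v : L2h) : HasSum (fun x => v x • e x) v := by
  classical
  have h := lp.hasSum_single (p := 2) (by simp) v
  convert h using 2 with x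
  ext y
  rw [lp.coeFn_smul, Pi.smul_apply, e_apply, lp.single_apply]
  by_cases h : y = x
  · subst h; simp
  · simp [h]

/-- A closed subspace that contains the basis vectors of the support of `v` contains `v`. -/
theorem mem_of_isClosed_of_e_mem {W : Submodule ℂ L2h} (hW : IsClosed (W : Set L2h)) (v : L2h)
    (h : ∀ x, v x ≠ 0 → e x ∈ W) : v ∈ W := by
  refine hW.mem_of_tendsto (hasSum_e v) (Filter.Eventually.of_forall fun s => ?_)
  refine Submodule.sum_mem _ fun x _ => ?_
  by_cases hx : v x = 0
  · rw [hx, zero_smul]; exact W.zero_mem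
  · exact W.smul_mem _ (h x hx)

theorem clm_ext_e {E : Type*} [NormedAddCommGroup E] [NormedSpace ℂ E] {S T : L2h →L[ℂ] E}
    (h : ∀ x, S (e x) = T (e x)) : S = T := by
  ext v
  refine (mem_of_isClosed_of_e_mem (W := (S - T).ker) (S - T).isClosed_ker v fun x _ => ?_ :
    v ∈ (S - T).ker) |> fun hv => sub_eq_zero.1 hv
  exact sub_eq_zero.2 (h x)

theorem diagOp_apply {w : Idx → ℝ} (h : ∃ C, ∀ x, |w x| ≤ C) (v : L2h) (x : Idx) :
    diagOp w v x = (w x : ℂ) * v x := by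
  rw [diagOp, dif_pos h, LinearMap.mkContinuous_apply]
  rfl

theorem shift_apply_up (s t : Fin 2) (v : L2h) (x : Idx) : shift s t v (up s t x) = v x := by
  rw [← inner_e, ← shift_e]
  change inner ℂ (isometryOf _ (up_injective s t) (e x)) (isometryOf _ (up_injective s t) v) = _
  rw [LinearIsometry.inner_map_map, inner_e]

theorem adjoint_shift_apply (s t : Fin 2) (v : L2h) (x : Idx) :
    ContinuousLinearMap.adjoint (shift s t) v x = v (up s t x) := by
  rw [← inner_e, ContinuousLinearMap.adjoint_inner_right, shift_e, inner_e]

theorem shift_apply_of_notMem (s t : Fin 2) (v : L2h) (x : Idx) (hx : x ∉ Set.range (up s t)) :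
    shift s t v x = 0 := by
  rw [← inner_e, ← ContinuousLinearMap.adjoint_inner_left, adjoint_shift_e_of_notMem s t x hx,
    inner_zero_left]

theorem adjoint_shift_comp_shift (s t : Fin 2) : star (shift s t) * shift s t = 1 := by
  ext v x
  exact (adjoint_shift_apply s t _ x).trans (shift_apply_up s t v x)

theorem star_diagOp (w : Idx → ℝ) : star (diagOp w) = diagOp w := by
  by_cases h : ∃ C, ∀ x, |w x| ≤ C
  · refine clm_ext_e fun x => ?_
    ext y
    classical
    rw [ContinuousLinearMap.star_eq_adjoint, ← inner_e, ContinuousLinearMap.adjoint_inner_right,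
      diagOp_e h, diagOp_e h, inner_smul_left, inner_e, lp.coeFn_smul, Pi.smul_apply, e_apply]
    by_cases hxy : y = x
    · subst hxy; simp
    · simp [hxy]
  · rw [diagOp, dif_neg h, star_zero]

theorem norm_diagOp_le {w : Idx → ℝ} {C : ℝ} (hC : 0 ≤ C) (h : ∀ x, |w x| ≤ C) :
    ‖diagOp w‖ ≤ C := by
  refine ContinuousLinearMap.opNorm_le_bound _ hC fun v => ?_
  have h1 : ‖((C : ℂ) • v : L2h)‖ = C * ‖v‖ := by
    rw [norm_smul, Complex.norm_real, Real.norm_of_nonneg hC]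
  rw [← h1]
  refine lp.norm_mono (by simp) fun x => ?_
  rw [diagOp_apply ⟨C, h⟩, lp.coeFn_smul, Pi.smul_apply, smul_eq_mul, norm_mul, norm_mul,
    Complex.norm_real, Complex.norm_real]
  exact mul_le_mul_of_nonneg_right ((h x).trans (le_abs_self C)) (norm_nonneg _)

theorem norm_shift_le (s t : Fin 2) : ‖shift s t‖ ≤ 1 :=
  LinearIsometry.norm_toContinuousLinearMap_le _

theorem diagOp_mul_diagOp {w w' : Idx → ℝ} (h : ∃ C, ∀ x, |w x| ≤ C) (h' : ∃ C, ∀ x, |w' x| ≤ C) :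
    diagOp w * diagOp w' = diagOp (fun x => w x * w' x) := by
  have h2 : ∃ C, ∀ x, |w x * w' x| ≤ C := by
    obtain ⟨C, hC⟩ := h
    obtain ⟨C', hC'⟩ := h'
    refine ⟨C * C', fun x => ?_⟩
    rw [abs_mul]
    exact mul_le_mul (hC x) (hC' x) (abs_nonneg _) ((abs_nonneg _).trans (hC x))
  ext v x
  rw [mul_apply_eq_comp, diagOp_apply h, diagOp_apply h', diagOp_apply h2]
  push_cast
  ring

theorem diagOp_add_diagOp {w w' : Idx → ℝ} (h : ∃ C, ∀ x, |w x| ≤ C) (h' : ∃ C, ∀ x, |w' x| ≤ C) :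
    diagOp w + diagOp w' = diagOp (fun x => w x + w' x) := by
  have h2 : ∃ C, ∀ x, |w x + w' x| ≤ C := by
    obtain ⟨C, hC⟩ := h
    obtain ⟨C', hC'⟩ := h'
    exact ⟨C + C', fun x => (abs_add_le _ _).trans (add_le_add (hC x) (hC' x))⟩
  ext v x
  rw [_root_.add_apply, lp.coeFn_add, Pi.add_apply, diagOp_apply h, diagOp_apply h',
    diagOp_apply h2]
  push_cast
  ring

open scoped Classical in
/-- The orthogonal projection onto the closed span of the `e x`, `x ∈ A`. -/
noncomputable def indOp (A : Set Idx) : L2h →L[ℂ] L2h := diagOp (A.indicator 1)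

theorem indicator_bounded (A : Set Idx) : ∃ C, ∀ x, |A.indicator (1 : Idx → ℝ) x| ≤ C := by
  classical
  refine ⟨1, fun x => ?_⟩
  rw [Set.indicator_apply]
  split_ifs <;> simp

theorem indOp_apply_of_mem {A : Set Idx} {x : Idx} (hx : x ∈ A) (v : L2h) : indOp A v x = v x := by
  rw [indOp, diagOp_apply (indicator_bounded A), Set.indicator_of_mem hx]
  simp

theorem indOp_apply_of_notMem {A : Set Idx} {x : Idx} (hx : x ∉ A) (v : L2h) :
    indOp A v x = 0 := by
  rw [indOp, diagOp_apply (indicator_bounded A), Set.indicator_of_notMem hx]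
  simp

/-- The restriction of v to the labels in A lies in W by closedness, and the remainder is supported
where all elements of W vanish. This makes both `P` and the spectral projections diagonal. -/
theorem starProjection_eq_indOp (W : Submodule ℂ L2h) [W.HasOrthogonalProjection]
    (hW : IsClosed (W : Set L2h)) (A : Set Idx) (h1 : ∀ x ∈ A, e x ∈ W)
    (h2 : ∀ v ∈ W, ∀ x ∉ A, v x = 0) : W.starProjection = indOp A := by
  ext1 v
  refine (Submodule.eq_starProjection_of_mem_of_inner_eq_zero ?_ fun w hw => ?_)
  · refine mem_of_isClosed_of_e_mem hW _ fun x hx => ?_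
    by_cases hA : x ∈ A
    · exact h1 x hA
    · exact absurd (indOp_apply_of_notMem hA v) hx
  · rw [lp.inner_eq_tsum]
    refine (tsum_congr fun x => ?_).trans tsum_zero
    by_cases hA : x ∈ A
    · rw [lp.coeFn_sub, Pi.sub_apply, indOp_apply_of_mem hA, sub_self, inner_zero_left]
    · rw [h2 w hw x hA, inner_zero_right]

theorem apply_eq_zero_of_mem_closure_span {S : Set L2h} {x : Idx} (hS : ∀ v ∈ S, v x = 0)
    {v : L2h} (hv : v ∈ (Submodule.span ℂ S).topologicalClosure) : v x = 0 := by
  have hle : (Submodule.span ℂ S).topologicalClosure ≤ (innerSL ℂ (e x)).ker := by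
    refine Submodule.topologicalClosure_minimal _ (Submodule.span_le.2 fun u hu => ?_)
      (innerSL ℂ (e x)).isClosed_ker
    exact (inner_e x u).trans (hS u hu)
  exact (inner_e x v).symm.trans (hle hv)

/-- Labels with `n - i = k`. -/
def row (k : ℕ) : Set Idx := {x | x.I + k = x.N}

theorem P_eq_indOp (k : ℕ) : P k = indOp (row k) := by
  classical
  refine starProjection_eq_indOp (rowSpace k) (Submodule.isClosed_topologicalClosure _) _
    (fun x hx => Submodule.le_topologicalClosure _ (Submodule.subset_span ⟨x, hx, rfl⟩))
    fun v hv x hx => apply_eq_zero_of_mem_closure_span ?_ hv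
  rintro _ ⟨y, hy, rfl⟩
  rw [e_apply, if_neg]
  rintro rfl
  exact hx hy

theorem hasFiniteRange_diagOp {w : Idx → ℝ} (hw : ∃ C, ∀ x, |w x| ≤ C)
    (h : {x | w x ≠ 0}.Finite) : (diagOp w).toLinearMap.HasFiniteRange := by
  rw [LinearMap.hasFiniteRange_iff_range]
  have hfg : (Submodule.span ℂ (e '' {x | w x ≠ 0})).FG := Submodule.fg_span (h.image _)
  have := Module.Finite.iff_fg.2 hfg
  have hle : (diagOp w).toLinearMap.range ≤ Submodule.span ℂ (e '' {x | w x ≠ 0}) := by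
    rintro _ ⟨v, rfl⟩
    refine mem_of_isClosed_of_e_mem (Submodule.closed_of_finiteDimensional _) _ fun x hx => ?_
    refine Submodule.subset_span ⟨x, fun h0 => hx ?_, rfl⟩
    exact (diagOp_apply hw v x).trans (by rw [h0]; simp)
  exact Submodule.FG.of_le hfg hle

/-- Discarding the weights of modulus below ε/2 leaves a finite rank operator and costs at most ε/2
in norm. -/
theorem isApproxFinite_diagOp {w : Idx → ℝ} (hw : ∃ C, ∀ x, |w x| ≤ C)
    (h : ∀ ε > 0, {x | ε ≤ |w x|}.Finite) : IsApproxFinite (diagOp w) := by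
  classical
  refine isApproxFinite_iff.2 fun ε hε => ?_
  have h1 : ∀ x, |if ε / 2 ≤ |w x| then w x else 0| ≤ |w x| := fun x => by
    split_ifs <;> simp
  obtain ⟨C, hC⟩ := hw
  have hw1 : ∃ C, ∀ x, |if ε / 2 ≤ |w x| then w x else 0| ≤ C := ⟨C, fun x => (h1 x).trans (hC x)⟩
  refine ⟨_, hasFiniteRange_diagOp hw1 ((h (ε / 2) (half_pos hε)).subset fun x hx => ?_), ?_⟩
  · by_contra hx'
    exact hx (if_neg hx')
  · have h2 : ∀ x, |w x - if ε / 2 ≤ |w x| then w x else 0| ≤ ε / 2 := fun x => by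
      split_ifs with h3
      · rw [sub_self, abs_zero]; exact (half_pos hε).le
      · rw [sub_zero]; exact (not_le.1 h3).le
    have h3 : diagOp w - diagOp (fun x => if ε / 2 ≤ |w x| then w x else 0) =
        diagOp (fun x => w x - if ε / 2 ≤ |w x| then w x else 0) := by
      ext v x
      rw [_root_.sub_apply, lp.coeFn_sub, Pi.sub_apply, diagOp_apply ⟨C, hC⟩, diagOp_apply hw1,
        diagOp_apply ⟨_, h2⟩]
      push_cast
      ring
    rw [h3]
    exact (norm_diagOp_le (half_pos hε).le h2).trans_lt (half_lt_self hε)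

theorem indOp_e_of_mem {A : Set Idx} {x : Idx} (hx : x ∈ A) : indOp A (e x) = e x := by
  rw [indOp, diagOp_e (indicator_bounded A), Set.indicator_of_mem hx]
  simp

theorem indOp_e_of_notMem {A : Set Idx} {x : Idx} (hx : x ∉ A) : indOp A (e x) = 0 := by
  rw [indOp, diagOp_e (indicator_bounded A), Set.indicator_of_notMem hx]
  simp

theorem star_indOp (A : Set Idx) : star (indOp A) = indOp A := star_diagOp _

theorem indOp_mul_indOp (A B : Set Idx) : indOp A * indOp B = indOp (A ∩ B) := by
  refine clm_ext_e fun x => ?_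
  rw [mul_apply_eq_comp]
  by_cases hB : x ∈ B
  · rw [indOp_e_of_mem hB]
    by_cases hA : x ∈ A
    · rw [indOp_e_of_mem hA, indOp_e_of_mem (Set.mem_inter hA hB)]
    · rw [indOp_e_of_notMem hA, indOp_e_of_notMem fun h => hA h.1]
  · rw [indOp_e_of_notMem hB, map_zero, indOp_e_of_notMem fun h => hB h.2]

theorem shift_mul_indOp (s t : Fin 2) {A B : Set Idx} (h : ∀ x, x ∈ A ↔ up s t x ∈ B) :
    shift s t * indOp A = indOp B * shift s t := by
  refine clm_ext_e fun x => ?_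
  rw [mul_apply_eq_comp, mul_apply_eq_comp, shift_e]
  by_cases hA : x ∈ A
  · rw [indOp_e_of_mem hA, shift_e, indOp_e_of_mem ((h x).1 hA)]
  · rw [indOp_e_of_notMem hA, map_zero, indOp_e_of_notMem fun hB => hA ((h x).2 hB)]

theorem diagOp_mul_indOp_comm (w : Idx → ℝ) (A : Set Idx) :
    diagOp w * indOp A = indOp A * diagOp w := by
  by_cases h : ∃ C, ∀ x, |w x| ≤ C
  · rw [indOp, diagOp_mul_diagOp h (indicator_bounded A),
      diagOp_mul_diagOp (indicator_bounded A) h]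
    simp only [mul_comm]
  · rw [diagOp, dif_neg h, zero_mul, mul_zero]

/-- `shift 1 0` raises N and I together, so it keeps n - i. -/
theorem commute_P_shift_one_zero (k : ℕ) : Commute (P k) (shift 1 0) := by
  rw [P_eq_indOp]
  refine (shift_mul_indOp 1 0 fun x => ?_).symm
  simp only [row, up, Set.mem_ofPred_eq, Fin.val_one]
  omega

theorem commute_P_diagOp (k : ℕ) (w : Idx → ℝ) : Commute (P k) (diagOp w) := by
  rw [P_eq_indOp]
  exact (diagOp_mul_indOp_comm w _).symm

theorem star_P (k : ℕ) : star (P k) = P k := by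
  rw [P_eq_indOp, star_indOp]

theorem P_mul_P_self (k : ℕ) : P k * P k = P k := by
  rw [P_eq_indOp, indOp_mul_indOp, Set.inter_self]

theorem P_mul_P_of_ne {k l : ℕ} (h : k ≠ l) : P k * P l = 0 := by
  rw [P_eq_indOp, P_eq_indOp, indOp_mul_indOp]
  refine clm_ext_e fun x => indOp_e_of_notMem ?_
  simp only [row, Set.mem_inter_iff, Set.mem_ofPred_eq]
  omega

/-- `shift 0 1` raises N and keeps I, so it moves row k to row k + 1. -/
theorem shift_zero_one_mul_P (k : ℕ) : shift 0 1 * P k = P (k + 1) * shift 0 1 := by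
  rw [P_eq_indOp, P_eq_indOp]
  refine shift_mul_indOp 0 1 fun x => ?_
  simp only [row, up, Set.mem_ofPred_eq, Fin.val_zero]
  omega

/-! ### Decay of the coefficients of β along a row -/

theorem finite_N_le (M : ℕ) : {x : Idx | x.N ≤ M}.Finite := by
  have hinj : Function.Injective fun x : Idx => (x.N, x.I, x.J) := by
    intro x y h
    simp only [Prod.mk.injEq] at h
    ext <;> omega
  refine Set.Finite.of_finite_image (f := fun x : Idx => (x.N, x.I, x.J))
    (((Set.finite_Iic M).prod ((Set.finite_Iic M).prod (Set.finite_Iic M))).subset ?_)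
    hinj.injOn
  rintro _ ⟨x, hx, rfl⟩
  exact ⟨hx, x.hI.trans hx, x.hJ.trans hx⟩

/-- A diagonal operator whose weights decay like `q^{n+i}` is compact on each row. -/
theorem isApproxFinite_diagOp_mul_P {q : ℝ} (h0 : 0 < q) (h1 : q < 1) {w : Idx → ℝ} {C : ℝ}
    (hw : ∀ x, |w x| ≤ C * q ^ x.I) (k : ℕ) : IsApproxFinite (diagOp w * P k) := by
  classical
  have hC : ∀ x, |w x| ≤ |C| := fun x => (hw x).trans <| by
    have h2 : q ^ x.I ≤ 1 := pow_le_one₀ h0.le h1.le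
    have h3 : 0 ≤ q ^ x.I := by positivity
    calc C * q ^ x.I ≤ |C| * q ^ x.I := mul_le_mul_of_nonneg_right (le_abs_self C) h3
      _ ≤ |C| := mul_le_of_le_one_right (abs_nonneg C) h2
  rw [P_eq_indOp, indOp, diagOp_mul_diagOp ⟨_, hC⟩ (indicator_bounded _)]
  have hle : ∀ x, |w x * (row k).indicator (1 : Idx → ℝ) x| ≤ |w x| := fun x => by
    rw [Set.indicator_apply]
    split_ifs <;> simp
  refine isApproxFinite_diagOp ⟨_, fun x => (hle x).trans (hC x)⟩ fun ε hε => ?_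
  -- Once |C| q^M < ε, a weight of modulus at least ε forces I < M; on row k this gives N = I + k ≤
  -- M + k. The added 1 in the denominator covers C = 0.
  obtain ⟨M, hM⟩ := exists_pow_lt_of_lt_one (div_pos hε (by positivity : 0 < |C| + 1)) h1
  refine (finite_N_le (M + k)).subset fun x hx => ?_
  rw [Set.mem_ofPred_eq] at hx
  have hrow : x ∈ row k := by
    by_contra hr
    rw [Set.indicator_of_notMem hr, mul_zero, abs_zero] at hx
    exact absurd hx (not_le.2 hε)
  have hrow' : x.I + k = x.N := hrow
  have h5 : x.I < M := by
    by_contra hI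
    have h3 : q ^ x.I ≤ q ^ M := pow_le_pow_of_le_one h0.le h1.le (not_lt.1 hI)
    have h4 : ε ≤ |C| * q ^ x.I := (hx.trans (hle x)).trans ((hw x).trans
      (mul_le_mul_of_nonneg_right (le_abs_self C) (by positivity)))
    rw [lt_div_iff₀ (by positivity)] at hM
    have h6 : 0 < q ^ M := by positivity
    nlinarith [abs_nonneg C]
  change x.N ≤ M + k
  omega

/-- Write b_+ = -q^J √ρ with 1 - (a + b) ≤ ρ ≤ 1, where a = q^{2(N-J)+2} and b = q^{2I+2}. On [0,1]
one has √ρ ≥ ρ, so 1 - √ρ ≤ a + b; and q^J a and q^J b are each at most q^I because I, J ≤ N. -/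
theorem abs_bPlus_add_le {q : ℝ} (h0 : 0 < q) (h1 : q < 1) (x : Idx) :
    |bPlus q x + q ^ x.J| ≤ 2 * q ^ x.I := by
  have hI := x.hI
  have hJ := x.hJ
  have n := one_sub_pow_nonneg h0 h1
  have p1 := fun k : ℕ => pow_le_one₀ (n := k) h0.le h1.le
  have p0 := fun k : ℕ => pow_pos h0 k
  have hN : ∀ k : ℕ, 0 < 1 - q ^ (k + 2) := fun k =>
    sub_pos.2 (pow_lt_one₀ h0.le h1 (by omega))
  set a := q ^ (2 * (x.N - x.J) + 2) with ha
  set b := q ^ (2 * x.I + 2) with hb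
  set ρ := (1 - a) * (1 - b) / ((1 - q ^ (2 * x.N + 2)) * (1 - q ^ (2 * x.N + 4))) with hρ
  have hden : 0 < (1 - q ^ (2 * x.N + 2)) * (1 - q ^ (2 * x.N + 4)) :=
    mul_pos (hN _) (hN (2 * x.N + 2))
  have hρ0 : 0 ≤ ρ := div_nonneg (mul_nonneg (n _) (n _)) hden.le
  have hρ1 : ρ ≤ 1 := div_le_one_of_le₀ (mul_le_mul (one_sub_pow_le h0 h1 (by omega))
    (one_sub_pow_le h0 h1 (by omega)) (n _) (n _)) hden.le
  have hρ2 : 1 - (a + b) ≤ ρ := by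
    rw [hρ, le_div_iff₀ hden]
    have hd1 : (1 - q ^ (2 * x.N + 2)) * (1 - q ^ (2 * x.N + 4)) ≤ 1 :=
      mul_le_one₀ (by linarith [p0 (2 * x.N + 2)]) (n _) (by linarith [p0 (2 * x.N + 4)])
    have ha0 : 0 < a := p0 _
    have hb0 : 0 < b := p0 _
    by_cases hneg : 1 - (a + b) ≤ 0
    · have : 0 ≤ (1 - a) * (1 - b) := mul_nonneg (n _) (n _)
      nlinarith
    · nlinarith
  have hb' : bPlus q x = -(q ^ x.J * Real.sqrt ρ) := by
    rw [bPlus, Real.sqrt_mul (by positivity), mul_comm 2 x.J, pow_mul,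
      Real.sqrt_sq (by positivity)]
  have hs0 := Real.sqrt_nonneg ρ
  have hs1 : ρ ≤ Real.sqrt ρ := by
    nlinarith [Real.sq_sqrt hρ0, Real.sqrt_le_one.2 hρ1]
  have hs2 : Real.sqrt ρ ≤ 1 := Real.sqrt_le_one.2 hρ1
  have hq := p0 x.J
  rw [hb', show -(q ^ x.J * Real.sqrt ρ) + q ^ x.J = q ^ x.J * (1 - Real.sqrt ρ) by ring,
    abs_of_nonneg (mul_nonneg hq.le (by linarith))]
  have h2 : q ^ x.J * a ≤ q ^ x.I := by
    rw [ha, ← pow_add]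
    exact pow_le_pow_of_le_one h0.le h1.le (by omega)
  have h3 : q ^ x.J * b ≤ q ^ x.I :=
    (mul_le_of_le_one_left (p0 _).le (p1 _)).trans
      (pow_le_pow_of_le_one h0.le h1.le (by omega))
  calc q ^ x.J * (1 - Real.sqrt ρ) ≤ q ^ x.J * (a + b) :=
        mul_le_mul_of_nonneg_left (by linarith) hq.le
    _ ≤ 2 * q ^ x.I := by linarith

theorem abs_bMinus_le {q : ℝ} (h0 : 0 < q) (h1 : q < 1) (x : Idx) :
    |bMinus q x| ≤ 1 * q ^ x.I := by
  have hI := x.hI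
  have hJ := x.hJ
  have n := one_sub_pow_nonneg h0 h1
  rw [bMinus, Real.sqrt_mul (by positivity), mul_comm 2 x.I, pow_mul,
      Real.sqrt_sq (by positivity), abs_mul, abs_of_nonneg (by positivity), mul_comm]
  refine mul_le_mul_of_nonneg_right ?_ (by positivity)
  rw [← one_mul (_ / _)]
  exact coeff_le_one le_rfl (n _) (one_sub_pow_le h0 h1 (by omega)) (n _)
    (one_sub_pow_le h0 h1 (by omega))

/-! ### Asymptotic equality on rows, and the model of γ_r -/

/-- `x` is a limit of finite rank operators plus `y` on the range of `p`, which reduces `y`. -/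
structure AsympOn (p x y : L2h →L[ℂ] L2h) : Prop where
  approx : IsApproxFinite ((x - y) * p)
  comm : Commute p y

namespace AsympOn

variable {p x y x' y' : L2h →L[ℂ] L2h}

theorem one : AsympOn p 1 1 := ⟨by rw [sub_self, zero_mul]; exact isApproxFinite_zero,
  Commute.one_right p⟩

theorem add (h : AsympOn p x y) (h' : AsympOn p x' y') : AsympOn p (x + x') (y + y') := by
  refine ⟨?_, h.comm.add_right h'.comm⟩
  rw [add_sub_add_comm, add_mul]
  exact h.approx.add h'.approx

theorem sub (h : AsympOn p x y) (h' : AsympOn p x' y') : AsympOn p (x - x') (y - y') := by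
  refine ⟨?_, h.comm.sub_right h'.comm⟩
  rw [sub_sub_sub_comm, sub_mul]
  exact h.approx.sub h'.approx

/-- Commutation of p with y' lets p reach x - y in the second term of x(x' - y')p + (x - y)y'p; this
is why reduction by p is part of the structure. -/
theorem mul (h : AsympOn p x y) (h' : AsympOn p x' y') : AsympOn p (x * x') (y * y') := by
  refine ⟨?_, h.comm.mul_right h'.comm⟩
  have h1 : (x * x' - y * y') * p = x * ((x' - y') * p) + (x - y) * p * y' := by
    rw [mul_assoc (x - y), h'.comm.eq]; noncomm_ring
  rw [h1]
  exact (h'.approx.comp_left x).add (h.approx.comp_right y')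

theorem pow (h : AsympOn p x y) (r : ℕ) : AsympOn p (x ^ r) (y ^ r) := by
  induction r with
  | zero => rw [pow_zero, pow_zero]; exact one
  | succ r ih => rw [pow_succ, pow_succ]; exact ih.mul h

end AsympOn

/-- The operator `e^{(n)}_{ij} ↦ -q^{n+j} e^{(n+1/2)}_{i+1/2,j-1/2}`. -/
noncomputable def betaModel (q : ℝ) : L2h →L[ℂ] L2h := -(shift 1 0 * diagOp fun x => q ^ x.J)

theorem pow_bounded {q : ℝ} (h0 : 0 < q) (h1 : q < 1) (f : Idx → ℕ) :
    ∃ C, ∀ x : Idx, |q ^ f x| ≤ C :=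
  ⟨1, fun x => by rw [abs_of_pos (pow_pos h0 _)]; exact pow_le_one₀ h0.le h1.le⟩

theorem commute_P_betaModel (q : ℝ) (k : ℕ) : Commute (P k) (betaModel q) :=
  ((commute_P_shift_one_zero k).mul_right (commute_P_diagOp k _)).neg_right

theorem beta_sub_betaModel {q : ℝ} (h0 : 0 < q) (h1 : q < 1) :
    beta q - betaModel q = shift 1 0 * diagOp (fun x => bPlus q x + q ^ x.J) +
      star (shift 0 1) * diagOp (bMinus q) := by
  rw [← diagOp_add_diagOp ⟨1, fun x => (coefficients_bounded h0 h1 x).2.2.1⟩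
    (pow_bounded h0 h1 _), mul_add, betaModel, sub_neg_eq_add]
  change shift 1 0 * diagOp (bPlus q) + star (shift 0 1) * diagOp (bMinus q) + _ = _
  abel

theorem asympOn_beta {q : ℝ} (h0 : 0 < q) (h1 : q < 1) (k : ℕ) :
    AsympOn (P k) (beta q) (betaModel q) := by
  refine ⟨?_, commute_P_betaModel q k⟩
  rw [beta_sub_betaModel h0 h1, add_mul, mul_assoc, mul_assoc]
  exact ((isApproxFinite_diagOp_mul_P h0 h1 (abs_bPlus_add_le h0 h1) k).comp_left _).add
    ((isApproxFinite_diagOp_mul_P h0 h1 (abs_bMinus_le h0 h1) k).comp_left _)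

/-- Taking adjoints puts the weights on the left of the shifts, so the row projection must pass
through them. The b_- part of β* raises n - i by one, so its decay is used on row k + 1. -/
theorem asympOn_star_beta {q : ℝ} (h0 : 0 < q) (h1 : q < 1) (k : ℕ) :
    AsympOn (P k) (star (beta q)) (star (betaModel q)) := by
  refine ⟨?_, ?_⟩
  · rw [← star_sub, beta_sub_betaModel h0 h1, star_add, star_mul, star_mul, star_star, star_diagOp,
      star_diagOp, add_mul, mul_assoc, mul_assoc, shift_zero_one_mul_P]
    have hS : star (shift 1 0) * P k = P k * star (shift 1 0) := by
      have := congrArg star (commute_P_shift_one_zero k).eq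
      rwa [star_mul, star_mul, star_P] at this
    rw [hS, ← mul_assoc, ← mul_assoc]
    exact ((isApproxFinite_diagOp_mul_P h0 h1 (abs_bPlus_add_le h0 h1) k).comp_right _).add
      ((isApproxFinite_diagOp_mul_P h0 h1 (abs_bMinus_le h0 h1) (k + 1)).comp_right _)
  · have := congrArg star (commute_P_betaModel q k).eq
    rw [star_mul, star_mul, star_P] at this
    exact this.symm

/-- The model `1 - q^{2r(n+j)} (1 + q^{n+j} S)` of `γ_r`, with
`S : e^{(n)}_{ij} ↦ e^{(n+1/2)}_{i+1/2,j-1/2}`. -/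
noncomputable def gammaModel (q : ℝ) (r : ℕ) : L2h →L[ℂ] L2h :=
  (star (betaModel q) * betaModel q) ^ r * (betaModel q - 1) + 1

theorem asympOn_gamma {q : ℝ} (h0 : 0 < q) (h1 : q < 1) (r k : ℕ) :
    AsympOn (P k) (gamma q r) (gammaModel q r) :=
  ((((asympOn_star_beta h0 h1 k).mul (asympOn_beta h0 h1 k)).pow r).mul
    ((asympOn_beta h0 h1 k).sub AsympOn.one)).add AsympOn.one

theorem star_betaModel_mul_betaModel {q : ℝ} (h0 : 0 < q) (h1 : q < 1) :
    star (betaModel q) * betaModel q = diagOp fun x => q ^ (2 * x.J) := by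
  rw [betaModel, star_neg, neg_mul_neg, star_mul, star_diagOp, mul_assoc,
    ← mul_assoc (star (shift 1 0)), adjoint_shift_comp_shift, one_mul,
    diagOp_mul_diagOp (pow_bounded h0 h1 _) (pow_bounded h0 h1 _)]
  simp only [← pow_add, two_mul]

theorem diagOp_pow {w : Idx → ℝ} (h : ∃ C, ∀ x, |w x| ≤ C) (r : ℕ) (x : Idx) :
    (diagOp w ^ r) (e x) = ((w x : ℂ) ^ r) • e x := by
  induction r with
  | zero => simp
  | succ r ih =>
    rw [pow_succ, mul_apply_eq_comp, diagOp_e h, map_smul, ih, smul_smul, pow_succ, mul_comm]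

theorem gammaModel_e {q : ℝ} (h0 : 0 < q) (h1 : q < 1) (r : ℕ) (x : Idx) :
    gammaModel q r (e x) =
      e x - ((q : ℂ) ^ (2 * x.J * r)) • (((q : ℂ) ^ x.J) • e (up 1 0 x) + e x) := by
  -- The shift preserves J, so the power of β*β contributes the same scalar to both terms.
  have hJ : (up 1 0 x).J = x.J := rfl
  rw [gammaModel, _root_.add_apply, mul_apply_eq_comp, _root_.sub_apply,
    star_betaModel_mul_betaModel h0 h1, betaModel, _root_.neg_apply, mul_apply_eq_comp,
    diagOp_e (pow_bounded h0 h1 _), map_smul, shift_e, map_sub, map_neg, map_smul,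
    one_apply_eq_self, diagOp_pow (pow_bounded h0 h1 _),
    diagOp_pow (pow_bounded h0 h1 _), hJ]
  push_cast
  rw [← pow_mul]
  module

/-! ### Index of the model on one row -/

/-- V is injective, and its range is the kernel of the coordinate functional at x, so the cokernel
is one-dimensional. -/
theorem hasFredholmIndex_neg_one {V V' : L2h →L[ℂ] L2h} (x : Idx) (h : V' * V = 1)
    (h' : V * V' = 1 - indOp {x}) : HasFredholmIndex V (-1) := by
  have hle : ∀ v, V (V' v) = v - indOp {x} v := fun v => congrArg (fun T : L2h →L[ℂ] L2h => T v) h'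
  have hV : ∀ v, V' (V v) = v := fun v => congrArg (fun T : L2h →L[ℂ] L2h => T v) h
  have hker : V.toLinearMap.ker = ⊥ := LinearMap.ker_eq_bot.2 (Function.LeftInverse.injective hV)
  let ev : L2h →ₗ[ℂ] ℂ := (innerSL ℂ (e x)).toLinearMap
  have hev : ∀ v, ev v = v x := inner_e x
  have hrange : V.toLinearMap.range = ev.ker := by
    ext v
    constructor
    · rintro ⟨u, rfl⟩
      have h1 : V u = V u - indOp {x} (V u) := by
        rw [← hle, hV]
      have h2 := indOp_apply_of_mem (Set.mem_singleton x) (V u)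
      rw [LinearMap.mem_ker, hev]
      change V u x = 0
      rw [← h2, sub_eq_self.1 h1.symm]
      rfl
    · intro hv
      rw [LinearMap.mem_ker, hev] at hv
      refine ⟨V' v, (hle v).trans ?_⟩
      rw [sub_eq_self]
      ext y
      by_cases hy : y = x
      · rw [hy, indOp_apply_of_mem (Set.mem_singleton x), hv]; rfl
      · exact indOp_apply_of_notMem (A := {x}) hy v
  have hsurj : Function.Surjective ev := fun c => ⟨c • e x, by
    classical
    rw [hev, lp.coeFn_smul, Pi.smul_apply, e_apply, if_pos rfl, smul_eq_mul, mul_one]⟩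
  have e1 : (L2h ⧸ V.toLinearMap.range) ≃ₗ[ℂ] ℂ :=
    (Submodule.quotEquivOfEq _ _ hrange).trans (ev.quotKerEquivOfSurjective hsurj)
  have hfin : (indOp {x}).toLinearMap.HasFiniteRange :=
    hasFiniteRange_diagOp (indicator_bounded _) ((Set.finite_singleton x).subset
      fun y hy => by
        by_contra hyx
        exact hy (Set.indicator_of_notMem hyx _))
  refine ⟨ContinuousLinearMap.IsFredholm.of_isQuasiInverse (v := V')
    ⟨LinearMap.FiniteRangeSetoid.equiv_iff_hasFiniteRange.2 ?_,
      LinearMap.FiniteRangeSetoid.equiv_iff_hasFiniteRange.2 ?_⟩, ?_⟩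
  · have h1 : V'.toLinearMap ∘ₗ V.toLinearMap - LinearMap.id = 0 :=
      LinearMap.ext fun v => sub_eq_zero.2 (hV v)
    rw [h1]
    exact LinearMap.HasFiniteRange.zero
  · have h1 : V.toLinearMap ∘ₗ V'.toLinearMap - LinearMap.id = -(indOp {x}).toLinearMap := by
      refine LinearMap.ext fun v => ?_
      change V (V' v) - v = -(indOp {x} v)
      rw [hle]; abel
    rw [h1]
    exact hfin.neg
  · rw [hker, e1.finrank_eq]
    simp

/-- Labels with `n - i = k` and `n + j = 0`. -/
def rowStart (k : ℕ) : Set Idx := {x | x.I + k = x.N ∧ x.J = 0}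

/-- The isometry that shifts the `e x`, `x ∈ rowStart k`, and fixes the other basis vectors. -/
noncomputable def rowShift (k : ℕ) : L2h →L[ℂ] L2h :=
  shift 1 0 * indOp (rowStart k) + (1 - indOp (rowStart k))

theorem up_mem_rowStart {k : ℕ} {x : Idx} : up 1 0 x ∈ rowStart k ↔ x ∈ rowStart k := by
  simp only [rowStart, up, Set.mem_ofPred_eq, Fin.val_one, Fin.val_zero]
  omega

theorem rowShift_e_of_mem {k : ℕ} {x : Idx} (hx : x ∈ rowStart k) :
    rowShift k (e x) = e (up 1 0 x) := by
  rw [rowShift, _root_.add_apply, mul_apply_eq_comp, _root_.sub_apply, indOp_e_of_mem hx, shift_e,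
    one_apply_eq_self, sub_self, add_zero]

theorem rowShift_e_of_notMem {k : ℕ} {x : Idx} (hx : x ∉ rowStart k) :
    rowShift k (e x) = e x := by
  rw [rowShift, _root_.add_apply, mul_apply_eq_comp, _root_.sub_apply, indOp_e_of_notMem hx,
    map_zero, one_apply_eq_self, sub_zero, zero_add]

theorem hasFredholmIndex_rowShift (k : ℕ) : HasFredholmIndex (rowShift k) (-1) := by
  have hs : ∀ x, star (shift 1 0) (e (up 1 0 x)) = e x := adjoint_shift_e_up 1 0
  have hadj1 : ∀ x ∉ rowStart k,
      (star (shift 1 0) * indOp (rowStart k) + (1 - indOp (rowStart k))) (e x) = e x := by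
    intro x hx
    rw [_root_.add_apply, mul_apply_eq_comp, _root_.sub_apply, indOp_e_of_notMem hx, map_zero,
      one_apply_eq_self, sub_zero, zero_add]
  have hadj2 : ∀ x ∈ rowStart k,
      (star (shift 1 0) * indOp (rowStart k) + (1 - indOp (rowStart k))) (e x) =
        star (shift 1 0) (e x) := by
    intro x hx
    rw [_root_.add_apply, mul_apply_eq_comp, _root_.sub_apply, indOp_e_of_mem hx,
      one_apply_eq_self, sub_self, add_zero]
  -- The labels of `rowStart k` are (I + k, I, 0) with I ≥ 0, a half line; the shift misses only its
  -- initial point I = 0.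
  refine hasFredholmIndex_neg_one ⟨k, 0, 0, Nat.zero_le _, Nat.zero_le _⟩
    (V' := star (shift 1 0) * indOp (rowStart k) + (1 - indOp (rowStart k)))
    (clm_ext_e fun x => ?_) (clm_ext_e fun x => ?_)
  · rw [mul_apply_eq_comp, one_apply_eq_self]
    by_cases hx : x ∈ rowStart k
    · rw [rowShift_e_of_mem hx, hadj2 _ (up_mem_rowStart.2 hx), hs]
    · rw [rowShift_e_of_notMem hx, hadj1 _ hx]
  · rw [mul_apply_eq_comp, _root_.sub_apply, one_apply_eq_self]
    by_cases hx : x ∈ rowStart k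
    · rw [hadj2 _ hx]
      by_cases hI : x.I = 0
      · have hx0 : x = ⟨k, 0, 0, Nat.zero_le _, Nat.zero_le _⟩ := by
          obtain ⟨h1, h2⟩ := hx
          ext <;> simp <;> omega
        have hr : x ∉ Set.range (up 1 0) := by
          rintro ⟨y, rfl⟩
          simp [up] at hI
        have h0 : star (shift 1 0) (e x) = 0 := adjoint_shift_e_of_notMem 1 0 x hr
        rw [h0, map_zero, ← hx0, indOp_e_of_mem (Set.mem_singleton x), sub_self]
      · obtain ⟨h1, h2⟩ := hx
        have hy : x = up 1 0 ⟨x.N - 1, x.I - 1, x.J, by omega, by omega⟩ := by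
          ext <;> simp [up] <;> omega
        rw [hy, hs, rowShift_e_of_mem ?_, indOp_e_of_notMem ?_, sub_zero]
        · rw [Set.mem_singleton_iff, ← hy]
          intro h; rw [h] at hI; exact hI rfl
        · rw [← up_mem_rowStart, ← hy]; exact ⟨h1, h2⟩
    · rw [hadj1 _ hx, rowShift_e_of_notMem hx, indOp_e_of_notMem ?_, sub_zero]
      rintro rfl
      exact hx ⟨by simp, rfl⟩

theorem isUnit_one_sub_two_smul_indOp (A : Set Idx) : IsUnit (1 - (2 : ℂ) • indOp A) := by
  have h : (1 - (2 : ℂ) • indOp A) * (1 - (2 : ℂ) • indOp A) = 1 := by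
    have h1 : indOp A * indOp A = indOp A := by rw [indOp_mul_indOp, Set.inter_self]
    rw [mul_sub, sub_mul, sub_mul, smul_mul_smul_comm, h1]
    simp only [mul_one, one_mul]
    module
  exact ⟨⟨_, _, h, h⟩, rfl⟩

open scoped Classical in
/-- The weight `q^m`, `m = f x`, on the labels with `n - i = k` and `n + j ≥ 1`, otherwise `0`. -/
noncomputable def tailWeight (q : ℝ) (k : ℕ) (f : Idx → ℕ) (x : Idx) : ℝ :=
  if x.I + k = x.N ∧ 1 ≤ x.J then q ^ f x else 0

theorem abs_tailWeight_le {q : ℝ} (h0 : 0 < q) (h1 : q < 1) (k c : ℕ) {f : Idx → ℕ}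
    (hf : ∀ x, 1 ≤ x.J → c ≤ f x) (x : Idx) : |tailWeight q k f x| ≤ q ^ c := by
  rw [tailWeight]
  split_ifs with h
  · rw [abs_of_pos (pow_pos h0 _)]
    exact pow_le_pow_of_le_one h0.le h1.le (hf x h.2)
  · rw [abs_zero]; positivity

/-- On the row, the part J = 0 of the model is minus a unilateral shift, and the part J ≥ 1 is 1 - R
with ‖R‖ ≤ 2q^{2r} < 1. -/
theorem hasFredholmIndex_gammaModel_row {q : ℝ} (h0 : 0 < q) (h1 : q < 1) {r : ℕ}
    (hr : q ^ (2 * r) < 1 / 2) (k : ℕ) :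
    HasFredholmIndex (gammaModel q r * P k + (1 - P k)) (-1) := by
  have hw0 := abs_tailWeight_le h0 h1 k (2 * r) (f := fun x => 2 * x.J * r)
    (fun x hx => by nlinarith)
  have hw1 := abs_tailWeight_le h0 h1 k (2 * r) (f := fun x => 2 * x.J * r + x.J)
    (fun x hx => by nlinarith)
  set w0 := tailWeight q k (fun x => 2 * x.J * r) with hw0'
  set w1 := tailWeight q k (fun x => 2 * x.J * r + x.J) with hw1'
  set R := shift 1 0 * diagOp w1 + diagOp w0 with hR
  have hRn : ‖R‖ < 1 := by
    have h2 : ‖shift 1 0 * diagOp w1‖ ≤ 1 * q ^ (2 * r) :=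
      (norm_mul_le _ _).trans (mul_le_mul (norm_shift_le 1 0)
        (norm_diagOp_le (by positivity) hw1) (norm_nonneg _) zero_le_one)
    have h3 := norm_diagOp_le (by positivity) hw0
    have h4 := norm_add_le (shift 1 0 * diagOp w1) (diagOp w0)
    linarith
  -- The three factors supply the sign on J = 0, the shift on J = 0, and the invertible part on J ≥
  -- 1; only the shift contributes to the index.
  have hfac : gammaModel q r * P k + (1 - P k) =
      (1 - (2 : ℂ) • indOp (rowStart k)) ∘L (rowShift k ∘L (1 - R)) := by
    refine clm_ext_e fun x => ?_
    have hRe : (1 - R) (e x) = e x - ((w1 x : ℂ) • e (up 1 0 x) + (w0 x : ℂ) • e x) := by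
      rw [_root_.sub_apply, one_apply_eq_self, hR, _root_.add_apply, mul_apply_eq_comp,
        diagOp_e ⟨_, hw1⟩, diagOp_e ⟨_, hw0⟩, map_smul, shift_e]
    rw [_root_.add_apply, mul_apply_eq_comp, _root_.sub_apply, one_apply_eq_self, P_eq_indOp,
      ContinuousLinearMap.comp_apply, ContinuousLinearMap.comp_apply, hRe, _root_.sub_apply,
      one_apply_eq_self, _root_.smul_apply]
    by_cases hk : x ∈ row k
    · rw [indOp_e_of_mem hk, gammaModel_e h0 h1]
      by_cases hJ : x.J = 0
      · have hx : x ∈ rowStart k := ⟨hk, hJ⟩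
        have e1 : w1 x = 0 := if_neg (by omega)
        have e0 : w0 x = 0 := if_neg (by omega)
        rw [e1, e0, hJ]
        simp only [Complex.ofReal_zero, zero_smul, add_zero, sub_zero, rowShift_e_of_mem hx,
          indOp_e_of_mem (up_mem_rowStart.2 hx)]
        simp only [mul_zero, zero_mul, pow_zero]
        module
      · have hx : x ∉ rowStart k := fun h => hJ h.2
        have hx' : up 1 0 x ∉ rowStart k := fun h => hx (up_mem_rowStart.1 h)
        have e1 : w1 x = q ^ (2 * x.J * r + x.J) := if_pos ⟨hk, by omega⟩
        have e0 : w0 x = q ^ (2 * x.J * r) := if_pos ⟨hk, by omega⟩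
        simp only [map_sub, map_add, map_smul, rowShift_e_of_notMem hx, rowShift_e_of_notMem hx',
          indOp_e_of_notMem hx, indOp_e_of_notMem hx']
        rw [e1, e0]
        push_cast
        rw [pow_add]
        module
    · have hx : x ∉ rowStart k := fun h => hk h.1
      have e1 : w1 x = 0 := if_neg fun h => hk h.1
      have e0 : w0 x = 0 := if_neg fun h => hk h.1
      rw [e1, e0, indOp_e_of_notMem hk]
      simp only [Complex.ofReal_zero, zero_smul, add_zero, sub_zero, rowShift_e_of_notMem hx,
        indOp_e_of_notMem hx, map_zero, smul_zero, zero_add]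
  rw [hfac]
  exact (IsUnit.hasFredholmIndex (isUnit_one_sub_two_smul_indOp _)).comp
    ((hasFredholmIndex_rowShift k).comp
      (IsUnit.hasFredholmIndex (isUnit_one_sub_of_norm_lt_one hRn)))

/-! ### Finitely many rows, their complement, and cross terms -/

/-- The sum of the `P k`, `k ∈ F`. -/
noncomputable def rowsProj (F : Finset ℕ) : L2h →L[ℂ] L2h := ∑ k ∈ F, P k

theorem rowsProj_mul_P_of_notMem {F : Finset ℕ} {k : ℕ} (hk : k ∉ F) : rowsProj F * P k = 0 := by
  rw [rowsProj, Finset.sum_mul]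
  exact Finset.sum_eq_zero fun l hl => P_mul_P_of_ne fun h => hk (h ▸ hl)

theorem rowsProj_mul_self (F : Finset ℕ) : rowsProj F * rowsProj F = rowsProj F := by
  classical
  rw [rowsProj, Finset.sum_mul_sum]
  refine Finset.sum_congr rfl fun k hk => ?_
  rw [Finset.sum_eq_single_of_mem k hk fun l _ hl => P_mul_P_of_ne hl.symm, P_mul_P_self]

theorem AsympOn.sum {x y : L2h →L[ℂ] L2h} (h : ∀ k, AsympOn (P k) x y) (F : Finset ℕ) :
    AsympOn (rowsProj F) x y := by
  classical
  induction F using Finset.induction_on with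
  | empty =>
    rw [rowsProj, Finset.sum_empty]
    exact ⟨by rw [mul_zero]; exact isApproxFinite_zero, Commute.zero_left y⟩
  | insert k F hk ih =>
    have hs : rowsProj (insert k F) = P k + rowsProj F := Finset.sum_insert hk
    rw [hs]
    exact ⟨by rw [mul_add]; exact (h k).approx.add ih.approx, (h k).comm.add_left ih.comm⟩

/-- The rows are orthogonal and reduce the model, so its extension by the identity is the product of
the extensions for single rows, each of index -1. -/
theorem hasFredholmIndex_gammaModel_rows {q : ℝ} (h0 : 0 < q) (h1 : q < 1) {r : ℕ}
    (hr : q ^ (2 * r) < 1 / 2) (F : Finset ℕ) :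
    HasFredholmIndex (gammaModel q r * rowsProj F + (1 - rowsProj F)) (-(F.card : ℤ)) := by
  classical
  induction F using Finset.induction_on with
  | empty =>
    rw [rowsProj, Finset.sum_empty, mul_zero, zero_add, sub_zero, Finset.card_empty]
    exact IsUnit.hasFredholmIndex isUnit_one
  | insert k F hk ih =>
    have hs : rowsProj (insert k F) = P k + rowsProj F := Finset.sum_insert hk
    have hz := rowsProj_mul_P_of_notMem hk
    have hc := (asympOn_gamma h0 h1 r k).comm.eq
    set T := gammaModel q r
    set p := rowsProj F
    have hfac : T * rowsProj (insert k F) + (1 - rowsProj (insert k F)) =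
        (T * p + (1 - p)) * (T * P k + (1 - P k)) := by
      have hz' : p * (T * P k) = 0 := by rw [← hc, ← mul_assoc, hz, zero_mul]
      have h2 : (T * p + (1 - p)) * (T * P k + (1 - P k)) = T * p + T * P k + 1 - p - P k +
          (T * (p * (T * P k)) - T * (p * P k) - p * (T * P k) + p * P k) := by
        noncomm_ring
      rw [h2, hs, hz', hz]
      noncomm_ring
    have hcard : -((F.card + 1 : ℕ) : ℤ) = -(F.card : ℤ) + -1 := by push_cast; ring
    rw [hfac, Finset.card_insert_of_notMem hk, hcard]
    exact ih.comp (hasFredholmIndex_gammaModel_row h0 h1 hr k)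

/-- The compression differs from that of the model by p(γ_r - model)p, a limit of finite rank
operators, and the model commutes with p. -/
theorem hasFredholmIndex_gamma_rows {q : ℝ} (h0 : 0 < q) (h1 : q < 1) {r : ℕ}
    (hr : q ^ (2 * r) < 1 / 2) (F : Finset ℕ) :
    HasFredholmIndex (rowsProj F * gamma q r * rowsProj F + (1 - rowsProj F)) (-(F.card : ℤ)) := by
  have ha := AsympOn.sum (asympOn_gamma h0 h1 r) F
  convert (hasFredholmIndex_gammaModel_rows h0 h1 hr F).add_isApproxFinite
    (ha.approx.comp_left (rowsProj F)) using 1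
  change _ = _ + rowsProj F * ((gamma q r - gammaModel q r) * rowsProj F)
  have hc := ha.comm.eq
  have hp := rowsProj_mul_self F
  have : rowsProj F * (gammaModel q r * rowsProj F) = gammaModel q r * rowsProj F := by
    rw [← mul_assoc, hc, mul_assoc, hp]
  rw [sub_mul, mul_sub, this, mul_assoc]
  abel

/-- For invertible `γ_r`, the complementary compression has the opposite index. -/
theorem hasFredholmIndex_gamma_compl_rows {q : ℝ} (h0 : 0 < q) (h1 : q < 1) {r : ℕ}
    (hr : q ^ (2 * r) < 1 / 2) (hu : IsUnit (gamma q r)) (F : Finset ℕ) :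
    HasFredholmIndex ((1 - rowsProj F) * gamma q r * (1 - rowsProj F) + rowsProj F) F.card := by
  have ha := AsympOn.sum (asympOn_gamma h0 h1 r) F
  have hB := hasFredholmIndex_gamma_rows h0 h1 hr F
  have hp := rowsProj_mul_self F
  have hc := ha.comm.eq
  set g := gamma q r
  set p := rowsProj F
  have hK : IsApproxFinite ((1 - p) * g * p) := by
    have h2 : (1 - p) * g * p = (1 - p) * ((g - gammaModel q r) * p) := by
      have h3 : (1 - p) * (gammaModel q r * p) = 0 := by
        rw [← hc, ← mul_assoc, sub_mul, hp, one_mul, sub_self, zero_mul]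
      rw [sub_mul g, mul_sub, h3, sub_zero, mul_assoc]
    rw [h2]
    exact ha.approx.comp_left _
  have hC : IsUnit (1 + p * g * (1 - p)) := by
    have h2 : p * g * (1 - p) * (p * g * (1 - p)) = 0 := by
      have h3 : (1 - p) * p = 0 := by rw [sub_mul, hp, one_mul, sub_self]
      rw [mul_assoc (p * g), ← mul_assoc (1 - p), ← mul_assoc (1 - p), h3, zero_mul, zero_mul,
        mul_zero]
    generalize p * g * (1 - p) = c at h2
    have h3 : (1 + c) * (1 - c) = 1 - c * c := by noncomm_ring
    have h4 : (1 - c) * (1 + c) = 1 - c * c := by noncomm_ring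
    rw [h2, sub_zero] at h3 h4
    exact ⟨⟨_, _, h3, h4⟩, rfl⟩
  -- After removal of the corner (1-p)gp the operator is block triangular: it factors into the
  -- complementary block, a unipotent factor, and the block on p.
  have h4 : g + -((1 - p) * g * p) = ((1 - p) * g * (1 - p) + p) ∘L
      ((1 + p * g * (1 - p)) ∘L (p * g * p + (1 - p))) := by
    -- The bracketed remainders collect multiples of p² - p, which makes the identities valid in any
    -- ring before idempotence is used.
    have h5 : (1 + p * g * (1 - p)) * (p * g * p + (1 - p)) = p * g + (1 - p) +
        (p * g * (p * p - p) + p * g * (p - p * p) * g * p) := by noncomm_ring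
    have h6 : ((1 - p) * g * (1 - p) + p) * (p * g + (1 - p)) = g + -((1 - p) * g * p) +
        ((p * p - p) * g + (1 - p) * g * (p - p * p) * g + (1 - p) * g * (p * p - p)
          + (p - p * p)) := by
      noncomm_ring
    change _ = ((1 - p) * g * (1 - p) + p) * ((1 + p * g * (1 - p)) * (p * g * p + (1 - p)))
    rw [h5, hp, sub_self]
    simp only [mul_zero, zero_mul, add_zero]
    rw [h6, hp, sub_self]
    simp only [mul_zero, zero_mul, add_zero]
  -- The left side has index 0 since g is invertible, so the complementary block must offset the
  -- index -|F| of the block on p.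
  have h7 := (IsUnit.hasFredholmIndex hu).add_isApproxFinite hK.neg
  rw [h4] at h7
  simpa using h7.of_comp ((IsUnit.hasFredholmIndex hC).comp hB)

theorem hasFredholmIndex_compress_row {q : ℝ} (h0 : 0 < q) (h1 : q < 1) {r : ℕ}
    (hr : q ^ (2 * r) < 1 / 2) (k : ℕ) :
    HasFredholmIndex (compress (rowSpace k) (gamma q r)) (-1) := by
  refine HasFredholmIndex.compress ?_
  have := hasFredholmIndex_gamma_rows h0 h1 hr {k}
  rwa [rowsProj, Finset.sum_singleton, Finset.card_singleton] at this

/-- The model preserves rows, so between distinct rows only γ_r - model survives, and it is compact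
on row k. -/
theorem isCompactOperator_P_gamma_P {q : ℝ} (h0 : 0 < q) (h1 : q < 1) (r : ℕ) {k l : ℕ}
    (hkl : l ≠ k) : IsCompactOperator (P l ∘L gamma q r ∘L P k) := by
  have ha := asympOn_gamma h0 h1 r k
  have h : P l ∘L gamma q r ∘L P k = P l ∘L ((gamma q r - gammaModel q r) * P k) := by
    change P l * (gamma q r * P k) = P l * ((gamma q r - gammaModel q r) * P k)
    rw [sub_mul, mul_sub, ← ha.comm.eq, ← mul_assoc (P l) (P k), P_mul_P_of_ne hkl, zero_mul,
      sub_zero]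
  rw [h]
  exact (ha.approx.comp_left _).isCompactOperator

/-! ### Spectrum of β*β and invertibility of γ_r -/

/-- a'a = 1 - b and aa' = 1 - cb have the same nonzero spectrum; z ≠ 1 makes 1 - z a nonzero point
of it. -/
theorem div_mem_spectrum_of_rel {A : Type*} [Ring A] [Algebra ℂ A] {a a' b : A} {c : ℂ}
    (hc : c ≠ 0) (h1 : a' * a + b = 1) (h2 : a * a' + c • b = 1) {z : ℂ}
    (hz : z ∈ spectrum ℂ b) (hz1 : z ≠ 1) : z / c ∈ spectrum ℂ b := by
  have hne : 1 - z ≠ 0 := sub_ne_zero.2 hz1.symm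
  have h3 : 1 - z ∈ spectrum ℂ (a' * a) := by
    rw [spectrum.mem_iff] at hz ⊢
    have : algebraMap ℂ A (1 - z) - a' * a = -(algebraMap ℂ A z - b) := by
      rw [eq_sub_of_add_eq h1, map_sub, map_one]; abel
    rw [this, IsUnit.neg_iff]
    exact hz
  have h4 : 1 - z ∈ spectrum ℂ (a * a') := by
    have := (spectrum.nonzero_mul_comm (𝕜 := ℂ) a' a).subset ⟨h3, hne⟩
    exact this.1
  rw [spectrum.mem_iff] at h4 ⊢
  refine fun hu => h4 ?_
  have h5 : algebraMap ℂ A (1 - z) - a * a' = (-c) • (algebraMap ℂ A (z / c) - b) := by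
    have h6 : c • algebraMap ℂ A (z / c) = algebraMap ℂ A z := by
      rw [Algebra.algebraMap_eq_smul_one, smul_smul, mul_div_cancel₀ _ hc,
        ← Algebra.algebraMap_eq_smul_one]
    rw [eq_sub_of_add_eq h2, map_sub, map_one, neg_smul, smul_sub, h6]
    abel
  rw [h5]
  exact (IsUnit.smul (Units.mk0 (-c) (neg_ne_zero.2 hc)) hu)

variable {A : Type*} [CStarAlgebra A]

/-- Division by q² stays in the spectrum until it meets the value 1. A nonzero z that is no power
q^{2n} would produce arbitrarily large spectral points. -/
theorem spectrum_subset_of_rel {a a' b : A} {q : ℝ} (h0 : 0 < q) (hq1 : q < 1)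
    (h1 : a' * a + b = 1) (h2 : a * a' + (q : ℂ) ^ 2 • b = 1) {z : ℂ} (hz : z ∈ spectrum ℂ b) :
    z = 0 ∨ ∃ n : ℕ, z = (q : ℂ) ^ (2 * n) := by
  by_contra! h
  obtain ⟨hz0, hzn⟩ := h
  have hq : (q : ℂ) ≠ 0 := Complex.ofReal_ne_zero.2 h0.ne'
  have key : ∀ n : ℕ, z / (q : ℂ) ^ (2 * n) ∈ spectrum ℂ b := by
    intro n
    induction n with
    | zero => simpa using hz
    | succ n ih =>
      have hne : z / (q : ℂ) ^ (2 * n) ≠ 1 := fun h => hzn n ((div_eq_one_iff_eq (pow_ne_zero _ hq)).1 h)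
      have := div_mem_spectrum_of_rel (pow_ne_zero 2 hq) h1 h2 ih hne
      rwa [div_div, ← pow_add] at this
  have hb : ∀ n : ℕ, ‖z‖ ≤ (‖b‖ * ‖(1 : A)‖) * (q ^ 2) ^ n := by
    intro n
    have := spectrum.norm_le_norm_mul_of_mem (key n)
    rw [norm_div, norm_pow, Complex.norm_real, Real.norm_of_nonneg h0.le,
      div_le_iff₀ (by positivity), pow_mul] at this
    exact this
  have hlim : Filter.Tendsto (fun n : ℕ => (‖b‖ * ‖(1 : A)‖) * (q ^ 2) ^ n) Filter.atTop
      (nhds ((‖b‖ * ‖(1 : A)‖) * 0)) :=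
    (tendsto_pow_atTop_nhds_zero_of_lt_one (by positivity)
      (pow_lt_one₀ h0.le hq1 two_ne_zero)).const_mul _
  rw [mul_zero] at hlim
  have := ge_of_tendsto' hlim hb
  exact hz0 (norm_le_zero_iff.1 this)

/-- `(b*b)^r (b - 1) + 1` is invertible. -/
theorem isUnit_of_rel {a b : A} {q : ℝ} (h0 : 0 < q) (hq1 : q < 1)
    (h1 : star a * a + star b * b = 1) (h2 : a * star a + (q : ℂ) ^ 2 • (b * star b) = 1)
    (h3 : star b * b = b * star b) {r : ℕ} (hr : q ^ (2 * r) < 1 / 2) :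
    IsUnit ((star b * b) ^ r * (b - 1) + 1) := by
  have hn : IsStarNormal b := ⟨h3⟩
  -- Needed at spectral points with |z|² = 0, where 0^r must vanish.
  have hr0 : r ≠ 0 := by
    rintro rfl
    norm_num at hr
  have hcfc : cfc (fun z : ℂ => (star z * z) ^ r * (z - 1) + 1) b
      = (star b * b) ^ r * (b - 1) + 1 := by
    rw [cfc_add_const 1 (fun z : ℂ => (star z * z) ^ r * (z - 1)) b,
      cfc_mul (fun z : ℂ => (star z * z) ^ r) (fun z => z - 1) b,
      cfc_pow (fun z : ℂ => star z * z) r b, cfc_mul (fun z : ℂ => star z) (fun z => z) b,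
      cfc_star_id b, cfc_id' ℂ b, cfc_sub (fun z : ℂ => z) (fun _ => 1) b, cfc_id' ℂ b,
      cfc_const_one ℂ b, map_one]
  have hcfc2 : cfc (fun z : ℂ => star z * z) b = star b * b := by
    rw [cfc_mul (fun z : ℂ => star z) (fun z => z) b, cfc_star_id b, cfc_id' ℂ b]
  rw [← hcfc, isUnit_cfc_iff _ b]
  intro z hz h
  have hz2 : star z * z ∈ spectrum ℂ (star b * b) := by
    rw [← hcfc2, cfc_map_spectrum (fun z : ℂ => star z * z) b]
    exact ⟨z, hz, rfl⟩
  have hzz : star z * z = ((‖z‖ ^ 2 : ℝ) : ℂ) := by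
    rw [mul_comm, Complex.star_def, Complex.mul_conj, Complex.normSq_eq_norm_sq]
  rw [← h3] at h2
  -- The function takes the value 1 at z = 0 and the value z when |z| = 1; for |z| = q^{n+1} the
  -- term |z|^{2r}(z - 1) has modulus at most 2q^{2r} < 1. It has no zero in any case.
  rcases spectrum_subset_of_rel h0 hq1 h1 h2 hz2 with h4 | ⟨n, h4⟩
  · rw [h4, zero_pow hr0, zero_mul, zero_add] at h
    exact one_ne_zero h
  · have h5 : ‖z‖ ^ 2 = (q ^ n) ^ 2 := by
      rw [hzz] at h4
      rw [← pow_mul, mul_comm n]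
      exact_mod_cast h4
    have h6 : ‖z‖ = q ^ n := (pow_left_inj₀ (norm_nonneg _) (by positivity) two_ne_zero).1 h5
    rw [h4] at h
    cases n with
    | zero =>
      rw [mul_zero, pow_zero, one_pow, one_mul, sub_add_cancel] at h
      rw [h, norm_zero, pow_zero] at h6
      exact zero_ne_one h6
    | succ n =>
      have h7 : ‖((q : ℂ) ^ (2 * (n + 1))) ^ r * (z - 1)‖ = 1 := by
        rw [eq_neg_of_add_eq_zero_left h, norm_neg, norm_one]
      rw [norm_mul, norm_pow, norm_pow, Complex.norm_real, Real.norm_of_nonneg h0.le] at h7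
      have h8 : ‖z - 1‖ ≤ 2 := by
        have := norm_sub_le z 1
        have h9 : q ^ (n + 1) ≤ 1 := pow_le_one₀ h0.le hq1.le
        rw [h6, norm_one] at this
        linarith
      have h10 : (q ^ (2 * (n + 1))) ^ r ≤ q ^ (2 * r) := by
        rw [← pow_mul]
        exact pow_le_pow_of_le_one h0.le hq1.le (by nlinarith [Nat.zero_le (n * r)])
      have h11 : 0 < (q ^ (2 * (n + 1))) ^ r := by positivity
      nlinarith [norm_nonneg (z - 1)]

/-! ### Spectral subspaces and the sign of D -/

section SpectralSubspaces

theorem inner_eq_zero_of_mem_closure_span {H : Type*} [NormedAddCommGroup H]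
    [InnerProductSpace ℂ H] {S T : Set H} (h : ∀ u ∈ S, ∀ v ∈ T, inner ℂ u v = 0)
    {u v : H} (hu : u ∈ (Submodule.span ℂ S).topologicalClosure)
    (hv : v ∈ (Submodule.span ℂ T).topologicalClosure) : inner ℂ u v = 0 := by
  have h1 : (Submodule.span ℂ T).topologicalClosure ≤ (Submodule.span ℂ S)ᗮ := by
    refine Submodule.topologicalClosure_minimal _ ?_ (Submodule.isClosed_orthogonal _)
    refine (Submodule.isOrtho_span (𝕜 := ℂ)).2 (fun v hv u hu => ?_)
    rw [← inner_conj_symm, h u hu v hv, map_zero]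
  have h2 : (Submodule.span ℂ S).topologicalClosure ≤ ((Submodule.span ℂ S)ᗮ)ᗮ :=
    Submodule.topologicalClosure_minimal _ (Submodule.le_orthogonal_orthogonal _)
      (Submodule.isClosed_orthogonal _)
  have h3 := h2 hu v (h1 hv)
  rw [← inner_conj_symm, h3, map_zero]

variable {H : Type*} [NormedAddCommGroup H] [InnerProductSpace ℂ H] [CompleteSpace H]

theorem inner_eq_zero_of_eigenvectors {D : H →ₗ.[ℂ] H} (hD : IsSelfAdjoint D) {a b : ℝ}
    (hab : a ≠ b) {u v : H} (hu : u ∈ D.domain) (hv : v ∈ D.domain)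
    (hDu : D ⟨u, hu⟩ = (a : ℂ) • u) (hDv : D ⟨v, hv⟩ = (b : ℂ) • v) : inner ℂ u v = 0 := by
  have hf : D.IsFormalAdjoint D := by
    have := D.adjoint_isFormalAdjoint hD.dense_domain
    rwa [LinearPMap.isSelfAdjoint_def.1 hD] at this
  have h := hf ⟨u, hu⟩ ⟨v, hv⟩
  rw [hDu, hDv, inner_smul_left, inner_smul_right, Complex.conj_ofReal] at h
  have h2 : ((a : ℂ) - b) * inner ℂ u v = 0 := by rw [sub_mul, h, sub_self]
  refine (mul_eq_zero.1 h2).resolve_left fun h3 => hab ?_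
  exact_mod_cast sub_eq_zero.1 h3

theorem inner_eq_zero_of_mem_spectralSubspace {D : H →ₗ.[ℂ] H} (hD : IsSelfAdjoint D)
    {Λ Λ' : Set ℝ} (hΛ : Disjoint Λ Λ') {u v : H} (hu : u ∈ spectralSubspace D Λ)
    (hv : v ∈ spectralSubspace D Λ') : inner ℂ u v = 0 := by
  refine inner_eq_zero_of_mem_closure_span ?_ hu hv
  rintro u ⟨hu, a, ha, hDu⟩ v ⟨hv, b, hb, hDv⟩
  exact inner_eq_zero_of_eigenvectors hD (fun h => Set.disjoint_left.1 hΛ ha (by rwa [h]))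
    hu hv hDu hDv

theorem starProjection_eq_zero_of_disjoint {D : H →ₗ.[ℂ] H} (hD : IsSelfAdjoint D)
    {Λ Λ' : Set ℝ} (hΛ : Disjoint Λ Λ') {v : H} (hv : v ∈ spectralSubspace D Λ') :
    (spectralSubspace D Λ).starProjection v = 0 :=
  Submodule.eq_starProjection_of_mem_of_inner_eq_zero (Submodule.zero_mem _) fun u hu => by
    rw [sub_zero, ← inner_conj_symm, inner_eq_zero_of_mem_spectralSubspace hD hΛ hu hv, map_zero]

/-- If `sign D` is a symmetry, it determines the spectral projection `χ_{[0,∞)}(D)`. -/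
theorem starProjection_Ici_of_signOp_mul_self {D : H →ₗ.[ℂ] H} (hD : IsSelfAdjoint D)
    (hS : signOp D * signOp D = 1) :
    (2 : ℂ) • (spectralSubspace D (Set.Ici 0)).starProjection = 1 + signOp D := by
  set p := (spectralSubspace D (Set.Ioi 0)).starProjection with hp
  set n := (spectralSubspace D (Set.Iio 0)).starProjection with hn
  have hSdef : signOp D = p - n := rfl
  have hmemp : ∀ v, p v ∈ spectralSubspace D (Set.Ioi 0) := fun v =>
    Submodule.starProjection_apply_mem _ _
  have hmemn : ∀ v, n v ∈ spectralSubspace D (Set.Iio 0) := fun v =>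
    Submodule.starProjection_apply_mem _ _
  have hd : Disjoint (Set.Ioi (0 : ℝ)) (Set.Iio 0) := by
    rw [Set.disjoint_left]; intro x hx hx'; exact lt_asymm (Set.mem_Ioi.1 hx) (Set.mem_Iio.1 hx')
  have hd' : Disjoint (Set.Iio (0 : ℝ)) (Set.Ici 0) := by
    rw [Set.disjoint_left]; intro x hx hx'; exact not_le.2 (Set.mem_Iio.1 hx) (Set.mem_Ici.1 hx')
  have hpn : ∀ v, p (n v) = 0 := fun v => starProjection_eq_zero_of_disjoint hD hd (hmemn v)
  have hnp : ∀ v, n (p v) = 0 := fun v => starProjection_eq_zero_of_disjoint hD hd.symm (hmemp v)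
  have hpp : ∀ v, p (p v) = p v := fun v => Submodule.starProjection_eq_self_iff.2 (hmemp v)
  have hnn : ∀ v, n (n v) = n v := fun v => Submodule.starProjection_eq_self_iff.2 (hmemn v)
  -- As pn = np = 0, the square of p - n is p + n, so the hypothesis says that the positive and
  -- negative subspaces exhaust H. No spectral theorem is needed.
  have hsum : ∀ v, p v + n v = v := fun v => by
    have h := congrArg (fun T : H →L[ℂ] H => T v) hS
    simp only [hSdef, mul_apply_eq_comp, _root_.sub_apply, map_sub, hpp, hnn, hpn, hnp,
      one_apply_eq_self] at h
    simpa using h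
  have hle : spectralSubspace D (Set.Ioi 0) ≤ spectralSubspace D (Set.Ici 0) := by
    refine Submodule.topologicalClosure_mono (Submodule.span_mono ?_)
    rintro v ⟨hv, c, hc, hDv⟩
    exact ⟨hv, c, (Set.mem_Ioi.1 hc).le, hDv⟩
  -- The remainder v - pv lies in the negative subspace, which is orthogonal to all eigenvectors
  -- with eigenvalue ≥ 0.
  have hK : (spectralSubspace D (Set.Ici 0)).starProjection = p := by
    ext v
    refine Submodule.eq_starProjection_of_mem_of_inner_eq_zero (hle (hmemp v)) fun w hw => ?_
    rw [show v - p v = n v by rw [sub_eq_iff_eq_add', hsum]]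
    exact inner_eq_zero_of_mem_spectralSubspace hD hd' (hmemn v) hw
  rw [hK, hSdef]
  ext v
  have := hsum v
  simp only [_root_.smul_apply, _root_.add_apply, one_apply_eq_self, _root_.sub_apply]
  nth_rw 2 [← this]
  rw [two_smul]; abel

end SpectralSubspaces

/-! ### Diagonal unbounded operators -/

/-- The diagonal operator `e x ↦ d x • e x` on its maximal domain. -/
noncomputable def diagPMap (d : Idx → ℝ) : L2h →ₗ.[ℂ] L2h where
  domain :=
    { carrier := {v | Memℓp (fun x => (d x : ℂ) * v x) 2}
      add_mem' := fun {u v} hu hv => by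
        change Memℓp (fun x => (d x : ℂ) * (u x + v x)) 2
        simp only [mul_add]
        exact hu.add hv
      zero_mem' := by
        change Memℓp (fun x => (d x : ℂ) * 0) 2
        simp only [mul_zero]
        exact zero_memℓp
      smul_mem' := fun c v hv => by
        change Memℓp (fun x => (d x : ℂ) * (c * v x)) 2
        simp only [mul_left_comm _ c]
        exact hv.const_smul c }
  toFun :=
    { toFun := fun v => ⟨fun x => (d x : ℂ) * (v : L2h) x, v.2⟩
      map_add' := fun u v => by
        ext x
        exact mul_add _ _ _
      map_smul' := fun c v => by
        ext x
        exact mul_left_comm _ _ _ }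

theorem diagPMap_apply (d : Idx → ℝ) (v : (diagPMap d).domain) (x : Idx) :
    diagPMap d v x = (d x : ℂ) * (v : L2h) x := rfl

theorem mem_diagPMap_domain {d : Idx → ℝ} {v u : L2h} (h : ∀ x, u x = (d x : ℂ) * v x) :
    v ∈ (diagPMap d).domain := by
  have hu : Memℓp u 2 := lp.memℓp u
  rwa [show (u : Idx → ℂ) = fun x => (d x : ℂ) * v x from funext h] at hu

theorem diagPMap_eq {d : Idx → ℝ} {v u : L2h} (h : ∀ x, u x = (d x : ℂ) * v x) :
    diagPMap d ⟨v, mem_diagPMap_domain h⟩ = u := by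
  ext x
  exact (h x).symm

theorem smul_e_apply_eq (d : Idx → ℝ) (x y : Idx) :
    ((d x : ℂ) • e x : L2h) y = (d y : ℂ) * e x y := by
  classical
  rw [lp.coeFn_smul, Pi.smul_apply, e_apply]
  by_cases h : y = x
  · rw [h]; rfl
  · simp [h]

theorem dense_diagPMap_domain (d : Idx → ℝ) : Dense ((diagPMap d).domain : Set L2h) := by
  intro v
  change v ∈ ((diagPMap d).domain.topologicalClosure : Set L2h)
  exact mem_of_isClosed_of_e_mem (Submodule.isClosed_topologicalClosure _) v fun x _ =>
    Submodule.le_topologicalClosure _ (mem_diagPMap_domain (smul_e_apply_eq d x))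

/-- Testing the adjoint against `e x` shows that it multiplies the coordinate at x by d x, so every
vector of its domain already lies in the maximal domain. -/
theorem isSelfAdjoint_diagPMap (d : Idx → ℝ) : IsSelfAdjoint (diagPMap d) := by
  have hdense := dense_diagPMap_domain d
  rw [LinearPMap.isSelfAdjoint_def]
  have hf : (diagPMap d).IsFormalAdjoint (diagPMap d) := fun u v => by
    rw [lp.inner_eq_tsum, lp.inner_eq_tsum]
    refine tsum_congr fun x => ?_
    rw [diagPMap_apply, diagPMap_apply, RCLike.inner_apply, RCLike.inner_apply, map_mul,
      Complex.conj_ofReal]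
    ring
  refine (LinearPMap.eq_of_le_of_domain_eq (hf.le_adjoint hdense) (le_antisymm
    (hf.le_adjoint hdense).1 fun y hy => ?_)).symm
  refine mem_diagPMap_domain (u := (diagPMap d).adjoint ⟨y, hy⟩) fun x => ?_
  have hx := mem_diagPMap_domain (smul_e_apply_eq d x)
  have h := (diagPMap d).adjoint_isFormalAdjoint hdense ⟨y, hy⟩ ⟨e x, hx⟩
  rw [diagPMap_eq (smul_e_apply_eq d x), inner_smul_right] at h
  rw [← inner_e, ← inner_e, ← inner_conj_symm, h, map_mul, inner_conj_symm, Complex.conj_ofReal]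

/-- 1/(d - i) = d/(d² + 1) + i/(d² + 1), with both real weights tending to zero. The splitting is
needed because `diagOp` takes real weights. -/
theorem compactResolvent_diagPMap {d : Idx → ℝ} (hd : ∀ M : ℝ, {x | |d x| ≤ M}.Finite) :
    ∃ R : L2h →L[ℂ] L2h, IsCompactOperator R ∧
      (∀ y : L2h, ∃ h : R y ∈ (diagPMap d).domain, diagPMap d ⟨R y, h⟩ - Complex.I • R y = y) ∧
      (∀ x : (diagPMap d).domain, R (diagPMap d x - Complex.I • (x : L2h)) = x) := by
  have hpos : ∀ x, 0 < d x ^ 2 + 1 := fun x => by positivity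
  have b1 : ∀ x, |d x / (d x ^ 2 + 1)| ≤ 1 := fun x => by
    rw [abs_div, abs_of_pos (hpos x), div_le_one (hpos x)]
    nlinarith [sq_abs (d x), sq_nonneg (|d x| - 1), abs_nonneg (d x)]
  have b2 : ∀ x, |1 / (d x ^ 2 + 1)| ≤ 1 := fun x => by
    rw [abs_div, abs_one, abs_of_pos (hpos x), div_le_one (hpos x)]
    nlinarith [sq_nonneg (d x)]
  have small : ∀ ε > 0, ∀ x, (ε ≤ |d x / (d x ^ 2 + 1)| ∨ ε ≤ |1 / (d x ^ 2 + 1)|) →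
      |d x| ≤ 1 / ε := by
    intro ε hε x hx
    rw [abs_div, abs_div, abs_one, abs_of_pos (hpos x), le_div_iff₀ (hpos x),
      le_div_iff₀ (hpos x), ← sq_abs] at hx
    rw [le_div_iff₀ hε]
    by_contra! hcon
    have h0 := abs_nonneg (d x)
    rcases hx with hx | hx
    · nlinarith
    · rcases le_or_gt (|d x|) 1 with h1 | h1 <;> nlinarith
  set R1 := diagOp fun x => d x / (d x ^ 2 + 1)
  set R2 := diagOp fun x => 1 / (d x ^ 2 + 1)
  have hR : ∀ (y : L2h) (x : Idx),
      (R1 + Complex.I • R2) y x = (1 / ((d x : ℂ) - Complex.I)) * y x := by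
    intro y x
    rw [_root_.add_apply, _root_.smul_apply, lp.coeFn_add, Pi.add_apply, lp.coeFn_smul,
      Pi.smul_apply, smul_eq_mul, diagOp_apply ⟨1, b1⟩, diagOp_apply ⟨1, b2⟩]
    have h1 : (d x : ℂ) - Complex.I ≠ 0 := fun h => by
      have := congrArg Complex.im h
      simp at this
    have h2 : ((d x : ℂ) ^ 2 + 1) ≠ 0 := by exact_mod_cast (hpos x).ne'
    push_cast
    field_simp
    linear_combination (y x) * (-1 : ℂ) * Complex.I_sq
  have hne : ∀ x, (d x : ℂ) - Complex.I ≠ 0 := fun x h => by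
    have := congrArg Complex.im h
    simp at this
  refine ⟨R1 + Complex.I • R2, ?_, fun y => ?_, fun v => ?_⟩
  · have h1 : IsApproxFinite R1 := isApproxFinite_diagOp ⟨1, b1⟩ fun ε hε =>
      (hd (1 / ε)).subset fun x hx => small ε hε x (Or.inl hx)
    have h2 : IsApproxFinite R2 := isApproxFinite_diagOp ⟨1, b2⟩ fun ε hε =>
      (hd (1 / ε)).subset fun x hx => small ε hε x (Or.inr hx)
    refine (h1.add ?_).isCompactOperator
    have := h2.comp_left (Complex.I • (1 : L2h →L[ℂ] L2h))
    change IsApproxFinite (Complex.I • (1 : L2h →L[ℂ] L2h) * R2) at this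
    rwa [smul_one_mul] at this
  · have hg : ∀ x, (y + Complex.I • (R1 + Complex.I • R2) y) x =
        (d x : ℂ) * (R1 + Complex.I • R2) y x := by
      intro x
      rw [lp.coeFn_add, Pi.add_apply, lp.coeFn_smul, Pi.smul_apply, smul_eq_mul, hR]
      have := hne x
      field_simp
      ring
    refine ⟨mem_diagPMap_domain hg, ?_⟩
    rw [diagPMap_eq hg, add_sub_cancel_right]
  · ext x
    rw [hR, lp.coeFn_sub, Pi.sub_apply, diagPMap_apply, lp.coeFn_smul, Pi.smul_apply, smul_eq_mul,
      ← sub_mul, ← mul_assoc, one_div_mul_cancel (hne x), one_mul]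

/-! ### Bounded commutators with a diagonal operator -/

/-- The commutator of `diagPMap d` with `a` is bounded. -/
def HasBoundedCommutator (d : Idx → ℝ) (a : L2h →L[ℂ] L2h) : Prop :=
  ∃ C : L2h →L[ℂ] L2h, ∀ v u : L2h, (∀ x, u x = (d x : ℂ) * v x) →
    ∀ x, (a u + C v) x = (d x : ℂ) * a v x

namespace HasBoundedCommutator

variable {d : Idx → ℝ} {a b : L2h →L[ℂ] L2h}

theorem smul_one (c : ℂ) : HasBoundedCommutator d (c • 1) := by
  refine ⟨0, fun v u h x => ?_⟩
  simp only [_root_.smul_apply, one_apply_eq_self, _root_.zero_apply, add_zero, lp.coeFn_smul,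
    Pi.smul_apply, smul_eq_mul, h]
  ring

theorem add (ha : HasBoundedCommutator d a) (hb : HasBoundedCommutator d b) :
    HasBoundedCommutator d (a + b) := by
  obtain ⟨C, hC⟩ := ha
  obtain ⟨C', hC'⟩ := hb
  refine ⟨C + C', fun v u h x => ?_⟩
  have h1 := hC v u h x
  have h2 := hC' v u h x
  simp only [_root_.add_apply, lp.coeFn_add, Pi.add_apply] at h1 h2 ⊢
  rw [mul_add, ← h1, ← h2]
  ring

/-- The Leibniz rule [D, ab] = a[D, b] + [D, a]b; the hypothesis on a is applied to bv, whose image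
under D is bu + C'v. -/
theorem mul (ha : HasBoundedCommutator d a) (hb : HasBoundedCommutator d b) :
    HasBoundedCommutator d (a * b) := by
  obtain ⟨C, hC⟩ := ha
  obtain ⟨C', hC'⟩ := hb
  refine ⟨a * C' + C * b, fun v u h x => ?_⟩
  have h1 := hC (b v) (b u + C' v) (hC' v u h) x
  simp only [_root_.add_apply, mul_apply_eq_comp, map_add] at h1 ⊢
  rw [← h1, add_assoc]

/-- The commutator is again a weighted shift, its weight multiplied by the increment of d along the
shift. -/
theorem shift_mul_diagOp (s t : Fin 2) {w : Idx → ℝ} {B C : ℝ} (hw : ∀ x, |w x| ≤ B)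
    (hd : ∀ x, |w x * (d (up s t x) - d x)| ≤ C) :
    HasBoundedCommutator d (shift s t * diagOp w) := by
  refine ⟨shift s t * diagOp fun x => w x * (d (up s t x) - d x), fun v u h y => ?_⟩
  rw [lp.coeFn_add, Pi.add_apply, mul_apply_eq_comp, mul_apply_eq_comp, mul_apply_eq_comp]
  by_cases hy : y ∈ Set.range (up s t)
  · obtain ⟨x, rfl⟩ := hy
    rw [shift_apply_up, shift_apply_up, shift_apply_up, diagOp_apply ⟨B, hw⟩, diagOp_apply ⟨C, hd⟩,
      diagOp_apply ⟨B, hw⟩, h]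
    push_cast
    ring
  · rw [shift_apply_of_notMem s t _ y hy, shift_apply_of_notMem s t _ y hy,
      shift_apply_of_notMem s t _ y hy, mul_zero, add_zero]

theorem diagOp_mul_star_shift (s t : Fin 2) {w : Idx → ℝ} {B C : ℝ} (hw : ∀ x, |w x| ≤ B)
    (hd : ∀ x, |w x * (d (up s t x) - d x)| ≤ C) :
    HasBoundedCommutator d (diagOp w * star (shift s t)) := by
  refine ⟨-((diagOp fun x => w x * (d (up s t x) - d x)) * star (shift s t)), fun v u h x => ?_⟩
  have hs : ∀ (v : L2h) x, star (shift s t) v x = v (up s t x) := adjoint_shift_apply s t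
  rw [lp.coeFn_add, Pi.add_apply, _root_.neg_apply, lp.coeFn_neg, Pi.neg_apply, mul_apply_eq_comp,
    mul_apply_eq_comp, mul_apply_eq_comp, diagOp_apply ⟨B, hw⟩, diagOp_apply ⟨C, hd⟩,
    diagOp_apply ⟨B, hw⟩, hs, hs, h]
  push_cast
  ring

/-- With u = Dv, the defining identity exhibits the coordinates of D(av) as those of the vector au +
Cv, which also puts av into the domain. -/
theorem exists_bound (ha : HasBoundedCommutator d a) :
    ∃ C : ℝ, ∀ x : (diagPMap d).domain, ∃ h : a x ∈ (diagPMap d).domain,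
      ‖diagPMap d ⟨a x, h⟩ - a (diagPMap d x)‖ ≤ C * ‖(x : L2h)‖ := by
  obtain ⟨C, hC⟩ := ha
  refine ⟨‖C‖, fun v => ?_⟩
  have h := hC v (diagPMap d v) fun _ => rfl
  refine ⟨mem_diagPMap_domain h, ?_⟩
  rw [diagPMap_eq h, add_sub_cancel_left]
  exact C.le_opNorm _

end HasBoundedCommutator

theorem star_shift_mul_diagOp (s t : Fin 2) {w : Idx → ℝ} (hw : ∃ C, ∀ x, |w x| ≤ C) :
    star (shift s t) * diagOp w = diagOp (fun x => w (up s t x)) * star (shift s t) := by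
  have hw' : ∃ C, ∀ x, |w (up s t x)| ≤ C := hw.imp fun C hC x => hC _
  have hs : ∀ (v : L2h) x, star (shift s t) v x = v (up s t x) := adjoint_shift_apply s t
  ext v x
  rw [mul_apply_eq_comp, mul_apply_eq_comp, hs, diagOp_apply hw, diagOp_apply hw', hs]

theorem hasBoundedCommutator_polyAlg {q : ℝ} (h0 : 0 < q) (h1 : q < 1) {d : Idx → ℝ} {C : ℝ}
    (hap : ∀ x, |aPlus q x * (d (up 0 0 x) - d x)| ≤ C)
    (ham : ∀ x, |aMinus q (up 1 1 x) * (d (up 1 1 x) - d x)| ≤ C)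
    (hbp : ∀ x, |bPlus q x * (d (up 1 0 x) - d x)| ≤ C)
    (hbm : ∀ x, |bMinus q (up 0 1 x) * (d (up 0 1 x) - d x)| ≤ C)
    {a : L2h →L[ℂ] L2h} (ha : a ∈ polyAlg q) : HasBoundedCommutator d a := by
  have hc := coefficients_bounded h0 h1
  have eα : alpha q = shift 0 0 * diagOp (aPlus q) +
      diagOp (fun x => aMinus q (up 1 1 x)) * star (shift 1 1) := by
    rw [← star_shift_mul_diagOp 1 1 ⟨1, fun x => (hc x).2.1⟩]; rfl
  have eβ : beta q = shift 1 0 * diagOp (bPlus q) +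
      diagOp (fun x => bMinus q (up 0 1 x)) * star (shift 0 1) := by
    rw [← star_shift_mul_diagOp 0 1 ⟨1, fun x => (hc x).2.2.2⟩]; rfl
  -- The adjoint is carried along in the induction because boundedness of the commutator is not
  -- visibly stable under `star`.
  refine (StarAlgebra.adjoin_induction (p := fun a _ => HasBoundedCommutator d a ∧
    HasBoundedCommutator d (star a)) ?_ ?_ ?_ ?_ ?_ ha).1
  · intro b hb
    rcases hb with rfl | hb
    · rw [eα]
      refine ⟨(HasBoundedCommutator.shift_mul_diagOp 0 0 (fun x => (hc x).1) hap).add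
        (HasBoundedCommutator.diagOp_mul_star_shift 1 1 (fun x => (hc _).2.1) ham), ?_⟩
      rw [star_add, star_mul, star_mul, star_star, star_diagOp, star_diagOp]
      exact (HasBoundedCommutator.diagOp_mul_star_shift 0 0 (fun x => (hc x).1) hap).add
        (HasBoundedCommutator.shift_mul_diagOp 1 1 (fun x => (hc _).2.1) ham)
    · rw [Set.mem_singleton_iff.1 hb, eβ]
      refine ⟨(HasBoundedCommutator.shift_mul_diagOp 1 0 (fun x => (hc x).2.2.1) hbp).add
        (HasBoundedCommutator.diagOp_mul_star_shift 0 1 (fun x => (hc _).2.2.2) hbm), ?_⟩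
      rw [star_add, star_mul, star_mul, star_star, star_diagOp, star_diagOp]
      exact (HasBoundedCommutator.diagOp_mul_star_shift 1 0 (fun x => (hc x).2.2.1) hbp).add
        (HasBoundedCommutator.shift_mul_diagOp 0 1 (fun x => (hc _).2.2.2) hbm)
  · intro c
    rw [Algebra.algebraMap_eq_smul_one, star_smul, star_one]
    exact ⟨HasBoundedCommutator.smul_one c, HasBoundedCommutator.smul_one _⟩
  · intro a b _ _ ha hb
    rw [star_add]
    exact ⟨ha.1.add hb.1, ha.2.add hb.2⟩
  · intro a b _ _ ha hb
    rw [star_mul]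
    exact ⟨ha.1.mul hb.1, hb.2.mul ha.2⟩
  · intro a _ ha
    rw [star_star]
    exact ⟨ha.2, ha.1⟩

/-! ### The Dirac weights and their increments -/

open scoped Classical in
/-- The spectrum `± (2n + 1)` of the Dirac operator, where the sign is `-s` on the labels with
`n - i ∈ F` and `s` on the others. -/
noncomputable def diracWeight (s : ℝ) (F : Finset ℕ) (x : Idx) : ℝ :=
  s * (if x.N - x.I ∈ F then -1 else 1) * ((x.N : ℝ) + 1)

theorem abs_diracWeight {s : ℝ} (hs : |s| = 1) (F : Finset ℕ) (x : Idx) :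
    |diracWeight s F x| = (x.N : ℝ) + 1 := by
  have h : (0 : ℝ) < (x.N : ℝ) + 1 := by positivity
  rw [diracWeight, abs_mul, abs_mul, hs, one_mul, abs_of_pos h]
  split_ifs <;> simp

/-- n - i is unchanged along `up 1 t`, so the sign stays and the modulus grows by one. -/
theorem abs_diracWeight_up_one_sub {s : ℝ} (hs : |s| = 1) (F : Finset ℕ) (t : Fin 2) (x : Idx) :
    |diracWeight s F (up 1 t x) - diracWeight s F x| = 1 := by
  classical
  have h1 : (up 1 t x).N - (up 1 t x).I = x.N - x.I := by simp [up]
  have h2 : ((up 1 t x).N : ℝ) = x.N + 1 := by simp [up]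
  rw [diracWeight, diracWeight, h1, h2, ← mul_sub, add_sub_add_right_eq_sub, add_sub_cancel_left,
    mul_one, abs_mul, hs, one_mul]
  split_ifs <;> simp

theorem exists_linear_mul_pow_bound {q : ℝ} (h0 : 0 < q) (h1 : q < 1) (M : ℝ) :
    ∃ C, 1 ≤ C ∧ ∀ n : ℕ, (2 * n + M) * q ^ n ≤ C := by
  have h2 := tendsto_self_mul_const_pow_of_lt_one h0.le h1
  have h3 := tendsto_pow_atTop_nhds_zero_of_lt_one h0.le h1
  have h4 := (h2.const_mul 2).add (h3.const_mul M)
  obtain ⟨C, hC⟩ := h4.bddAbove_range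
  refine ⟨max C 1, le_max_right _ _, fun n => le_trans (le_of_eq ?_) ((hC ⟨n, rfl⟩).trans (le_max_left _ _))⟩
  ring

/-- Along `up 0 t` the number n - i grows by one and the sign may flip, but not once n - i exceeds
max F. Up to there N ≤ I + max F, so q^I dominates the linear growth of the increment. -/
theorem exists_abs_diracWeight_up_zero_sub_le {q : ℝ} (h0 : 0 < q) (h1 : q < 1) {s : ℝ}
    (hs : |s| = 1) (F : Finset ℕ) : ∃ C, 1 ≤ C ∧ ∀ (t : Fin 2) (x : Idx),
    q ^ x.I * |diracWeight s F (up 0 t x) - diracWeight s F x| ≤ C := by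
  classical
  -- The increment is at most (N + 2) + (N + 1) = 2N + 3 ≤ 2I + 2 max F + 3; `F.sup id` is 0 for
  -- empty F.
  obtain ⟨C, hC1, hC⟩ := exists_linear_mul_pow_bound h0 h1 (2 * (F.sup id : ℕ) + 3)
  refine ⟨C, hC1, fun t x => ?_⟩
  have hI := x.hI
  have hN : ((up 0 t x).N : ℝ) = x.N + 1 := by simp [up]
  have hK : (up 0 t x).N - (up 0 t x).I = x.N - x.I + 1 := by simp [up]; omega
  have hqI : 0 < q ^ x.I := pow_pos h0 _
  by_cases hF : x.N - x.I ≤ F.sup id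
  · have hb : |diracWeight s F (up 0 t x) - diracWeight s F x| ≤ 2 * x.N + 3 := by
      refine (abs_sub _ _).trans ?_
      rw [abs_diracWeight hs, abs_diracWeight hs, hN]
      linarith
    have hNb : (x.N : ℝ) ≤ x.I + (F.sup id : ℕ) := by
      have : x.N ≤ x.I + F.sup id := by omega
      exact_mod_cast this
    calc q ^ x.I * |diracWeight s F (up 0 t x) - diracWeight s F x|
        ≤ q ^ x.I * (2 * x.I + (2 * (F.sup id : ℕ) + 3)) :=
          mul_le_mul_of_nonneg_left (hb.trans (by linarith)) hqI.le
      _ ≤ C := by rw [mul_comm]; exact hC x.I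
  · have hn1 : x.N - x.I ∉ F := fun h => hF (Finset.le_sup (f := id) h)
    have hn2 : x.N - x.I + 1 ∉ F := fun h => by
      have := Finset.le_sup (f := id) h
      simp only [id] at this hF
      omega
    rw [diracWeight, diracWeight, hK, if_neg hn1, if_neg hn2, hN, ← mul_sub,
      add_sub_add_right_eq_sub, add_sub_cancel_left, mul_one, mul_one, hs, mul_one]
    exact (pow_le_one₀ h0.le h1.le).trans hC1

theorem aPlus_le {q : ℝ} (h0 : 0 < q) (h1 : q < 1) (x : Idx) : |aPlus q x| ≤ q ^ x.I := by
  have hI := x.hI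
  have hJ := x.hJ
  have n := one_sub_pow_nonneg h0 h1
  have h2 : q ^ (2 * x.I + 2 * x.J + 2) = (q ^ (x.I + x.J + 1)) ^ 2 := by
    rw [← pow_mul]; congr 1; ring
  rw [aPlus, Real.sqrt_mul (by positivity), h2, Real.sqrt_sq (by positivity), abs_mul,
    abs_of_nonneg (by positivity)]
  have h3 : |√((1 - q ^ (2 * (x.N - x.J) + 2)) * (1 - q ^ (2 * (x.N - x.I) + 2)) /
      ((1 - q ^ (2 * x.N + 2)) * (1 - q ^ (2 * x.N + 4))))| ≤ 1 := by
    rw [← one_mul (_ / _)]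
    exact coeff_le_one le_rfl (n _) (one_sub_pow_le h0 h1 (by omega)) (n _)
      (one_sub_pow_le h0 h1 (by omega))
  calc _ ≤ q ^ (x.I + x.J + 1) * 1 := mul_le_mul_of_nonneg_left h3 (by positivity)
    _ ≤ q ^ x.I := by
      rw [mul_one]; exact pow_le_pow_of_le_one h0.le h1.le (by omega)

theorem isOddSpectralTriple_diracWeight {q : ℝ} (h0 : 0 < q) (h1 : q < 1) {s : ℝ}
    (hs : |s| = 1) (F : Finset ℕ) :
    IsOddSpectralTriple (polyAlg q) (diagPMap (diracWeight s F)) where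
  selfAdjoint := isSelfAdjoint_diagPMap _
  compactResolvent := compactResolvent_diagPMap fun M => by
    refine (finite_N_le ⌈M⌉₊).subset fun x hx => ?_
    rw [Set.mem_ofPred_eq, abs_diracWeight hs] at hx
    have h2 : (x.N : ℝ) ≤ ⌈M⌉₊ := by linarith [Nat.le_ceil M]
    exact_mod_cast h2
  boundedCommutators := fun a ha => by
    obtain ⟨C, hC1, hC⟩ := exists_abs_diracWeight_up_zero_sub_le h0 h1 hs F
    have hc := coefficients_bounded h0 h1
    refine (hasBoundedCommutator_polyAlg h0 h1 (C := C) (fun x => ?_) (fun x => ?_) (fun x => ?_)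
      (fun x => ?_) ha).exists_bound
    · rw [abs_mul]
      exact (mul_le_mul_of_nonneg_right (aPlus_le h0 h1 x) (abs_nonneg _)).trans (hC 0 x)
    · rw [abs_mul, abs_diracWeight_up_one_sub hs, mul_one]
      exact (hc _).2.1.trans hC1
    · rw [abs_mul, abs_diracWeight_up_one_sub hs, mul_one]
      exact (hc _).2.2.1.trans hC1
    · rw [abs_mul]
      refine (mul_le_mul_of_nonneg_right ((abs_bMinus_le h0 h1 _).trans (one_mul _).le)
        (abs_nonneg _)).trans (hC 1 x)

/-! ### Equivariance and sign of the Dirac operators -/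

theorem ofFinsupp_single (x : Idx) (c : ℂ) : ofFinsupp (Finsupp.single x c) = c • e x :=
  Finsupp.linearCombination_single ℂ c x

theorem onBasis_single (f : Idx → (Idx →₀ ℂ)) (x : Idx) (c : ℂ) :
    onBasis f (Finsupp.single x c) = c • f x :=
  Finsupp.linearCombination_single ℂ c x

/-- A₀, A₁ and A₁* act on the index j alone, and the eigenvalues depend only on n and i. -/
theorem isEquivariant_diagPMap (q : ℝ) {d : Idx → ℝ} 
    (hd : ∀ x y : Idx, x.N = y.N → x.I = y.I → d x = d y) : IsEquivariant q (diagPMap d) := by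
  refine ⟨onBasis fun x => Finsupp.single x (d x : ℂ), fun f => ?_, ?_, ?_, ?_⟩
  · have h : ∀ x, ofFinsupp (onBasis (fun x => Finsupp.single x (d x : ℂ)) f) x =
        (d x : ℂ) * ofFinsupp f x := by
      intro x
      induction f using Finsupp.induction_linear with
      | zero => simp
      | add f g hf hg => simp only [map_add, lp.coeFn_add, Pi.add_apply, hf, hg, mul_add]
      | single y c =>
        rw [onBasis_single, map_smul, ofFinsupp_single, ofFinsupp_single, lp.coeFn_smul,
          Pi.smul_apply, smul_e_apply_eq, lp.coeFn_smul, Pi.smul_apply, smul_eq_mul, smul_eq_mul]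
        ring
    exact ⟨mem_diagPMap_domain h, diagPMap_eq h⟩
  · refine Finsupp.lhom_ext fun x c => ?_
    simp only [LinearMap.comp_apply, A₀, onBasis_single, Finsupp.smul_single, smul_eq_mul]
    congr 1; ring
  · refine Finsupp.lhom_ext fun x c => ?_
    simp only [LinearMap.comp_apply, A₁, onBasis_single, map_smul]
    split_ifs with h
    · rw [onBasis_single, hd ⟨x.N, x.I, x.J + 1, x.hI, h⟩ x rfl rfl]
      simp only [Finsupp.smul_single, smul_eq_mul]
      congr 1; ring
    · simp
  · refine Finsupp.lhom_ext fun x c => ?_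
    simp only [LinearMap.comp_apply, A₁Star, onBasis_single, map_smul]
    split_ifs with h
    · rw [onBasis_single, hd ⟨x.N, x.I, x.J - 1, x.hI, _⟩ x rfl rfl]
      simp only [Finsupp.smul_single, smul_eq_mul]
      congr 1; ring
    · simp

/-- An eigenvector with eigenvalue c has zero coordinate at every label where d differs from c. -/
theorem starProjection_spectralSubspace_diagPMap (d : Idx → ℝ) (Λ : Set ℝ) :
    (spectralSubspace (diagPMap d) Λ).starProjection = indOp {x | d x ∈ Λ} := by
  refine starProjection_eq_indOp _ (Submodule.isClosed_topologicalClosure _) _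
    (fun x hx => Submodule.le_topologicalClosure _ (Submodule.subset_span
      ⟨mem_diagPMap_domain (smul_e_apply_eq d x), d x, hx, diagPMap_eq (smul_e_apply_eq d x)⟩))
    fun v hv x hx => apply_eq_zero_of_mem_closure_span ?_ hv
  rintro v ⟨hv, c, hc, h⟩
  have h1 := congrArg (fun u : L2h => u x) h
  simp only [diagPMap_apply, lp.coeFn_smul, Pi.smul_apply, smul_eq_mul] at h1
  have h2 : ((d x : ℂ) - c) * v x = 0 := by rw [sub_mul, h1, sub_self]
  refine (mul_eq_zero.1 h2).resolve_left fun h3 => hx ?_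
  have h4 : d x = c := by exact_mod_cast sub_eq_zero.1 h3
  rwa [Set.mem_ofPred_eq, h4]

theorem rowsProj_eq_indOp (F : Finset ℕ) : rowsProj F = indOp {x | x.N - x.I ∈ F} := by
  classical
  refine clm_ext_e fun x => ?_
  have hI := x.hI
  have hP : ∀ k, P k (e x) = if x.N - x.I = k then e x else 0 := fun k => by
    rw [P_eq_indOp]
    split_ifs with h
    · exact indOp_e_of_mem (show x.I + k = x.N by omega)
    · exact indOp_e_of_notMem (show ¬ x.I + k = x.N by omega)
  rw [rowsProj, _root_.sum_apply]
  simp only [hP, Finset.sum_ite_eq]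
  split_ifs with h
  · exact (indOp_e_of_mem h).symm
  · exact (indOp_e_of_notMem h).symm

theorem signOp_diracWeight {s : ℝ} (hs : s = 1 ∨ s = -1) (F : Finset ℕ) :
    signOp (diagPMap (diracWeight s F)) = (s : ℂ) • (1 - (2 : ℂ) • ∑ k ∈ F, P k) := by
  classical
  have hrows : ∑ k ∈ F, P k = rowsProj F := rfl
  rw [signOp, starProjection_spectralSubspace_diagPMap, starProjection_spectralSubspace_diagPMap,
    hrows, rowsProj_eq_indOp]
  refine clm_ext_e fun x => ?_
  have hN : (0 : ℝ) < (x.N : ℝ) + 1 := by positivity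
  simp only [_root_.sub_apply, _root_.smul_apply, one_apply_eq_self]
  by_cases hF : x.N - x.I ∈ F
  · have hw : diracWeight s F x = -(s * ((x.N : ℝ) + 1)) := by rw [diracWeight, if_pos hF]; ring
    rw [indOp_e_of_mem (A := {x : Idx | x.N - x.I ∈ F}) hF]
    rcases hs with rfl | rfl
    · rw [indOp_e_of_notMem, indOp_e_of_mem]
      · push_cast; module
      · simp only [Set.mem_ofPred_eq, hw, Set.mem_Iio]; linarith
      · simp only [Set.mem_ofPred_eq, hw, Set.mem_Ioi]; linarith
    · rw [indOp_e_of_mem, indOp_e_of_notMem]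
      · push_cast; module
      · simp only [Set.mem_ofPred_eq, hw, Set.mem_Iio]; linarith
      · simp only [Set.mem_ofPred_eq, hw, Set.mem_Ioi]; linarith
  · have hw : diracWeight s F x = s * ((x.N : ℝ) + 1) := by rw [diracWeight, if_neg hF]; ring
    rw [indOp_e_of_notMem (A := {x : Idx | x.N - x.I ∈ F}) hF]
    rcases hs with rfl | rfl
    · rw [indOp_e_of_mem, indOp_e_of_notMem]
      · push_cast; module
      · simp only [Set.mem_ofPred_eq, hw, Set.mem_Iio]; linarith
      · simp only [Set.mem_ofPred_eq, hw, Set.mem_Ioi]; linarith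
    · rw [indOp_e_of_notMem, indOp_e_of_mem]
      · push_cast; module
      · simp only [Set.mem_ofPred_eq, hw, Set.mem_Iio]; linarith
      · simp only [Set.mem_ofPred_eq, hw, Set.mem_Ioi]; linarith

theorem exists_isEquivariantSpectralTriple {q : ℝ} (h0 : 0 < q) (h1 : q < 1) (m : ℤ)
    (F : Finset ℕ) : ∃ D : L2h →ₗ.[ℂ] L2h, IsEquivariantSpectralTriple q D ∧
      signOp D = (if 0 ≤ m then (1 : ℂ) else -1) • (1 - (2 : ℂ) • ∑ k ∈ F, P k) := by
  have key : ∀ s : ℝ, s = 1 ∨ s = -1 → IsEquivariantSpectralTriple q (diagPMap (diracWeight s F)) :=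
    fun s hs => ⟨isOddSpectralTriple_diracWeight h0 h1 (by rcases hs with rfl | rfl <;> simp) F,
      isEquivariant_diagPMap q fun x y hN hI => by rw [diracWeight, diracWeight, hN, hI]⟩
  split_ifs
  · exact ⟨_, key 1 (Or.inl rfl), by rw [signOp_diracWeight (Or.inl rfl), Complex.ofReal_one]⟩
  · exact ⟨_, key (-1) (Or.inr rfl), by
      rw [signOp_diracWeight (Or.inr rfl), Complex.ofReal_neg, Complex.ofReal_one]⟩

/-! ### The pairing in terms of the sign -/

/-- The sign of `D` determines the pairing with `γ_r`. -/
theorem pairingEq_of_signOp {q : ℝ} (h0 : 0 < q) (h1 : q < 1) {r : ℕ}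
    (hr : q ^ (2 * r) < 1 / 2) (u : (contAlg q)ˣ)
    (hu : ((u : contAlg q) : L2h →L[ℂ] L2h) = gamma q r) {m : ℤ} {F : Finset ℕ}
    (hF : F.card = m.natAbs) {D : L2h →ₗ.[ℂ] L2h} (hD : IsSelfAdjoint D)
    (hS : signOp D = (if 0 ≤ m then (1 : ℂ) else -1) • (1 - (2 : ℂ) • ∑ k ∈ F, P k)) :
    PairingEq u D m := by
  have hunit : IsUnit (gamma q r) := by
    rw [← hu]
    exact u.isUnit.map (contAlg q).subtype
  have hp := rowsProj_mul_self F
  have hrows : ∑ k ∈ F, P k = rowsProj F := rfl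
  rw [hrows] at hS
  set p := rowsProj F
  have hpp : (1 - (2 : ℂ) • p) * (1 - (2 : ℂ) • p) = 1 := by
    rw [mul_sub, sub_mul, sub_mul, smul_mul_smul_comm, hp]
    simp only [mul_one, one_mul]
    module
  rw [PairingEq, hu]
  refine HasFredholmIndex.compress ?_
  have hK := starProjection_Ici_of_signOp_mul_self hD (by
    rw [hS, smul_mul_smul_comm, hpp]
    split_ifs <;> norm_num)
  rw [hS] at hK
  have h2 : (2 : ℂ) ≠ 0 := two_ne_zero
  -- The projection χ_{[0,∞)}(D) is 1 - p for m ≥ 0 and p for m < 0, so the index is |F| or -|F|,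
  -- equal to m in both cases.
  split_ifs at hK with hm
  · have hK' : (spectralSubspace D (Set.Ici 0)).starProjection = 1 - p := by
      refine smul_right_injective _ h2 (hK.trans ?_)
      module
    rw [hK', sub_sub_cancel]
    have hm' : m = F.card := by omega
    rw [hm']
    exact hasFredholmIndex_gamma_compl_rows h0 h1 hr hunit F
  · have hK' : (spectralSubspace D (Set.Ici 0)).starProjection = p := by
      refine smul_right_injective _ h2 (hK.trans ?_)
      module
    rw [hK']
    have hm' : m = -(F.card : ℤ) := by omega
    rw [hm']
    exact hasFredholmIndex_gamma_rows h0 h1 hr F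

/-! ### An algebraic model of `L₂(h)` with rational coefficients -/

/-- `N, I, J` are the coordinates of a label. -/
def ValidIdx (N I J : ℤ) : Prop := 0 ≤ I ∧ I ≤ N ∧ 0 ≤ J ∧ J ≤ N

open scoped Classical in
/-- The basis vector with label `N, I, J`, or `0` if there is no such label. -/
noncomputable def basisVec (N I J : ℤ) : Idx →₀ ℂ :=
  if h : ValidIdx N I J then
    Finsupp.single ⟨N.toNat, I.toNat, J.toNat, Int.toNat_le_toNat h.2.1,
      Int.toNat_le_toNat h.2.2.2⟩ 1
  else 0

theorem basisVec_of_not_valid {N I J : ℤ} (h : ¬ ValidIdx N I J) : basisVec N I J = 0 := dif_neg h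

theorem basisVec_coe (x : Idx) : basisVec x.N x.I x.J = Finsupp.single x 1 := by
  have hI := x.hI
  have hJ := x.hJ
  rw [basisVec, dif_pos ⟨by omega, by omega, by omega, by omega⟩]
  rfl

theorem basisVec_eq {N I J : ℤ} {x : Idx} (hN : N = x.N) (hI : I = x.I) (hJ : J = x.J) :
    basisVec N I J = Finsupp.single x 1 := by
  rw [hN, hI, hJ, basisVec_coe]

theorem ValidIdx.exists_idx {N I J : ℤ} (h : ValidIdx N I J) :
    ∃ x : Idx, N = x.N ∧ I = x.I ∧ J = x.J := by
  obtain ⟨h1, h2, h3, h4⟩ := h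
  exact ⟨⟨N.toNat, I.toNat, J.toNat, by omega, by omega⟩, by simp; omega, by simp; omega,
    by simp; omega⟩

theorem validIdx_coe (x : Idx) : ValidIdx x.N x.I x.J := by
  have hI := x.hI
  have hJ := x.hJ
  exact ⟨by omega, by omega, by omega, by omega⟩

theorem linearMap_ext_basisVec {M : Type*} [AddCommMonoid M] [Module ℂ M]
    {f g : (Idx →₀ ℂ) →ₗ[ℂ] M}
    (h : ∀ N I J, ValidIdx N I J → f (basisVec N I J) = g (basisVec N I J)) : f = g := by
  refine Finsupp.lhom_ext' fun x => LinearMap.ext_ring ?_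
  have := h x.N x.I x.J (validIdx_coe x)
  rwa [basisVec_coe] at this

/-- The data of an operator that moves `N, I, J` to `N + 1, I + s, J + t` and to
`N - 1, I + s - 1, J + t - 1`, with coefficients that depend on `q^N`, `q^I`, `q^J`. -/
structure Ladder where
  s : ℤ
  t : ℤ
  u : ℂ → ℂ → ℂ → ℂ
  d : ℂ → ℂ → ℂ → ℂ

/-- The operator of a ladder. -/
noncomputable def Ladder.op (q : ℂ) (L : Ladder) : (Idx →₀ ℂ) →ₗ[ℂ] (Idx →₀ ℂ) :=
  onBasis fun x =>
    L.u (q ^ (x.N : ℤ)) (q ^ (x.I : ℤ)) (q ^ (x.J : ℤ)) •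
      basisVec (x.N + 1) (x.I + L.s) (x.J + L.t) +
    L.d (q ^ (x.N : ℤ)) (q ^ (x.I : ℤ)) (q ^ (x.J : ℤ)) •
      basisVec (x.N - 1) (x.I + L.s - 1) (x.J + L.t - 1)

/-- The coefficients of a ladder vanish on the boundary. -/
structure Ladder.IsProper (q : ℂ) (L : Ladder) : Prop where
  s_eq : L.s = 0 ∨ L.s = 1
  t_eq : L.t = 0 ∨ L.t = 1
  d_eq_zero : ∀ N I J, ValidIdx N I J → ¬ ValidIdx (N - 1) (I + L.s - 1) (J + L.t - 1) →
    L.d (q ^ N) (q ^ I) (q ^ J) = 0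

theorem Ladder.op_basisVec (q : ℂ) (L : Ladder) {N I J : ℤ} (h : ValidIdx N I J) :
    L.op q (basisVec N I J) =
      L.u (q ^ N) (q ^ I) (q ^ J) • basisVec (N + 1) (I + L.s) (J + L.t) +
      L.d (q ^ N) (q ^ I) (q ^ J) • basisVec (N - 1) (I + L.s - 1) (J + L.t - 1) := by
  obtain ⟨x, rfl, rfl, rfl⟩ := h.exists_idx
  rw [basisVec_coe, Ladder.op, onBasis_single, one_smul]

theorem Ladder.IsProper.valid_up {q : ℂ} {L : Ladder} (hL : L.IsProper q) {N I J : ℤ}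
    (h : ValidIdx N I J) : ValidIdx (N + 1) (I + L.s) (J + L.t) := by
  obtain ⟨h1, h2, h3, h4⟩ := h
  rcases hL.s_eq with hs | hs <;> rcases hL.t_eq with ht | ht <;> rw [hs, ht] <;>
    exact ⟨by omega, by omega, by omega, by omega⟩

/-- The coefficients of the composite of two ladders. -/
noncomputable def Ladder.top (q : ℂ) (L' L : Ladder) (Z X Y : ℂ) : ℂ :=
  L.u Z X Y * L'.u (Z * q) (X * q ^ L.s) (Y * q ^ L.t)

/-- See `Ladder.top`. -/
noncomputable def Ladder.mid (q : ℂ) (L' L : Ladder) (Z X Y : ℂ) : ℂ :=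
  L.u Z X Y * L'.d (Z * q) (X * q ^ L.s) (Y * q ^ L.t) +
    L.d Z X Y * L'.u (Z / q) (X * q ^ (L.s - 1)) (Y * q ^ (L.t - 1))

/-- See `Ladder.top`. -/
noncomputable def Ladder.bot (q : ℂ) (L' L : Ladder) (Z X Y : ℂ) : ℂ :=
  L.d Z X Y * L'.d (Z / q) (X * q ^ (L.s - 1)) (Y * q ^ (L.t - 1))

/-- A lowering step that leaves the set of labels has coefficient zero, so the composite obeys one
formula with no boundary cases. This is the purpose of `Ladder.IsProper`. -/
theorem Ladder.op_op_basisVec {q : ℂ} (hq : q ≠ 0) {L' L : Ladder} (hL : L.IsProper q) (S T : ℤ)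
    (hS : L.s + L'.s = S) (hT : L.t + L'.t = T) {N I J : ℤ} (h : ValidIdx N I J) :
    L'.op q (L.op q (basisVec N I J)) =
      Ladder.top q L' L (q ^ N) (q ^ I) (q ^ J) • basisVec (N + 2) (I + S) (J + T) +
      Ladder.mid q L' L (q ^ N) (q ^ I) (q ^ J) • basisVec N (I + S - 1) (J + T - 1) +
      Ladder.bot q L' L (q ^ N) (q ^ I) (q ^ J) • basisVec (N - 2) (I + S - 2) (J + T - 2) := by
  have hdown : L.d (q ^ N) (q ^ I) (q ^ J) • L'.op q (basisVec (N - 1) (I + L.s - 1) (J + L.t - 1))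
      = L.d (q ^ N) (q ^ I) (q ^ J) • (L'.u (q ^ N / q) (q ^ I * q ^ (L.s - 1))
        (q ^ J * q ^ (L.t - 1)) • basisVec N (I + S - 1) (J + T - 1) +
        L'.d (q ^ N / q) (q ^ I * q ^ (L.s - 1)) (q ^ J * q ^ (L.t - 1)) •
          basisVec (N - 2) (I + S - 2) (J + T - 2)) := by
    by_cases hv : ValidIdx (N - 1) (I + L.s - 1) (J + L.t - 1)
    · rw [L'.op_basisVec q hv, zpow_sub_one₀ hq, ← div_eq_mul_inv, ← zpow_add₀ hq, ← zpow_add₀ hq,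
        add_sub_assoc I, add_sub_assoc J, ← hS, ← hT]
      congr 3 <;> congr 1 <;> ring
    · rw [hL.d_eq_zero N I J h hv, zero_smul, zero_smul]
  rw [L.op_basisVec q h, map_add, map_smul, map_smul, hdown, L'.op_basisVec q (hL.valid_up h),
    Ladder.top, Ladder.mid, Ladder.bot, zpow_add_one₀ hq, zpow_add₀ hq, zpow_add₀ hq,
    show N + 1 + 1 = N + 2 by ring, show I + L.s + L'.s = I + S by rw [← hS]; ring,
    show J + L.t + L'.t = J + T by rw [← hT]; ring, show N + 1 - 1 = N by ring]
  module

/-! ### Left and right ladders and the defining relations -/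

/-- The ladders of `α, α*, β, β*`, acting from the left. -/
noncomputable def leftLadder (q : ℂ) : Gen → Ladder
  | .a => ⟨0, 0, fun Z X Y => q * X * Y / (1 - (Z * q) ^ 2),
      fun Z X Y => (1 - X ^ 2) * (1 - Y ^ 2) / (1 - (Z * q) ^ 2)⟩
  | .aStar => ⟨1, 1, fun Z _ _ => 1 / (1 - (Z * q) ^ 2),
      fun Z X Y => q * X * Y * (1 - (Z / X) ^ 2) * (1 - (Z / Y) ^ 2) / (1 - (Z * q) ^ 2)⟩
  | .b => ⟨1, 0, fun Z _ Y => -Y / (1 - (Z * q) ^ 2),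
      fun Z X Y => X * (1 - Y ^ 2) * (1 - (Z / X) ^ 2) / (1 - (Z * q) ^ 2)⟩
  | .bStar => ⟨0, 1, fun Z X _ => X / (1 - (Z * q) ^ 2),
      fun Z X Y => -Y * (1 - X ^ 2) * (1 - (Z / Y) ^ 2) / (1 - (Z * q) ^ 2)⟩

/-- The ladders conjugate to those of `leftLadder` under `I ↦ N - I`, `J ↦ N - J`. -/
noncomputable def rightLadder (q : ℂ) (g : Gen) : Ladder :=
  ⟨1 - (leftLadder q g).s, 1 - (leftLadder q g).t,
    fun Z X Y => (leftLadder q g).u Z (Z / X) (Z / Y),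
    fun Z X Y => (leftLadder q g).d Z (Z / X) (Z / Y)⟩

/-- The factors 1 - X², 1 - Y², 1 - (Z/X)² and 1 - (Z/Y)² vanish at I = 0, J = 0, I = N and J = N,
exactly where the lowered label would leave the range. -/
theorem isProper_leftLadder {q : ℂ} (hq : q ≠ 0) (g : Gen) : (leftLadder q g).IsProper q := by
  cases g <;> refine ⟨by simp [leftLadder], by simp [leftLadder], ?_⟩ <;>
    rintro N I J ⟨h1, h2, h3, h4⟩ hv <;> simp only [leftLadder] at hv ⊢
  · rcases (by unfold ValidIdx at hv; omega : I = 0 ∨ J = 0) with rfl | rfl <;> simp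
  · rcases (by unfold ValidIdx at hv; omega : I = N ∨ J = N) with rfl | rfl <;>
      simp [div_self (zpow_ne_zero _ hq)]
  · rcases (by unfold ValidIdx at hv; omega : I = N ∨ J = 0) with rfl | rfl <;>
      simp [div_self (zpow_ne_zero _ hq)]
  · rcases (by unfold ValidIdx at hv; omega : I = 0 ∨ J = N) with rfl | rfl <;>
      simp [div_self (zpow_ne_zero _ hq)]

theorem isProper_rightLadder {q : ℂ} (hq : q ≠ 0) (g : Gen) : (rightLadder q g).IsProper q := by
  have h := isProper_leftLadder hq g
  refine ⟨?_, ?_, fun N I J hv hn => ?_⟩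
  · rcases h.s_eq with hs | hs <;> simp [rightLadder, hs]
  · rcases h.t_eq with hs | hs <;> simp [rightLadder, hs]
  · obtain ⟨h1, h2, h3, h4⟩ := hv
    have := h.d_eq_zero N (N - I) (N - J) ⟨by omega, by omega, by omega, by omega⟩ (fun hv => hn ?_)
    · rwa [zpow_sub₀ hq, zpow_sub₀ hq] at this
    · obtain ⟨k1, k2, k3, k4⟩ := hv
      simp only [rightLadder]
      exact ⟨by omega, by omega, by omega, by omega⟩

/-- A quadratic relation between ladder operators can be checked on coefficients. -/
theorem Ladder.op_relation {q : ℂ} (hq : q ≠ 0) (hq1 : ∀ n : ℕ, 1 - (q ^ (n + 1)) ^ 2 ≠ 0)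
    {L₁' L₁ L₂' L₂ : Ladder} (h₁ : L₁.IsProper q) (h₂ : L₂.IsProper q) (c δ : ℂ) (S T : ℤ)
    (hS₁ : L₁.s + L₁'.s = S) (hT₁ : L₁.t + L₁'.t = T) (hS₂ : L₂.s + L₂'.s = S)
    (hT₂ : L₂.t + L₂'.t = T) (hδ : δ = 0 ∨ S = 1 ∧ T = 1)
    (htop : ∀ Z X Y : ℂ, Z ≠ 0 → X ≠ 0 → Y ≠ 0 →
      Ladder.top q L₁' L₁ Z X Y + c * Ladder.top q L₂' L₂ Z X Y = 0)
    (hbot : ∀ Z X Y : ℂ, Z ≠ 0 → X ≠ 0 → Y ≠ 0 →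
      Ladder.bot q L₁' L₁ Z X Y + c * Ladder.bot q L₂' L₂ Z X Y = 0)
    (hmid : ∀ Z X Y : ℂ, Z ≠ 0 → X ≠ 0 → Y ≠ 0 → 1 - Z ^ 2 ≠ 0 → 1 - (Z * q) ^ 2 ≠ 0 →
      1 - (Z * q * q) ^ 2 ≠ 0 → Ladder.mid q L₁' L₁ Z X Y + c * Ladder.mid q L₂' L₂ Z X Y = δ)
    (hmid_one : 1 - q ^ 2 ≠ 0 → 1 - (q * q) ^ 2 ≠ 0 →
      Ladder.mid q L₁' L₁ 1 1 1 + c * Ladder.mid q L₂' L₂ 1 1 1 = δ) :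
    L₁'.op q * L₁.op q + c • (L₂'.op q * L₂.op q) = δ • (1 : Module.End ℂ (Idx →₀ ℂ)) := by
  refine linearMap_ext_basisVec fun N I J hv => ?_
  rw [LinearMap.add_apply, LinearMap.smul_apply, Module.End.mul_apply, Module.End.mul_apply,
    LinearMap.smul_apply, Module.End.one_apply,
    Ladder.op_op_basisVec hq h₁ S T hS₁ hT₁ hv, Ladder.op_op_basisVec hq h₂ S T hS₂ hT₂ hv]
  have ht := htop _ _ _ (zpow_ne_zero N hq) (zpow_ne_zero I hq) (zpow_ne_zero J hq)
  have hb := hbot _ _ _ (zpow_ne_zero N hq) (zpow_ne_zero I hq) (zpow_ne_zero J hq)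
  have hm : Ladder.mid q L₁' L₁ (q ^ N) (q ^ I) (q ^ J) +
      c * Ladder.mid q L₂' L₂ (q ^ N) (q ^ I) (q ^ J) = δ := by
    obtain ⟨x, rfl, rfl, rfl⟩ := hv.exists_idx
    have hI := x.hI
    have hJ := x.hJ
    -- At N = 0 the denominator 1 - Z² that arises after a lowering step vanishes, so the generic
    -- rational identity is not available and the coefficients are checked separately.
    rcases Nat.eq_zero_or_pos x.N with hN | hN
    · rw [hN, show x.I = 0 by omega, show x.J = 0 by omega]
      have e1 := hq1 0
      have e2 := hq1 1
      rw [zero_add, pow_one] at e1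
      rw [show q ^ (1 + 1) = q * q by ring] at e2
      simpa using hmid_one e1 e2
    · obtain ⟨n, hn⟩ := Nat.exists_eq_succ_of_ne_zero hN.ne'
      have e1 := hq1 n
      have e2 := hq1 (n + 1)
      have e3 := hq1 (n + 2)
      refine hmid _ _ _ (zpow_ne_zero _ hq) (zpow_ne_zero _ hq) (zpow_ne_zero _ hq) ?_ ?_ ?_ <;>
        rw [zpow_natCast, hn] <;> assumption
  -- A nonzero scalar on the right requires total shift (1, 1), for which the middle term returns to
  -- the original label.
  have hs : δ • basisVec N (I + S - 1) (J + T - 1) = δ • basisVec N I J := by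
    rcases hδ with rfl | ⟨rfl, rfl⟩
    · rw [zero_smul, zero_smul]
    · rw [add_sub_cancel_right, add_sub_cancel_right]
  rw [← hs]
  trans (Ladder.top q L₁' L₁ (q ^ N) (q ^ I) (q ^ J) +
      c * Ladder.top q L₂' L₂ (q ^ N) (q ^ I) (q ^ J)) • basisVec (N + 2) (I + S) (J + T) +
    (Ladder.mid q L₁' L₁ (q ^ N) (q ^ I) (q ^ J) +
      c * Ladder.mid q L₂' L₂ (q ^ N) (q ^ I) (q ^ J)) • basisVec N (I + S - 1) (J + T - 1) +
    (Ladder.bot q L₁' L₁ (q ^ N) (q ^ I) (q ^ J) +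
      c * Ladder.bot q L₂' L₂ (q ^ N) (q ^ I) (q ^ J)) • basisVec (N - 2) (I + S - 2) (J + T - 2)
  · module
  · rw [ht, hm, hb, zero_smul, zero_smul, zero_add, add_zero]

theorem top_leftLadder_rightLadder {q : ℂ} (hq : q ≠ 0) (g g' : Gen) (Z X Y : ℂ) :
    Ladder.top q (leftLadder q g) (rightLadder q g') Z X Y =
      Ladder.top q (rightLadder q g') (leftLadder q g) Z X Y := by
  cases g <;> cases g' <;>
    simp only [Ladder.top, leftLadder, rightLadder, sub_zero, sub_self, zpow_zero, zpow_one,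
      mul_one] <;>
    first | (ring; done) | field_simp

set_option maxHeartbeats 1000000 in
theorem bot_leftLadder_rightLadder {q : ℂ} (hq : q ≠ 0) (g g' : Gen) {Z X Y : ℂ} (hZ : Z ≠ 0)
    (hX : X ≠ 0) (hY : Y ≠ 0) :
    Ladder.bot q (leftLadder q g) (rightLadder q g') Z X Y =
      Ladder.bot q (rightLadder q g') (leftLadder q g) Z X Y := by
  cases g <;> cases g' <;>
    simp only [Ladder.bot, leftLadder, rightLadder, sub_zero, sub_self, zpow_zero,
      zero_sub, zpow_neg_one, mul_one, div_mul_cancel₀ _ hq] <;>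
    first | (ring; done) | field_simp

set_option maxHeartbeats 1000000 in
theorem mid_leftLadder_rightLadder {q : ℂ} (hq : q ≠ 0) (g g' : Gen) {Z X Y : ℂ} (hZ : Z ≠ 0)
    (hX : X ≠ 0) (hY : Y ≠ 0) (h1 : 1 - Z ^ 2 ≠ 0) (h2 : 1 - (Z * q) ^ 2 ≠ 0)
    (h3 : 1 - (Z * q * q) ^ 2 ≠ 0) :
    Ladder.mid q (leftLadder q g) (rightLadder q g') Z X Y =
      Ladder.mid q (rightLadder q g') (leftLadder q g) Z X Y := by
  cases g <;> cases g' <;>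
    simp only [Ladder.mid, leftLadder, rightLadder, sub_zero, sub_self, zpow_zero, zpow_one,
      zero_sub, zpow_neg_one, mul_one, div_mul_cancel₀ _ hq] <;>
    -- The three denominators are treated as independent symbols while fractions are cleared.
    generalize hA : 1 - Z ^ 2 = A at * <;>
    generalize hB : 1 - (Z * q) ^ 2 = B at * <;>
    generalize hC : 1 - (Z * q * q) ^ 2 = C at * <;>
    field_simp <;> simp only [← hA, ← hC] <;> ring

theorem mid_leftLadder_rightLadder_one {q : ℂ} (hq : q ≠ 0) (g g' : Gen) :
    Ladder.mid q (leftLadder q g) (rightLadder q g') 1 1 1 =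
      Ladder.mid q (rightLadder q g') (leftLadder q g) 1 1 1 := by
  cases g <;> cases g' <;>
    simp only [Ladder.mid, leftLadder, rightLadder, sub_zero, sub_self, zpow_zero, zpow_one,
      mul_one, one_mul, div_one, one_pow, mul_zero, zero_mul, zero_div, add_zero, div_self hq]

/-- The two families behave like left and right multiplications; their commutation makes the vacuum
vector separating. -/
theorem leftLadder_comm_rightLadder {q : ℂ} (hq : q ≠ 0)
    (hq1 : ∀ n : ℕ, 1 - (q ^ (n + 1)) ^ 2 ≠ 0) (g g' : Gen) :
    Commute ((leftLadder q g).op q) ((rightLadder q g').op q) := by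
  have := Ladder.op_relation hq hq1 (L₁' := leftLadder q g) (L₁ := rightLadder q g')
    (L₂' := rightLadder q g') (L₂ := leftLadder q g) (isProper_rightLadder hq g')
    (isProper_leftLadder hq g) (-1) 0 _ _ rfl rfl (add_comm _ _) (add_comm _ _) (Or.inl rfl)
    (fun Z X Y _ _ _ => by rw [top_leftLadder_rightLadder hq]; ring)
    (fun Z X Y hZ hX hY => by rw [bot_leftLadder_rightLadder hq g g' hZ hX hY]; ring)
    (fun Z X Y hZ hX hY h1 h2 h3 => by
      rw [mid_leftLadder_rightLadder hq g g' hZ hX hY h1 h2 h3]; ring)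
    (fun _ _ => by rw [mid_leftLadder_rightLadder_one hq g g']; ring)
  rw [zero_smul] at this
  exact sub_eq_zero.1 (Eq.trans (by module) this)

/-- The operators of the generators in the algebraic model. -/
noncomputable def genOp (q : ℂ) (g : Gen) : Module.End ℂ (Idx →₀ ℂ) := (leftLadder q g).op q

theorem genOp_relation₁ {q : ℂ} (hq : q ≠ 0) (hq1 : ∀ n : ℕ, 1 - (q ^ (n + 1)) ^ 2 ≠ 0) :
    genOp q .aStar * genOp q .a + (1 : ℂ) • (genOp q .bStar * genOp q .b) =
      (1 : ℂ) • (1 : Module.End ℂ (Idx →₀ ℂ)) := by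
  refine Ladder.op_relation hq hq1 (isProper_leftLadder hq _) (isProper_leftLadder hq _) (1 : ℂ) (1 : ℂ)
    1 1 (by simp [leftLadder]) (by simp [leftLadder]) (by simp [leftLadder])
    (by simp [leftLadder]) (by simp) ?_ ?_ ?_ ?_
  · intro Z X Y hZ hX hY
    simp only [Ladder.top, leftLadder, zpow_zero, zpow_one, mul_one]
    ring
  · intro Z X Y hZ hX hY
    simp only [Ladder.bot, leftLadder, sub_self, zpow_zero, zero_sub, zpow_neg_one, mul_one,
      div_mul_cancel₀ _ hq]
    field_simp
    ring
  · intro Z X Y hZ hX hY h1 h2 h3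
    simp only [Ladder.mid, leftLadder, sub_self, zpow_zero, zpow_one, zero_sub, zpow_neg_one,
      mul_one, div_mul_cancel₀ _ hq]
    generalize hA : 1 - Z ^ 2 = A at *
    generalize hB : 1 - (Z * q) ^ 2 = B at *
    generalize hC : 1 - (Z * q * q) ^ 2 = C at *
    field_simp
    simp only [← hA, ← hB, ← hC]
    ring
  · intro h1 h2
    simp only [Ladder.mid, leftLadder, sub_self, zpow_zero, zpow_one, mul_one, one_mul, div_one,
      one_pow, mul_zero, zero_mul, zero_div, add_zero]
    generalize hB : 1 - q ^ 2 = B at *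
    generalize hC : 1 - (q * q) ^ 2 = C at *
    field_simp
    simp only [← hB, ← hC]
    ring

theorem genOp_relation₂ {q : ℂ} (hq : q ≠ 0) (hq1 : ∀ n : ℕ, 1 - (q ^ (n + 1)) ^ 2 ≠ 0) :
    genOp q .a * genOp q .aStar + (q ^ 2) • (genOp q .b * genOp q .bStar) =
      (1 : ℂ) • (1 : Module.End ℂ (Idx →₀ ℂ)) := by
  refine Ladder.op_relation hq hq1 (isProper_leftLadder hq _) (isProper_leftLadder hq _) (q ^ 2) (1 : ℂ)
    1 1 (by simp [leftLadder]) (by simp [leftLadder]) (by simp [leftLadder])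
    (by simp [leftLadder]) (by simp) ?_ ?_ ?_ ?_
  · intro Z X Y hZ hX hY
    simp only [Ladder.top, leftLadder, zpow_zero, zpow_one, mul_one]
    ring
  · intro Z X Y hZ hX hY
    simp only [Ladder.bot, leftLadder, sub_self, zpow_zero, zero_sub, zpow_neg_one, mul_one,
      div_mul_cancel₀ _ hq]
    field_simp
    ring
  · intro Z X Y hZ hX hY h1 h2 h3
    simp only [Ladder.mid, leftLadder, sub_self, zpow_zero, zpow_one, zero_sub, zpow_neg_one,
      mul_one, div_mul_cancel₀ _ hq]
    generalize hA : 1 - Z ^ 2 = A at *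
    generalize hB : 1 - (Z * q) ^ 2 = B at *
    generalize hC : 1 - (Z * q * q) ^ 2 = C at *
    field_simp
    simp only [← hA, ← hB, ← hC]
    ring
  · intro h1 h2
    simp only [Ladder.mid, leftLadder, sub_self, zpow_zero, zpow_one, mul_one, one_mul, div_one,
      one_pow, mul_zero, zero_mul, zero_div, add_zero]
    generalize hB : 1 - q ^ 2 = B at *
    generalize hC : 1 - (q * q) ^ 2 = C at *
    field_simp
    simp only [← hB, ← hC]
    ring

theorem genOp_relation₃ {q : ℂ} (hq : q ≠ 0) (hq1 : ∀ n : ℕ, 1 - (q ^ (n + 1)) ^ 2 ≠ 0) :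
    genOp q .a * genOp q .b + (-q) • (genOp q .b * genOp q .a) =
      (0 : ℂ) • (1 : Module.End ℂ (Idx →₀ ℂ)) := by
  refine Ladder.op_relation hq hq1 (isProper_leftLadder hq _) (isProper_leftLadder hq _) (-q) (0 : ℂ)
    1 0 (by simp [leftLadder]) (by simp [leftLadder]) (by simp [leftLadder])
    (by simp [leftLadder]) (by simp) ?_ ?_ ?_ ?_
  · intro Z X Y hZ hX hY
    simp only [Ladder.top, leftLadder, zpow_zero, zpow_one, mul_one]
    ring
  · intro Z X Y hZ hX hY
    simp only [Ladder.bot, leftLadder, sub_self, zpow_zero, zero_sub, zpow_neg_one, mul_one,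
      div_mul_cancel₀ _ hq]
    field_simp
    ring
  · intro Z X Y hZ hX hY h1 h2 h3
    simp only [Ladder.mid, leftLadder, sub_self, zpow_zero, zpow_one, zero_sub, zpow_neg_one,
      mul_one, div_mul_cancel₀ _ hq]
    generalize hA : 1 - Z ^ 2 = A at *
    generalize hB : 1 - (Z * q) ^ 2 = B at *
    generalize hC : 1 - (Z * q * q) ^ 2 = C at *
    field_simp
    simp only [← hA, ← hB, ← hC]
    ring
  · intro _ _
    simp only [Ladder.mid, leftLadder, sub_self, zpow_zero, zpow_one, mul_one, one_mul, div_one,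
      one_pow, mul_zero, zero_mul, zero_div, add_zero]

theorem genOp_relation₄ {q : ℂ} (hq : q ≠ 0) (hq1 : ∀ n : ℕ, 1 - (q ^ (n + 1)) ^ 2 ≠ 0) :
    genOp q .a * genOp q .bStar + (-q) • (genOp q .bStar * genOp q .a) =
      (0 : ℂ) • (1 : Module.End ℂ (Idx →₀ ℂ)) := by
  refine Ladder.op_relation hq hq1 (isProper_leftLadder hq _) (isProper_leftLadder hq _) (-q) (0 : ℂ)
    0 1 (by simp [leftLadder]) (by simp [leftLadder]) (by simp [leftLadder])
    (by simp [leftLadder]) (by simp) ?_ ?_ ?_ ?_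
  · intro Z X Y hZ hX hY
    simp only [Ladder.top, leftLadder, zpow_zero, zpow_one, mul_one]
    ring
  · intro Z X Y hZ hX hY
    simp only [Ladder.bot, leftLadder, sub_self, zpow_zero, zero_sub, zpow_neg_one, mul_one,
      div_mul_cancel₀ _ hq]
    field_simp
    ring
  · intro Z X Y hZ hX hY h1 h2 h3
    simp only [Ladder.mid, leftLadder, sub_self, zpow_zero, zpow_one, zero_sub, zpow_neg_one,
      mul_one, div_mul_cancel₀ _ hq]
    generalize hA : 1 - Z ^ 2 = A at *
    generalize hB : 1 - (Z * q) ^ 2 = B at *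
    generalize hC : 1 - (Z * q * q) ^ 2 = C at *
    field_simp
    simp only [← hA, ← hB, ← hC]
    ring
  · intro _ _
    simp only [Ladder.mid, leftLadder, sub_self, zpow_zero, zpow_one, mul_one, one_mul, div_one,
      one_pow, mul_zero, zero_mul, zero_div, add_zero]

theorem genOp_relation₅ {q : ℂ} (hq : q ≠ 0) (hq1 : ∀ n : ℕ, 1 - (q ^ (n + 1)) ^ 2 ≠ 0) :
    genOp q .bStar * genOp q .b + (-1 : ℂ) • (genOp q .b * genOp q .bStar) =
      (0 : ℂ) • (1 : Module.End ℂ (Idx →₀ ℂ)) := by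
  refine Ladder.op_relation hq hq1 (isProper_leftLadder hq _) (isProper_leftLadder hq _) (-1 : ℂ) (0 : ℂ)
    1 1 (by simp [leftLadder]) (by simp [leftLadder]) (by simp [leftLadder])
    (by simp [leftLadder]) (by simp) ?_ ?_ ?_ ?_
  · intro Z X Y hZ hX hY
    simp only [Ladder.top, leftLadder, zpow_zero, zpow_one, mul_one]
    ring
  · intro Z X Y hZ hX hY
    simp only [Ladder.bot, leftLadder, sub_self, zpow_zero, zero_sub, zpow_neg_one, mul_one,
      div_mul_cancel₀ _ hq]
    field_simp
    ring
  · intro Z X Y hZ hX hY h1 h2 h3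
    simp only [Ladder.mid, leftLadder, sub_self, zpow_zero, zpow_one, zero_sub, zpow_neg_one,
      mul_one, div_mul_cancel₀ _ hq]
    generalize hA : 1 - Z ^ 2 = A at *
    generalize hB : 1 - (Z * q) ^ 2 = B at *
    generalize hC : 1 - (Z * q * q) ^ 2 = C at *
    field_simp
    simp only [← hA, ← hB, ← hC]
    ring
  · intro h1 h2
    simp only [Ladder.mid, leftLadder, sub_self, zpow_zero, zpow_one, mul_one, one_mul, div_one,
      one_pow, mul_zero, zero_mul, zero_div, add_zero]
    generalize hB : 1 - q ^ 2 = B at *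
    generalize hC : 1 - (q * q) ^ 2 = C at *
    field_simp
    simp only [← hB, ← hC]
    ring

/-! ### The algebraic model inside `L₂(h)` -/

/-- `1 - q^{2n}`. -/
def qInt (q : ℝ) (n : ℕ) : ℝ := 1 - q ^ (2 * n)

/-- The `q`-factorial `∏_{i < n} (1 - q^{2i+2})`. -/
noncomputable def qFac (q : ℝ) (n : ℕ) : ℝ := ∏ i ∈ Finset.range n, qInt q (i + 1)

theorem qInt_pos {q : ℝ} (h0 : 0 < q) (h1 : q < 1) (n : ℕ) : 0 < qInt q (n + 1) :=
  sub_pos.2 (pow_lt_one₀ h0.le h1 (by omega))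

theorem qFac_pos {q : ℝ} (h0 : 0 < q) (h1 : q < 1) (n : ℕ) : 0 < qFac q n :=
  Finset.prod_pos fun i _ => qInt_pos h0 h1 i

theorem qFac_succ (q : ℝ) (n : ℕ) : qFac q (n + 1) = qFac q n * qInt q (n + 1) :=
  Finset.prod_range_succ _ n

/-- The norm of the basis vector with label `x` of the algebraic model. -/
noncomputable def modelNorm (q : ℝ) (x : Idx) : ℝ :=
  Real.sqrt (qInt q 1 * (qFac q x.I * qFac q (x.N - x.I)) * (qFac q x.J * qFac q (x.N - x.J)) /
    qInt q (x.N + 1))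

/-- The number `p` with `[I]! [N-I]!` multiplied by `1 - q^{2p}` under `up s t`. -/
def newIndex (s : Fin 2) (N I : ℕ) : ℕ := if s = 0 then N - I + 1 else I + 1

/-- The quotient of the squares of `modelNorm` at `up s t x` and `x`. -/
noncomputable def normRatio (q : ℝ) (s t : Fin 2) (x : Idx) : ℝ :=
  qInt q (newIndex s x.N x.I) * qInt q (newIndex t x.N x.J) * (qInt q (x.N + 1) / qInt q (x.N + 2))

theorem qFac_mul_qFac_up (q : ℝ) (s : Fin 2) {N I : ℕ} (h : I ≤ N) :
    qFac q (I + s) * qFac q (N + 1 - (I + s)) =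
      qInt q (newIndex s N I) * (qFac q I * qFac q (N - I)) := by
  fin_cases s
  · simp only [newIndex, Fin.zero_eta, add_zero, if_true]
    rw [show N + 1 - I = N - I + 1 by omega, qFac_succ]
    ring
  · simp only [newIndex, Fin.mk_one, one_ne_zero, if_false]
    rw [show N + 1 - (I + 1) = N - I by omega, qFac_succ]
    ring

theorem modelNorm_pos {q : ℝ} (h0 : 0 < q) (h1 : q < 1) (x : Idx) : 0 < modelNorm q x := by
  have hi := qInt_pos h0 h1
  have hf := qFac_pos h0 h1
  exact Real.sqrt_pos.2 (div_pos (mul_pos (mul_pos (hi 0) (mul_pos (hf _) (hf _)))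
    (mul_pos (hf _) (hf _))) (hi _))

theorem newIndex_pos (s : Fin 2) (N I : ℕ) : ∃ n, newIndex s N I = n + 1 := by
  rw [newIndex]
  split_ifs <;> exact ⟨_, rfl⟩

theorem normRatio_pos {q : ℝ} (h0 : 0 < q) (h1 : q < 1) (s t : Fin 2) (x : Idx) :
    0 < normRatio q s t x := by
  have hi := qInt_pos h0 h1
  obtain ⟨n, hn⟩ := newIndex_pos s x.N x.I
  obtain ⟨m, hm⟩ := newIndex_pos t x.N x.J
  rw [normRatio, hn, hm]
  exact mul_pos (mul_pos (hi _) (hi _)) (div_pos (hi _) (hi _))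

/-- The square roots in a_± and b_± are the square roots of `normRatio` up to factors rational in
q^N, q^I, q^J; the rescaled basis absorbs them. -/
theorem modelNorm_up {q : ℝ} (h0 : 0 < q) (h1 : q < 1) (s t : Fin 2) (x : Idx) :
    modelNorm q (up s t x) = modelNorm q x * Real.sqrt (normRatio q s t x) := by
  have hi := fun n => (qInt_pos h0 h1 n).ne'
  have hr := (normRatio_pos h0 h1 s t x).le
  rw [modelNorm, modelNorm, ← Real.sqrt_mul' _ hr]
  congr 1
  simp only [up]
  rw [qFac_mul_qFac_up q s x.hI, qFac_mul_qFac_up q t x.hJ, normRatio]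
  have e1 := hi x.N
  have e2 := hi (x.N + 1)
  field_simp

/-- The embedding of the algebraic model, mapping the basis vector with label `x` to a multiple
of `e x`. -/
noncomputable def modelEmb (q : ℝ) : (Idx →₀ ℂ) →ₗ[ℂ] L2h :=
  Finsupp.linearCombination ℂ fun x => (modelNorm q x : ℂ) • e x

theorem modelEmb_single (q : ℝ) (x : Idx) :
    modelEmb q (Finsupp.single x 1) = (modelNorm q x : ℂ) • e x := by
  rw [modelEmb, Finsupp.linearCombination_single, one_smul]

theorem e_eq_modelEmb {q : ℝ} (h0 : 0 < q) (h1 : q < 1) (x : Idx) :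
    e x = modelEmb q ((modelNorm q x : ℂ)⁻¹ • Finsupp.single x 1) := by
  rw [map_smul, modelEmb_single, inv_smul_smul₀]
  exact_mod_cast (modelNorm_pos h0 h1 x).ne'

theorem mem_range_up_iff (s t : Fin 2) (x : Idx) : x ∈ Set.range (up s t) ↔
    ValidIdx (x.N - 1) (x.I - (s : ℕ)) (x.J - (t : ℕ)) := by
  constructor
  · rintro ⟨y, rfl⟩
    have := y.hI
    have := y.hJ
    simp only [up]
    push_cast
    exact ⟨by omega, by omega, by omega, by omega⟩
  · rintro ⟨h1, h2, h3, h4⟩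
    refine ⟨⟨x.N - 1, x.I - s, x.J - t, by omega, by omega⟩, ?_⟩
    ext <;> simp only [up] <;> omega

/-- Weighted shifts restrict to ladder operators on the algebraic model. -/
theorem modelEmb_ladder {q : ℝ} (L : Ladder) (s t s' t' : Fin 2) (hs : L.s = (s : ℕ))
    (ht : L.t = (t : ℕ)) (hs' : (s' : ℕ) + s = 1) (ht' : (t' : ℕ) + t = 1)
    {w w' : Idx → ℝ} (hw : ∃ C, ∀ x, |w x| ≤ C) (hw' : ∃ C, ∀ x, |w' x| ≤ C)
    (hu : ∀ x : Idx, (modelNorm q x * w x : ℂ) =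
      L.u ((q : ℂ) ^ (x.N : ℤ)) ((q : ℂ) ^ (x.I : ℤ)) ((q : ℂ) ^ (x.J : ℤ)) *
        modelNorm q (up s t x))
    (hd : ∀ x : Idx, (modelNorm q (up s' t' x) * w' x : ℂ) =
      L.d ((q : ℂ) ^ ((x.N + 1 : ℕ) : ℤ)) ((q : ℂ) ^ ((x.I + s' : ℕ) : ℤ))
        ((q : ℂ) ^ ((x.J + t' : ℕ) : ℤ)) * modelNorm q x) (v : Idx →₀ ℂ) :
    (shift s t * diagOp w + diagOp w' * star (shift s' t')) (modelEmb q v) =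
      modelEmb q (L.op q v) := by
  suffices h : ((shift s t * diagOp w + diagOp w' * star (shift s' t') : L2h →L[ℂ] L2h) :
      L2h →ₗ[ℂ] L2h) ∘ₗ modelEmb q = modelEmb q ∘ₗ L.op q from LinearMap.congr_fun h v
  refine Finsupp.lhom_ext' fun x => LinearMap.ext_ring ?_
  change (shift s t * diagOp w + diagOp w' * star (shift s' t') : L2h →L[ℂ] L2h)
    (modelEmb q (Finsupp.single x 1)) = modelEmb q (L.op q (Finsupp.single x 1))
  have e1 : (shift s t * diagOp w : L2h →L[ℂ] L2h) (e x) = (w x : ℂ) • e (up s t x) := by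
    rw [mul_apply_eq_comp, diagOp_e hw, map_smul, shift_e]
  have e2 : basisVec (x.N + 1) (x.I + L.s) (x.J + L.t) = Finsupp.single (up s t x) 1 :=
    basisVec_eq (by simp [up]) (by simp [up, hs]) (by simp [up, ht])
  rw [modelEmb_single, map_smul, _root_.add_apply, e1, Ladder.op, onBasis_single, one_smul,
    map_add, map_smul, map_smul, e2, modelEmb_single, smul_add, smul_smul, smul_smul, hu]
  congr 1
  by_cases hx : x ∈ Set.range (up s' t')
  · obtain ⟨y, rfl⟩ := hx
    have e3 : basisVec ((up s' t' y).N - 1) ((up s' t' y).I + L.s - 1)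
        ((up s' t' y).J + L.t - 1) = Finsupp.single y 1 :=
      basisVec_eq (by simp [up]) (by simp only [up, hs]; omega) (by simp only [up, ht]; omega)
    rw [mul_apply_eq_comp, ContinuousLinearMap.star_eq_adjoint, adjoint_shift_e_up, diagOp_e hw',
      e3, modelEmb_single, smul_smul, smul_smul, hd]
    rfl
  · have e3 : basisVec (x.N - 1) (x.I + L.s - 1) (x.J + L.t - 1) = 0 := by
      refine basisVec_of_not_valid fun h => hx ((mem_range_up_iff s' t' x).2 ?_)
      obtain ⟨k1, k2, k3, k4⟩ := h
      exact ⟨by omega, by omega, by omega, by omega⟩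
    rw [mul_apply_eq_comp, ContinuousLinearMap.star_eq_adjoint, adjoint_shift_e_of_notMem _ _ _ hx,
      e3, map_zero, map_zero, smul_zero, smul_zero]

/-- The weight of the upward part of a generator in the algebraic model. -/
noncomputable def upWeight (q : ℝ) (x : Idx) : Gen → ℝ
  | .a => q ^ (x.I + x.J + 1) / qInt q (x.N + 1)
  | .aStar => 1 / qInt q (x.N + 1)
  | .b => -q ^ x.J / qInt q (x.N + 1)
  | .bStar => q ^ x.I / qInt q (x.N + 1)

theorem sqrt_eq_mul_sqrt {c r w : ℝ} (hc : 0 ≤ c) (h : w = c ^ 2 * r) :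
    Real.sqrt w = c * Real.sqrt r := by
  rw [h, Real.sqrt_mul (sq_nonneg c), Real.sqrt_sq hc]

section

variable {q : ℝ} (h0 : 0 < q) (h1 : q < 1) (x : Idx)
include h0 h1

theorem aPlus_eq : aPlus q x = upWeight q x .a * Real.sqrt (normRatio q 0 0 x) := by
  have e1 := (qInt_pos h0 h1 x.N).ne'
  have e2 := (qInt_pos h0 h1 (x.N + 1)).ne'
  refine sqrt_eq_mul_sqrt (div_nonneg (pow_nonneg h0.le _) (qInt_pos h0 h1 _).le) ?_
  simp only [upWeight, normRatio, newIndex, if_true]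
  rw [show (1 - q ^ (2 * (x.N - x.J) + 2)) = qInt q (x.N - x.J + 1) from rfl,
    show (1 - q ^ (2 * (x.N - x.I) + 2)) = qInt q (x.N - x.I + 1) from rfl,
    show (1 - q ^ (2 * x.N + 2)) = qInt q (x.N + 1) from rfl,
    show (1 - q ^ (2 * x.N + 4)) = qInt q (x.N + 2) from rfl,
    show q ^ (2 * x.I + 2 * x.J + 2) = (q ^ (x.I + x.J + 1)) ^ 2 by ring]
  field_simp

theorem aMinus_up_eq : aMinus q (up 1 1 x) =
    upWeight q x .aStar * Real.sqrt (normRatio q 1 1 x) := by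
  have e1 := (qInt_pos h0 h1 x.N).ne'
  have e2 := (qInt_pos h0 h1 (x.N + 1)).ne'
  refine sqrt_eq_mul_sqrt (div_nonneg zero_le_one (qInt_pos h0 h1 _).le) ?_
  simp only [upWeight, normRatio, newIndex, one_ne_zero, if_false, up, Fin.val_one]
  rw [show (1 - q ^ (2 * (x.J + 1))) = qInt q (x.J + 1) from rfl,
    show (1 - q ^ (2 * (x.I + 1))) = qInt q (x.I + 1) from rfl,
    show (1 - q ^ (2 * (x.N + 1))) = qInt q (x.N + 1) from rfl,
    show (1 - q ^ (2 * (x.N + 1) + 2)) = qInt q (x.N + 2) from rfl]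
  field_simp

theorem bPlus_eq : bPlus q x = upWeight q x .b * Real.sqrt (normRatio q 1 0 x) := by
  have e1 := (qInt_pos h0 h1 x.N).ne'
  have e2 := (qInt_pos h0 h1 (x.N + 1)).ne'
  rw [bPlus, upWeight, neg_div, neg_mul, neg_inj]
  refine sqrt_eq_mul_sqrt (div_nonneg (pow_nonneg h0.le _) (qInt_pos h0 h1 _).le) ?_
  simp only [normRatio, newIndex, if_true, one_ne_zero, if_false]
  rw [show (1 - q ^ (2 * (x.N - x.J) + 2)) = qInt q (x.N - x.J + 1) from rfl,
    show (1 - q ^ (2 * x.I + 2)) = qInt q (x.I + 1) from rfl,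
    show (1 - q ^ (2 * x.N + 2)) = qInt q (x.N + 1) from rfl,
    show (1 - q ^ (2 * x.N + 4)) = qInt q (x.N + 2) from rfl,
    show q ^ (2 * x.J) = (q ^ x.J) ^ 2 by ring]
  field_simp

theorem bMinus_up_eq : bMinus q (up 0 1 x) =
    upWeight q x .bStar * Real.sqrt (normRatio q 0 1 x) := by
  have e1 := (qInt_pos h0 h1 x.N).ne'
  have e2 := (qInt_pos h0 h1 (x.N + 1)).ne'
  have hI := x.hI
  refine sqrt_eq_mul_sqrt (div_nonneg (pow_nonneg h0.le _) (qInt_pos h0 h1 _).le) ?_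
  simp only [upWeight, normRatio, newIndex, one_ne_zero, if_false, if_true, up, Fin.val_one,
    Fin.val_zero, add_zero]
  rw [show x.N + 1 - x.I = x.N - x.I + 1 by omega,
    show (1 - q ^ (2 * (x.J + 1))) = qInt q (x.J + 1) from rfl,
    show (1 - q ^ (2 * (x.N - x.I + 1))) = qInt q (x.N - x.I + 1) from rfl,
    show (1 - q ^ (2 * (x.N + 1))) = qInt q (x.N + 1) from rfl,
    show (1 - q ^ (2 * (x.N + 1) + 2)) = qInt q (x.N + 2) from rfl,
    show q ^ (2 * x.I) = (q ^ x.I) ^ 2 by ring]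
  field_simp

end

/-- For the raising part √normRatio cancels against the change of norm. For the lowering part it
occurs twice, leaving the rational factor `normRatio`. -/
theorem modelEmb_leftLadder {q : ℝ} (h0 : 0 < q) (h1 : q < 1) (g g' : Gen) (s t s' t' : Fin 2)
    (hs : (leftLadder q g).s = (s : ℕ)) (ht : (leftLadder q g).t = (t : ℕ))
    (hs' : (s' : ℕ) + s = 1) (ht' : (t' : ℕ) + t = 1) {w w' : Idx → ℝ} (hw : ∃ C, ∀ x, |w x| ≤ C)
    (hw' : ∃ C, ∀ x, |w' x| ≤ C)
    (e : ∀ x, w x = upWeight q x g * Real.sqrt (normRatio q s t x))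
    (e' : ∀ x, w' x = upWeight q x g' * Real.sqrt (normRatio q s' t' x))
    (hu : ∀ x : Idx, (upWeight q x g : ℂ) =
      (leftLadder q g).u ((q : ℂ) ^ (x.N : ℤ)) ((q : ℂ) ^ (x.I : ℤ)) ((q : ℂ) ^ (x.J : ℤ)))
    (hd : ∀ x : Idx, (upWeight q x g' * normRatio q s' t' x : ℂ) =
      (leftLadder q g).d ((q : ℂ) ^ ((x.N + 1 : ℕ) : ℤ)) ((q : ℂ) ^ ((x.I + s' : ℕ) : ℤ))
        ((q : ℂ) ^ ((x.J + t' : ℕ) : ℤ))) (v : Idx →₀ ℂ) :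
    (shift s t * diagOp w + diagOp w' * star (shift s' t')) (modelEmb q v) =
      modelEmb q (genOp q g v) := by
  refine modelEmb_ladder (leftLadder q g) s t s' t' hs ht hs' ht' hw hw' (fun x => ?_)
    (fun x => ?_) v
  · rw [e, ← hu, modelNorm_up h0 h1]
    push_cast
    ring
  · have hr : ((Real.sqrt (normRatio q s' t' x) : ℝ) : ℂ) * (Real.sqrt (normRatio q s' t' x) : ℝ)
        = (normRatio q s' t' x : ℝ) := by
      rw [← Complex.ofReal_mul, Real.mul_self_sqrt (normRatio_pos h0 h1 s' t' x).le]
    rw [← hd, e', modelNorm_up h0 h1, ← hr]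
    push_cast
    ring

/-- The action of the noncommutative polynomials on the algebraic model. -/
noncomputable def modelRep (q : ℂ) : Poly →ₐ[ℂ] Module.End ℂ (Idx →₀ ℂ) :=
  FreeAlgebra.lift ℂ (genOp q)

theorem pow_succ_div_pow {q : ℂ} (hq : q ≠ 0) {N I : ℕ} (h : I ≤ N) :
    q ^ (N + 1) / q ^ I = q ^ (N - I + 1) := by
  rw [div_eq_iff (pow_ne_zero _ hq), ← pow_add]
  congr 1
  omega

theorem ofReal_qInt (q : ℝ) (n : ℕ) : ((qInt q n : ℝ) : ℂ) = 1 - ((q : ℂ) ^ n) ^ 2 := by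
  rw [qInt, ← pow_mul, mul_comm n]
  push_cast
  rfl

section

variable {q : ℝ} (h0 : 0 < q) (h1 : q < 1)
include h0 h1

theorem alpha_modelEmb (v : Idx →₀ ℂ) :
    alpha q (modelEmb q v) = modelEmb q (genOp q .a v) := by
  have hc := coefficients_bounded h0 h1
  have hq : (q : ℂ) ≠ 0 := by exact_mod_cast h0.ne'
  have eα : alpha q = shift 0 0 * diagOp (aPlus q) +
      diagOp (fun x => aMinus q (up 1 1 x)) * star (shift 1 1) := by
    rw [← star_shift_mul_diagOp 1 1 ⟨1, fun x => (hc x).2.1⟩]; rfl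
  rw [eα]
  refine modelEmb_leftLadder h0 h1 .a .aStar 0 0 1 1 rfl rfl rfl rfl ⟨1, fun x => (hc x).1⟩
    ⟨1, fun x => (hc _).2.1⟩ (aPlus_eq h0 h1) (aMinus_up_eq h0 h1) (fun x => ?_) (fun x => ?_) v
  · simp only [upWeight, leftLadder, zpow_natCast]
    push_cast
    rw [ofReal_qInt]
    ring
  · have e1 := (qInt_pos h0 h1 x.N).ne'
    simp only [upWeight, leftLadder, zpow_natCast, normRatio, newIndex, one_ne_zero, if_false,
      Fin.val_one]
    rw [← pow_succ, ← ofReal_qInt, ← ofReal_qInt, ← ofReal_qInt]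
    norm_cast
    field_simp

theorem star_alpha_modelEmb (v : Idx →₀ ℂ) :
    star (alpha q) (modelEmb q v) = modelEmb q (genOp q .aStar v) := by
  have hc := coefficients_bounded h0 h1
  have hq : (q : ℂ) ≠ 0 := by exact_mod_cast h0.ne'
  have eα : alpha q = shift 0 0 * diagOp (aPlus q) +
      diagOp (fun x => aMinus q (up 1 1 x)) * star (shift 1 1) := by
    rw [← star_shift_mul_diagOp 1 1 ⟨1, fun x => (hc x).2.1⟩]; rfl
  rw [eα, star_add, star_mul, star_mul, star_star, star_diagOp, star_diagOp, add_comm]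
  refine modelEmb_leftLadder h0 h1 .aStar .a 1 1 0 0 rfl rfl rfl rfl ⟨1, fun x => (hc _).2.1⟩
    ⟨1, fun x => (hc x).1⟩ (aMinus_up_eq h0 h1) (aPlus_eq h0 h1) (fun x => ?_) (fun x => ?_) v
  · simp only [upWeight, leftLadder, zpow_natCast]
    push_cast
    rw [ofReal_qInt]
    ring
  · have e1 := (qInt_pos h0 h1 x.N).ne'
    have hI := x.hI
    have hJ := x.hJ
    simp only [upWeight, leftLadder, zpow_natCast, normRatio, newIndex, if_true, Fin.val_zero,
      add_zero]
    rw [pow_succ_div_pow hq hI, pow_succ_div_pow hq hJ, ← pow_succ, ← ofReal_qInt, ← ofReal_qInt,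
      ← ofReal_qInt]
    norm_cast
    field_simp
    ring

theorem beta_modelEmb (v : Idx →₀ ℂ) :
    beta q (modelEmb q v) = modelEmb q (genOp q .b v) := by
  have hc := coefficients_bounded h0 h1
  have hq : (q : ℂ) ≠ 0 := by exact_mod_cast h0.ne'
  have eβ : beta q = shift 1 0 * diagOp (bPlus q) +
      diagOp (fun x => bMinus q (up 0 1 x)) * star (shift 0 1) := by
    rw [← star_shift_mul_diagOp 0 1 ⟨1, fun x => (hc x).2.2.2⟩]; rfl
  rw [eβ]
  refine modelEmb_leftLadder h0 h1 .b .bStar 1 0 0 1 rfl rfl rfl rfl ⟨1, fun x => (hc x).2.2.1⟩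
    ⟨1, fun x => (hc _).2.2.2⟩ (bPlus_eq h0 h1) (bMinus_up_eq h0 h1) (fun x => ?_) (fun x => ?_) v
  · simp only [upWeight, leftLadder, zpow_natCast]
    push_cast
    rw [ofReal_qInt]
    ring
  · have e1 := (qInt_pos h0 h1 x.N).ne'
    have hI := x.hI
    simp only [upWeight, leftLadder, zpow_natCast, normRatio, newIndex, one_ne_zero, if_false,
      if_true, Fin.val_one, Fin.val_zero, add_zero]
    rw [pow_succ_div_pow hq hI, ← pow_succ, ← ofReal_qInt, ← ofReal_qInt, ← ofReal_qInt]
    norm_cast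
    field_simp

theorem star_beta_modelEmb (v : Idx →₀ ℂ) :
    star (beta q) (modelEmb q v) = modelEmb q (genOp q .bStar v) := by
  have hc := coefficients_bounded h0 h1
  have hq : (q : ℂ) ≠ 0 := by exact_mod_cast h0.ne'
  have eβ : beta q = shift 1 0 * diagOp (bPlus q) +
      diagOp (fun x => bMinus q (up 0 1 x)) * star (shift 0 1) := by
    rw [← star_shift_mul_diagOp 0 1 ⟨1, fun x => (hc x).2.2.2⟩]; rfl
  rw [eβ, star_add, star_mul, star_mul, star_star, star_diagOp, star_diagOp, add_comm]
  refine modelEmb_leftLadder h0 h1 .bStar .b 0 1 1 0 rfl rfl rfl rfl ⟨1, fun x => (hc _).2.2.2⟩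
    ⟨1, fun x => (hc x).2.2.1⟩ (bMinus_up_eq h0 h1) (bPlus_eq h0 h1) (fun x => ?_) (fun x => ?_) v
  · simp only [upWeight, leftLadder, zpow_natCast]
    push_cast
    rw [ofReal_qInt]
    ring
  · have e1 := (qInt_pos h0 h1 x.N).ne'
    have hJ := x.hJ
    simp only [upWeight, leftLadder, zpow_natCast, normRatio, newIndex, one_ne_zero, if_false,
      if_true, Fin.val_one, Fin.val_zero, add_zero]
    rw [pow_succ_div_pow hq hJ, ← pow_succ, ← ofReal_qInt, ← ofReal_qInt, ← ofReal_qInt]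
    norm_cast
    field_simp

theorem evalPoly_modelEmb (p : Poly) (v : Idx →₀ ℂ) :
    evalPoly (alpha q) (beta q) p (modelEmb q v) = modelEmb q (modelRep q p v) := by
  induction p using FreeAlgebra.induction generalizing v with
  | grade0 c => rw [AlgHom.commutes, AlgHom.commutes, Module.algebraMap_end_apply, map_smul,
      Algebra.algebraMap_eq_smul_one, _root_.smul_apply, one_apply_eq_self]
  | grade1 g =>
    rw [modelRep, evalPoly, FreeAlgebra.lift_ι_apply, FreeAlgebra.lift_ι_apply]
    cases g
    · exact alpha_modelEmb h0 h1 v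
    · exact star_alpha_modelEmb h0 h1 v
    · exact beta_modelEmb h0 h1 v
    · exact star_beta_modelEmb h0 h1 v
  | mul a b ha hb => rw [map_mul, map_mul, mul_apply_eq_comp, Module.End.mul_apply, hb, ha]
  | add a b ha hb => rw [map_add, map_add, _root_.add_apply, ha, hb, LinearMap.add_apply, map_add]

theorem clm_ext_modelEmb {E : Type*} [NormedAddCommGroup E] [NormedSpace ℂ E]
    {S T : L2h →L[ℂ] E} (h : ∀ v, S (modelEmb q v) = T (modelEmb q v)) : S = T :=
  clm_ext_e fun x => by rw [e_eq_modelEmb h0 h1]; exact h _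

theorem evalPoly_eq_of_modelRep_eq {p p' : Poly} (h : modelRep q p = modelRep q p') :
    evalPoly (alpha q) (beta q) p = evalPoly (alpha q) (beta q) p' :=
  clm_ext_modelEmb h0 h1 fun v => by
    rw [evalPoly_modelEmb h0 h1, evalPoly_modelEmb h0 h1, h]

theorem one_sub_pow_sq_ne_zero (n : ℕ) : 1 - ((q : ℂ) ^ (n + 1)) ^ 2 ≠ 0 := by
  rw [← ofReal_qInt]
  exact_mod_cast (qInt_pos h0 h1 n).ne'

theorem alpha_beta_relations :
    star (alpha q) * alpha q + star (beta q) * beta q = 1 ∧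
    alpha q * star (alpha q) + (q : ℂ) ^ 2 • (beta q * star (beta q)) = 1 ∧
    alpha q * beta q - (q : ℂ) • (beta q * alpha q) = 0 ∧
    alpha q * star (beta q) - (q : ℂ) • (star (beta q) * alpha q) = 0 ∧
    star (beta q) * beta q = beta q * star (beta q) := by
  have hq : (q : ℂ) ≠ 0 := by exact_mod_cast h0.ne'
  have hq1 := one_sub_pow_sq_ne_zero h0 h1
  let x : Gen → Poly := FreeAlgebra.ι ℂ
  have key : ∀ (c d : ℂ) (g₁ g₂ g₃ g₄ : Gen),
      genOp q g₁ * genOp q g₂ + c • (genOp q g₃ * genOp q g₄) =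
        d • (1 : Module.End ℂ (Idx →₀ ℂ)) →
      evalPoly (alpha q) (beta q) (x g₁ * x g₂ + c • (x g₃ * x g₄)) =
        evalPoly (alpha q) (beta q) (d • 1) := fun c d g₁ g₂ g₃ g₄ h =>
    evalPoly_eq_of_modelRep_eq h0 h1 (by simpa [x, modelRep] using h)
  have r1 := key _ _ _ _ _ _ (genOp_relation₁ hq hq1)
  have r2 := key _ _ _ _ _ _ (genOp_relation₂ hq hq1)
  have r3 := key _ _ _ _ _ _ (genOp_relation₃ hq hq1)
  have r4 := key _ _ _ _ _ _ (genOp_relation₄ hq hq1)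
  have r5 := key _ _ _ _ _ _ (genOp_relation₅ hq hq1)
  simp only [x, evalPoly, map_add, map_mul, map_smul, map_one, map_zero, FreeAlgebra.lift_ι_apply,
    one_smul, zero_smul, neg_smul, ← sub_eq_add_neg, map_sub] at r1 r2 r3 r4 r5
  exact ⟨r1, r2, r3, r4, sub_eq_zero.1 r5⟩

end

/-! ### Cyclic and separating vectors of the algebraic model -/

/-- A subspace containing the vector with label `0, 0, 0` and invariant under ladder operators in
all four directions is everything. -/
theorem eq_top_of_ladder_mem {q : ℂ} {W : Submodule ℂ (Idx →₀ ℂ)} (F : Gen → Ladder)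
    (hF : ∀ s t : ℤ, s = 0 ∨ s = 1 → t = 0 ∨ t = 1 → ∃ g, (F g).s = s ∧ (F g).t = t)
    (hu : ∀ g N I J, ValidIdx N I J → (F g).u (q ^ N) (q ^ I) (q ^ J) ≠ 0)
    (h0 : basisVec 0 0 0 ∈ W) (hW : ∀ g, ∀ v ∈ W, (F g).op q v ∈ W) : W = ⊤ := by
  have key : ∀ (n : ℕ) (N I J : ℤ), N ≤ n → basisVec N I J ∈ W := by
    intro n
    induction n with
    | zero =>
      intro N I J hN
      by_cases hv : ValidIdx N I J
      · obtain ⟨h1, h2, h3, h4⟩ := hv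
        rw [show N = 0 by omega, show I = 0 by omega, show J = 0 by omega]
        exact h0
      · rw [basisVec_of_not_valid hv]
        exact W.zero_mem
    | succ n ih =>
      intro N I J hN
      by_cases hv : ValidIdx N I J
      · by_cases hN' : N ≤ n
        · exact ih N I J hN'
        obtain ⟨h1, h2, h3, h4⟩ := hv
        -- Every label of level N ≥ 1 lies above some label of level N - 1: keep the coordinate if
        -- it still fits, otherwise lower it by one.
        have hs : ∀ i : ℤ, 0 ≤ i → i ≤ N → ∃ s : ℤ, (s = 0 ∨ s = 1) ∧ 0 ≤ i - s ∧ i - s ≤ N - 1 := by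
          intro i hi hi'
          by_cases h : i ≤ N - 1
          · exact ⟨0, Or.inl rfl, by omega, by omega⟩
          · exact ⟨1, Or.inr rfl, by omega, by omega⟩
        obtain ⟨s, hs1, hs2, hs3⟩ := hs I h1 h2
        obtain ⟨t, ht1, ht2, ht3⟩ := hs J h3 h4
        obtain ⟨g, rfl, rfl⟩ := hF s t hs1 ht1
        have hv' : ValidIdx (N - 1) (I - (F g).s) (J - (F g).t) := ⟨hs2, hs3, ht2, ht3⟩
        have hm := hW g _ (ih (N - 1) (I - (F g).s) (J - (F g).t) (by omega))
        rw [Ladder.op_basisVec q _ hv', sub_add_cancel, sub_add_cancel, sub_add_cancel] at hm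
        -- The lowered component has level N - 2 and lies in W by induction, so a nonzero multiple
        -- of the wanted vector does too.
        have hm' := (Submodule.add_mem_iff_left W
          (W.smul_mem _ (ih (N - 1 - 1) (I - 1) (J - 1) (by omega)))).1 hm
        exact (Submodule.smul_mem_iff W (hu g _ _ _ hv')).1 hm'
      · rw [basisVec_of_not_valid hv]
        exact W.zero_mem
  refine eq_top_iff.2 fun v _ => ?_
  rw [← Finsupp.sum_single v]
  refine Submodule.sum_mem _ fun x _ => ?_
  rw [← mul_one (v x), ← smul_eq_mul, ← Finsupp.smul_single, ← basisVec_coe]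
  exact W.smul_mem _ (key x.N _ _ _ le_rfl)

section

variable {q : ℂ} (hq : q ≠ 0) (hq1 : ∀ n : ℕ, 1 - (q ^ (n + 1)) ^ 2 ≠ 0)
include hq1

theorem one_sub_zpow_ne_zero {N I J : ℤ} (h : ValidIdx N I J) : 1 - (q ^ N * q) ^ 2 ≠ 0 := by
  obtain ⟨x, rfl, rfl, rfl⟩ := h.exists_idx
  rw [zpow_natCast, ← pow_succ]
  exact hq1 _

include hq

theorem leftLadder_u_ne_zero (g : Gen) {N I J : ℤ} (h : ValidIdx N I J) {X Y : ℂ} (hX : X ≠ 0)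
    (hY : Y ≠ 0) : (leftLadder q g).u (q ^ N) X Y ≠ 0 := by
  have h1 := one_sub_zpow_ne_zero hq1 h
  cases g
  · exact div_ne_zero (mul_ne_zero (mul_ne_zero hq hX) hY) h1
  · exact div_ne_zero one_ne_zero h1
  · exact div_ne_zero (neg_ne_zero.2 hY) h1
  · exact div_ne_zero hX h1

/-- The vector with label `0, 0, 0` is cyclic. -/
theorem exists_modelRep_eq (v : Idx →₀ ℂ) : ∃ p, modelRep q p (basisVec 0 0 0) = v := by
  have h : LinearMap.range ((LinearMap.applyₗ (basisVec 0 0 0)) ∘ₗ (modelRep q).toLinearMap) = ⊤ := by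
    refine eq_top_of_ladder_mem (leftLadder q) ?_
      (fun g N I J h => leftLadder_u_ne_zero hq hq1 g h (zpow_ne_zero _ hq) (zpow_ne_zero _ hq))
      ⟨1, by simp⟩ ?_
    · rintro s t (rfl | rfl) (rfl | rfl)
      exacts [⟨.a, rfl, rfl⟩, ⟨.bStar, rfl, rfl⟩, ⟨.b, rfl, rfl⟩, ⟨.aStar, rfl, rfl⟩]
    · rintro g _ ⟨p, rfl⟩
      refine ⟨FreeAlgebra.ι ℂ g * p, ?_⟩
      simp [modelRep, genOp]
  obtain ⟨p, hp⟩ := LinearMap.range_eq_top.1 h v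
  exact ⟨p, hp⟩

theorem modelRep_comm_rightLadder (p : Poly) (g : Gen) :
    Commute (modelRep q p) ((rightLadder q g).op q) := by
  induction p using FreeAlgebra.induction with
  | grade0 c => rw [AlgHom.commutes]; exact Algebra.commute_algebraMap_left _ _
  | grade1 g' =>
    rw [modelRep, FreeAlgebra.lift_ι_apply]
    exact leftLadder_comm_rightLadder hq hq1 g' g
  | mul a b ha hb => rw [map_mul]; exact ha.mul_left hb
  | add a b ha hb => rw [map_add]; exact ha.add_left hb

/-- The vector with label `0, 0, 0` is separating. -/
theorem modelRep_eq_zero {p : Poly} (h : modelRep q p (basisVec 0 0 0) = 0) :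
    modelRep q p = 0 := by
  rw [← LinearMap.ker_eq_top]
  -- The kernel of p contains the vacuum and is invariant under the right ladders, which commute
  -- with p.
  refine eq_top_of_ladder_mem (rightLadder q) ?_
    (fun g N I J h => leftLadder_u_ne_zero hq hq1 g h
      (div_ne_zero (zpow_ne_zero _ hq) (zpow_ne_zero _ hq))
      (div_ne_zero (zpow_ne_zero _ hq) (zpow_ne_zero _ hq))) h ?_
  · rintro s t (rfl | rfl) (rfl | rfl)
    exacts [⟨.aStar, by simp [rightLadder, leftLadder], by simp [rightLadder, leftLadder]⟩,
      ⟨.b, by simp [rightLadder, leftLadder], by simp [rightLadder, leftLadder]⟩,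
      ⟨.bStar, by simp [rightLadder, leftLadder], by simp [rightLadder, leftLadder]⟩,
      ⟨.a, by simp [rightLadder, leftLadder], by simp [rightLadder, leftLadder]⟩]
  · intro g v hv
    rw [LinearMap.mem_ker] at hv ⊢
    rw [← Module.End.mul_apply, (modelRep_comm_rightLadder hq hq1 p g).eq, Module.End.mul_apply, hv,
      map_zero]

end

/-! ### The coproduct on the algebraic model -/

/-- The inverse of the `q`-factorial of `n`, which is `0` for `n < 0`. -/
noncomputable def invFac (q : ℂ) (n : ℤ) : ℂ :=
  if n < 0 then 0 else (∏ i ∈ Finset.range n.toNat, (1 - (q ^ (i + 1)) ^ 2))⁻¹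

/-- Extension by zero to negative integers makes the recursion hold at every integer: at n = 0 both
sides vanish. -/
theorem invFac_sub_one {q : ℂ} (hq1 : ∀ n : ℕ, 1 - (q ^ (n + 1)) ^ 2 ≠ 0) (n : ℤ) :
    (1 - (q ^ n) ^ 2) * invFac q n = invFac q (n - 1) := by
  rcases lt_trichotomy n 0 with h | rfl | h
  · rw [invFac, if_pos h, invFac, if_pos (by omega), mul_zero]
  · simp [invFac]
  · obtain ⟨m, rfl⟩ : ∃ m : ℕ, n = m + 1 := ⟨(n - 1).toNat, by omega⟩
    rw [invFac, if_neg (by omega), invFac, if_neg (by omega), add_sub_cancel_right,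
      show ((m : ℤ) + 1).toNat = m + 1 by omega, Int.toNat_natCast, Finset.prod_range_succ, mul_inv,
      show ((m : ℤ) + 1) = ((m + 1 : ℕ) : ℤ) by push_cast; rfl, zpow_natCast, mul_left_comm,
      mul_inv_cancel₀ (hq1 m), mul_one]

/-- The coefficients of the coproduct on the algebraic model. -/
noncomputable def coprodWeight (q : ℂ) (N k : ℤ) : ℂ := q ^ (N - k) * invFac q k * invFac q (N - k)

theorem coprodWeight_eq_zero (q : ℂ) {N k : ℤ} (h : k < 0 ∨ N < k) : coprodWeight q N k = 0 := by
  rw [coprodWeight]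
  rcases h with h | h
  · rw [invFac, if_pos h, mul_zero, zero_mul]
  · rw [show invFac q (N - k) = 0 from if_pos (by omega), mul_zero]

section

variable {q : ℂ} (hq : q ≠ 0) (hq1 : ∀ n : ℕ, 1 - (q ^ (n + 1)) ^ 2 ≠ 0)
include hq1

theorem coprodWeight_sub_one_sub_one (N k : ℤ) :
    (1 - (q ^ k) ^ 2) * coprodWeight q N k = coprodWeight q (N - 1) (k - 1) := by
  rw [coprodWeight, coprodWeight, ← invFac_sub_one hq1 k, sub_sub_sub_cancel_right]
  ring

include hq

theorem coprodWeight_sub_one (N k : ℤ) :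
    (1 - (q ^ (N - k)) ^ 2) * coprodWeight q N k = q * coprodWeight q (N - 1) k := by
  have h := invFac_sub_one hq1 (N - k)
  have e : q ^ (N - k) = q * q ^ (N - 1 - k) := by
    rw [← zpow_one_add₀ hq]; congr 1; ring
  rw [coprodWeight, coprodWeight, show N - 1 - k = N - k - 1 by ring, ← h, e,
    show N - k - 1 = N - 1 - k by ring]
  ring

/-- A q-Pascal rule, from 1 - q^{2(N+1)} = (1 - q^{2k}) + q^{2k}(1 - q^{2(N+1-k)}) and the two
preceding recursions. -/
theorem coprodWeight_add_one (N k : ℤ) :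
    (1 - (q ^ N * q) ^ 2) * coprodWeight q (N + 1) k =
      coprodWeight q N (k - 1) + q * (q ^ k) ^ 2 * coprodWeight q N k := by
  have h1 := coprodWeight_sub_one_sub_one hq1 (N + 1) k
  have h2 := coprodWeight_sub_one hq hq1 (N + 1) k
  rw [add_sub_cancel_right] at h1 h2
  have e : q ^ k * q ^ (N + 1 - k) = q ^ N * q := by
    rw [← zpow_add₀ hq, ← zpow_add_one₀ hq]; congr 1; ring
  rw [← e]
  linear_combination h1 + (q ^ k) ^ 2 * h2

end

/-- The coproduct on the algebraic model. -/
noncomputable def modelCoprod (q : ℂ) : (Idx →₀ ℂ) →ₗ[ℂ] (Idx →₀ ℂ) ⊗[ℂ] (Idx →₀ ℂ) :=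
  Finsupp.linearCombination ℂ fun x =>
    ∑ᶠ k : ℤ, coprodWeight q x.N k • (basisVec x.N x.I k ⊗ₜ[ℂ] basisVec x.N k x.J)

/-- Writing k - 0 gives the sum the shape with a general offset to which the finite sum lemmas
apply. -/
theorem modelCoprod_basisVec (q : ℂ) {N I J : ℤ} (h : ValidIdx N I J) :
    modelCoprod q (basisVec N I J) =
      ∑ᶠ k : ℤ, coprodWeight q N (k - 0) • (basisVec N I k ⊗ₜ[ℂ] basisVec N k J) := by
  obtain ⟨x, rfl, rfl, rfl⟩ := h.exists_idx
  simp only [sub_zero]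
  rw [basisVec_coe, modelCoprod, Finsupp.linearCombination_single, one_smul]

theorem hasFiniteSupport_coprodWeight_smul {M : Type*} [AddCommMonoid M] [Module ℂ M] (q : ℂ)
    (N m : ℤ) (f : ℤ → M) :
    Function.HasFiniteSupport fun k => coprodWeight q N (k - m) • f k := by
  refine (Set.finite_Icc m (N + m)).subset fun k hk => ?_
  by_contra h
  refine hk ?_
  change coprodWeight q N (k - m) • f k = 0
  rw [coprodWeight_eq_zero q, zero_smul]
  rw [Set.mem_Icc, not_and_or] at h
  omega

theorem map_finsum_coprodWeight_smul {M M' : Type*} [AddCommMonoid M] [Module ℂ M] [AddCommMonoid M']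
    [Module ℂ M'] (q : ℂ) (N m : ℤ) (f : ℤ → M) (T : M →ₗ[ℂ] M') :
    T (∑ᶠ k, coprodWeight q N (k - m) • f k) = ∑ᶠ k, coprodWeight q N (k - m) • T (f k) := by
  simp only [← map_smul]
  exact AddMonoidHom.map_finsum T.toAddMonoidHom (hasFiniteSupport_coprodWeight_smul q N m f)

theorem smul_finsum_coprodWeight_smul {M : Type*} [AddCommMonoid M] [Module ℂ M] (q : ℂ)
    (N m : ℤ) (f : ℤ → M) (c : ℂ) :
    c • (∑ᶠ k, coprodWeight q N (k - m) • f k) = ∑ᶠ k, coprodWeight q N (k - m) • c • f k :=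
  map_finsum_coprodWeight_smul q N m f (c • LinearMap.id)

theorem finsum_comp_sub {M : Type*} [AddCommMonoid M] (f : ℤ → M) (m : ℤ) :
    ∑ᶠ k, f k = ∑ᶠ k, f (k - m) :=
  (finsum_comp_equiv (Equiv.subRight m)).symm

/-- A pair of ladder operators on the coproduct of a basis vector. -/
theorem map_modelCoprod_basisVec {q : ℂ} (hq : q ≠ 0) (L L' : Ladder) (hLL : L.t = L'.s)
    {N I J : ℤ} (h : ValidIdx N I J) :
    TensorProduct.map (L.op q) (L'.op q) (modelCoprod q (basisVec N I J)) =
      ∑ᶠ j : ℤ, coprodWeight q N (j - L'.s) •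
        ((L.u (q ^ N) (q ^ I) (q ^ j / q ^ L'.s) • basisVec (N + 1) (I + L.s) j +
          L.d (q ^ N) (q ^ I) (q ^ j / q ^ L'.s) • basisVec (N - 1) (I + L.s - 1) (j - 1)) ⊗ₜ[ℂ]
        (L'.u (q ^ N) (q ^ j / q ^ L'.s) (q ^ J) • basisVec (N + 1) j (J + L'.t) +
          L'.d (q ^ N) (q ^ j / q ^ L'.s) (q ^ J) • basisVec (N - 1) (j - 1) (J + L'.t - 1))) := by
  rw [modelCoprod_basisVec q h, map_finsum_coprodWeight_smul, finsum_comp_sub _ L'.s]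
  refine finsum_congr fun j => ?_
  rw [TensorProduct.map_tmul, sub_zero]
  -- Outside the range of the middle index the weight is zero, so the ladder formula is needed only
  -- on genuine labels.
  by_cases hj : 0 ≤ j - L'.s ∧ j - L'.s ≤ N
  · obtain ⟨k1, k2, k3, k4⟩ := h
    rw [Ladder.op_basisVec q L (J := j - L'.s) ⟨k1, k2, hj.1, hj.2⟩,
      Ladder.op_basisVec q L' (I := j - L'.s) ⟨hj.1, hj.2, k3, k4⟩, hLL, sub_add_cancel,
      zpow_sub₀ hq]
  · rw [coprodWeight_eq_zero q (by omega), zero_smul, zero_smul]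

theorem modelCoprod_ladder {q : ℂ} {L : Ladder} (hL : L.IsProper q) {N I J : ℤ}
    (h : ValidIdx N I J) :
    modelCoprod q (L.op q (basisVec N I J)) =
      (∑ᶠ j : ℤ, coprodWeight q (N + 1) (j - 0) • (L.u (q ^ N) (q ^ I) (q ^ J) •
        (basisVec (N + 1) (I + L.s) j ⊗ₜ[ℂ] basisVec (N + 1) j (J + L.t)))) +
      ∑ᶠ j : ℤ, coprodWeight q (N - 1) (j - 1) • (L.d (q ^ N) (q ^ I) (q ^ J) •
        (basisVec (N - 1) (I + L.s - 1) (j - 1) ⊗ₜ[ℂ]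
          basisVec (N - 1) (j - 1) (J + L.t - 1))) := by
  rw [L.op_basisVec q h, map_add, map_smul, map_smul, modelCoprod_basisVec q (hL.valid_up h)]
  congr 1
  · rw [smul_finsum_coprodWeight_smul]
  · by_cases hv : ValidIdx (N - 1) (I + L.s - 1) (J + L.t - 1)
    · rw [modelCoprod_basisVec q hv, smul_finsum_coprodWeight_smul, finsum_comp_sub _ 1]
      simp only [sub_zero]
    · simp only [hL.d_eq_zero N I J h hv, zero_smul, smul_zero, finsum_zero]

/-- Compatibility of the coproduct with ladder operators, reduced to identities of coefficients. -/
theorem map_add_map_modelCoprod {q : ℂ} (hq : q ≠ 0) (hq1 : ∀ n : ℕ, 1 - (q ^ (n + 1)) ^ 2 ≠ 0)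
    {L L₁ L₁' L₂ L₂' : Ladder} (hL : L.IsProper q) (c₁ c₂ : ℂ)
    (hm₁ : L₁.t = 0) (hm₁' : L₁'.s = 0) (hm₂ : L₂.t = 1) (hm₂' : L₂'.s = 1)
    (hs₁ : L₁.s = L.s) (hs₂ : L₂.s = L.s) (ht₁ : L₁'.t = L.t) (ht₂ : L₂'.t = L.t)
    (H : ∀ Z X Y K w w₁ wu wd : ℂ, Z ≠ 0 → X ≠ 0 → Y ≠ 0 → K ≠ 0 → 1 - (Z * q) ^ 2 ≠ 0 →
      (1 - K ^ 2) * w = wd → (1 - (Z * q / K) ^ 2) * w₁ = q * wd →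
      (1 - (Z * q) ^ 2) * wu = w₁ + q * K ^ 2 * w →
      c₁ * w * (L₁.u Z X K * L₁'.u Z K Y) + c₂ * w₁ * (L₂.u Z X (K / q) * L₂'.u Z (K / q) Y) =
        wu * L.u Z X Y ∧
      c₁ * w * (L₁.u Z X K * L₁'.d Z K Y) + c₂ * w₁ * (L₂.u Z X (K / q) * L₂'.d Z (K / q) Y) = 0 ∧
      c₁ * w * (L₁.d Z X K * L₁'.u Z K Y) + c₂ * w₁ * (L₂.d Z X (K / q) * L₂'.u Z (K / q) Y) = 0 ∧
      c₁ * w * (L₁.d Z X K * L₁'.d Z K Y) + c₂ * w₁ * (L₂.d Z X (K / q) * L₂'.d Z (K / q) Y) =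
        wd * L.d Z X Y) :
    (c₁ • TensorProduct.map (L₁.op q) (L₁'.op q) + c₂ • TensorProduct.map (L₂.op q) (L₂'.op q)) ∘ₗ
      modelCoprod q = modelCoprod q ∘ₗ L.op q := by
  refine linearMap_ext_basisVec fun N I J hv => ?_
  rw [LinearMap.comp_apply, LinearMap.comp_apply, LinearMap.add_apply, LinearMap.smul_apply,
    LinearMap.smul_apply, map_modelCoprod_basisVec hq _ _ (hm₁.trans hm₁'.symm) hv,
    map_modelCoprod_basisVec hq _ _ (hm₂.trans hm₂'.symm) hv, modelCoprod_ladder hL hv,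
    smul_finsum_coprodWeight_smul, smul_finsum_coprodWeight_smul,
    ← finsum_add_distrib (hasFiniteSupport_coprodWeight_smul _ _ _ _)
      (hasFiniteSupport_coprodWeight_smul _ _ _ _),
    ← finsum_add_distrib (hasFiniteSupport_coprodWeight_smul _ _ _ _)
      (hasFiniteSupport_coprodWeight_smul _ _ _ _)]
  refine finsum_congr fun j => ?_
  have e : q ^ (N - (j - 1)) = q ^ N * q / q ^ j := by
    rw [← zpow_add_one₀ hq, ← zpow_sub₀ hq]; congr 1; ring
  have r2 := coprodWeight_sub_one hq hq1 N (j - 1)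
  rw [e] at r2
  -- Here w, w₁, wu, wd are the weights at (N, j), (N, j-1), (N+1, j), (N-1, j-1). The up-up and
  -- down-down terms reproduce the ladder L, and the mixed terms cancel.
  obtain ⟨huu, hud, hdu, hdd⟩ := H (q ^ N) (q ^ I) (q ^ J) (q ^ j) _ _ _ _ (zpow_ne_zero _ hq)
    (zpow_ne_zero _ hq) (zpow_ne_zero _ hq) (zpow_ne_zero _ hq) (one_sub_zpow_ne_zero hq1 hv)
    (coprodWeight_sub_one_sub_one hq1 N j) r2 (coprodWeight_add_one hq hq1 N j)
  rw [hm₁', hm₂', hs₁, hs₂, ht₁, ht₂, sub_zero, zpow_zero, div_one, zpow_one]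
  simp only [TensorProduct.add_tmul, TensorProduct.tmul_add, TensorProduct.smul_tmul_smul]
  generalize basisVec (N + 1) (I + L.s) j ⊗ₜ[ℂ] basisVec (N + 1) j (J + L.t) = UU
  generalize basisVec (N + 1) (I + L.s) j ⊗ₜ[ℂ] basisVec (N - 1) (j - 1) (J + L.t - 1) = UD
  generalize basisVec (N - 1) (I + L.s - 1) (j - 1) ⊗ₜ[ℂ] basisVec (N + 1) j (J + L.t) = DU
  generalize basisVec (N - 1) (I + L.s - 1) (j - 1) ⊗ₜ[ℂ]
    basisVec (N - 1) (j - 1) (J + L.t - 1) = DD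
  rw [smul_smul _ _ UU, smul_smul _ _ DD, ← huu, ← hdd]
  have h0 := (congrArg₂ (fun a b : ℂ => a • UD + b • DU) hud hdu).trans
    (by rw [zero_smul, zero_smul, add_zero])
  refine Eq.trans ?_ ((congrArg (_ + ·) h0).trans (add_zero _))
  module

/-- The coproduct of the algebraic model is compatible with the coproduct of the generators. -/
theorem coprod_genOp {q : ℂ} (hq : q ≠ 0) (hq1 : ∀ n : ℕ, 1 - (q ^ (n + 1)) ^ 2 ≠ 0) :
    ((1 : ℂ) • TensorProduct.map (genOp q .a) (genOp q .a) +
      (-q) • TensorProduct.map (genOp q .bStar) (genOp q .b)) ∘ₗ modelCoprod q =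
        modelCoprod q ∘ₗ genOp q .a ∧
    ((-q) • TensorProduct.map (genOp q .b) (genOp q .bStar) +
      (1 : ℂ) • TensorProduct.map (genOp q .aStar) (genOp q .aStar)) ∘ₗ modelCoprod q =
        modelCoprod q ∘ₗ genOp q .aStar ∧
    ((1 : ℂ) • TensorProduct.map (genOp q .b) (genOp q .a) +
      (1 : ℂ) • TensorProduct.map (genOp q .aStar) (genOp q .b)) ∘ₗ modelCoprod q =
        modelCoprod q ∘ₗ genOp q .b ∧
    ((1 : ℂ) • TensorProduct.map (genOp q .a) (genOp q .bStar) +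
      (1 : ℂ) • TensorProduct.map (genOp q .bStar) (genOp q .aStar)) ∘ₗ modelCoprod q =
        modelCoprod q ∘ₗ genOp q .bStar := by
  refine ⟨?_, ?_, ?_, ?_⟩ <;>
    refine map_add_map_modelCoprod hq hq1 (isProper_leftLadder hq _) _ _ rfl rfl rfl rfl rfl rfl
      rfl rfl ?_ <;>
    intro Z X Y K w w₁ wu wd hZ hX hY hK hD h1 h2 h3 <;>
    -- With K removed from the denominator here, wd eliminated by h1 and wu by h3, a single relation
    -- between w and w₁ remains.
    replace h2 : (K ^ 2 - Z ^ 2 * q ^ 2) * w₁ = q * K ^ 2 * wd := by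
      · field_simp at h2
        linear_combination h2
  all_goals
    obtain rfl := h1
    simp only [leftLadder]
    generalize hD' : 1 - (Z * q) ^ 2 = D at *
    obtain rfl : wu = (w₁ + q * K ^ 2 * w) / D := by
      rw [← h3, mul_div_cancel_left₀ _ hD]
    refine ⟨?_, ?_, ?_, ?_⟩ <;> field_simp <;> (try simp only [← hD']) <;> try grind

/-! ### Invariance of the vector state -/

/-- The coefficient of the basis vector with label `0, 0, 0`. -/
noncomputable def coeffZero : (Idx →₀ ℂ) →ₗ[ℂ] ℂ := Finsupp.lapply ⟨0, 0, 0, le_rfl, le_rfl⟩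

theorem coeffZero_basisVec {N I J : ℤ} (h : N ≠ 0) : coeffZero (basisVec N I J) = 0 := by
  by_cases hv : ValidIdx N I J
  · obtain ⟨x, rfl, rfl, rfl⟩ := hv.exists_idx
    rw [basisVec_coe, coeffZero, Finsupp.lapply_apply, Finsupp.single_eq_of_ne]
    rintro rfl
    exact h rfl
  · rw [basisVec_of_not_valid hv, map_zero]

theorem modelCoprod_basisVec_zero (q : ℂ) :
    modelCoprod q (basisVec 0 0 0) = basisVec 0 0 0 ⊗ₜ[ℂ] basisVec 0 0 0 := by
  rw [modelCoprod_basisVec q ⟨le_rfl, le_rfl, le_rfl, le_rfl⟩, finsum_eq_single _ 0]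
  · simp [coprodWeight, invFac]
  · intro k hk
    rw [coprodWeight_eq_zero q (by omega), zero_smul]

/-- Both legs of the coproduct have the level of the argument, so the vacuum coefficient annihilates
everything of level N ≠ 0. -/
theorem lid_map_coeffZero_modelCoprod (q : ℂ) (v : Idx →₀ ℂ) :
    TensorProduct.lid ℂ _ (TensorProduct.map coeffZero LinearMap.id (modelCoprod q v)) =
      coeffZero v • basisVec 0 0 0 := by
  suffices h : (TensorProduct.lid ℂ (Idx →₀ ℂ)).toLinearMap ∘ₗ
      TensorProduct.map coeffZero LinearMap.id ∘ₗ modelCoprod q =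
        coeffZero.smulRight (basisVec 0 0 0) from LinearMap.congr_fun h v
  refine linearMap_ext_basisVec fun N I J hv => ?_
  rw [LinearMap.comp_apply, LinearMap.comp_apply, LinearMap.smulRight_apply]
  by_cases hN : N = 0
  · obtain ⟨h1, h2, h3, h4⟩ := hv
    rw [hN, show I = 0 by omega, show J = 0 by omega, modelCoprod_basisVec_zero,
      TensorProduct.map_tmul, LinearEquiv.coe_coe, TensorProduct.lid_tmul, LinearMap.id_apply]
  · rw [coeffZero_basisVec hN, zero_smul, modelCoprod_basisVec q hv, map_finsum_coprodWeight_smul]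
    simp only [TensorProduct.map_tmul, coeffZero_basisVec hN, TensorProduct.zero_tmul, smul_zero,
      finsum_zero, map_zero]

theorem rid_map_coeffZero_modelCoprod (q : ℂ) (v : Idx →₀ ℂ) :
    TensorProduct.rid ℂ _ (TensorProduct.map LinearMap.id coeffZero (modelCoprod q v)) =
      coeffZero v • basisVec 0 0 0 := by
  suffices h : (TensorProduct.rid ℂ (Idx →₀ ℂ)).toLinearMap ∘ₗ
      TensorProduct.map LinearMap.id coeffZero ∘ₗ modelCoprod q =
        coeffZero.smulRight (basisVec 0 0 0) from LinearMap.congr_fun h v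
  refine linearMap_ext_basisVec fun N I J hv => ?_
  rw [LinearMap.comp_apply, LinearMap.comp_apply, LinearMap.smulRight_apply]
  by_cases hN : N = 0
  · obtain ⟨h1, h2, h3, h4⟩ := hv
    rw [hN, show I = 0 by omega, show J = 0 by omega, modelCoprod_basisVec_zero,
      TensorProduct.map_tmul, LinearEquiv.coe_coe, TensorProduct.rid_tmul, LinearMap.id_apply]
  · rw [coeffZero_basisVec hN, zero_smul, modelCoprod_basisVec q hv, map_finsum_coprodWeight_smul]
    simp only [TensorProduct.map_tmul, coeffZero_basisVec hN, TensorProduct.tmul_zero, smul_zero,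
      finsum_zero, map_zero]

/-- The tensor square of the representation on the algebraic model. -/
noncomputable def modelRepTensor (q : ℂ) :
    Poly ⊗[ℂ] Poly →ₐ[ℂ] Module.End ℂ ((Idx →₀ ℂ) ⊗[ℂ] (Idx →₀ ℂ)) :=
  (Module.endTensorEndAlgHom (R := ℂ) (S := ℂ) (A := ℂ)).comp
    (Algebra.TensorProduct.map (modelRep q) (modelRep q))

theorem modelRepTensor_tmul (q : ℂ) (a b : Poly) :
    modelRepTensor q (a ⊗ₜ[ℂ] b) = TensorProduct.map (modelRep q a) (modelRep q b) := by
  rw [modelRepTensor, AlgHom.comp_apply, Algebra.TensorProduct.map_tmul,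
    Module.endTensorEndAlgHom_apply]
  rfl

theorem modelRepTensor_sub_smul (q c : ℂ) (x y : Poly ⊗[ℂ] Poly) :
    modelRepTensor q (x - c • y) = modelRepTensor q x + (-c) • modelRepTensor q y := by
  have h : x - c • y = x + (-c) • y :=
    (sub_eq_add_neg x (c • y)).trans (congrArg (x + ·) (neg_smul c y).symm)
  rw [h, map_add, map_smul]

theorem modelRep_ι (q : ℂ) (g : Gen) : modelRep q (FreeAlgebra.ι ℂ g) = genOp q g :=
  FreeAlgebra.lift_ι_apply _ _

/-- Intertwining relations are stable under sums and products, so the four generators suffice. -/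
theorem modelRepTensor_coproduct {q : ℝ} (hq : (q : ℂ) ≠ 0)
    (hq1 : ∀ n : ℕ, 1 - ((q : ℂ) ^ (n + 1)) ^ 2 ≠ 0) (p : Poly) :
    modelRepTensor q (coproduct q p) ∘ₗ modelCoprod q = modelCoprod q ∘ₗ modelRep q p := by
  obtain ⟨ha, ha', hb, hb'⟩ := coprod_genOp hq hq1
  induction p using FreeAlgebra.induction with
  | grade0 c =>
    rw [AlgHom.commutes, AlgHom.commutes, AlgHom.commutes]
    refine LinearMap.ext fun v => ?_
    rw [LinearMap.comp_apply, LinearMap.comp_apply, Module.algebraMap_end_apply,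
      Module.algebraMap_end_apply, map_smul]
  | grade1 g =>
    rw [coproduct, FreeAlgebra.lift_ι_apply]
    cases g <;> dsimp only
    · rw [modelRepTensor_sub_smul, modelRepTensor_tmul, modelRepTensor_tmul]
      simp only [modelRep_ι]
      rw [← ha, one_smul]
    · rw [modelRepTensor_sub_smul, modelRepTensor_tmul, modelRepTensor_tmul]
      simp only [modelRep_ι]
      rw [← ha', one_smul, add_comm]
    · rw [map_add, modelRepTensor_tmul, modelRepTensor_tmul]
      simp only [modelRep_ι]
      rw [← hb, one_smul, one_smul]
    · rw [map_add, modelRepTensor_tmul, modelRepTensor_tmul]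
      simp only [modelRep_ι]
      rw [← hb', one_smul, one_smul, add_comm]
  | mul a b iha ihb =>
    rw [map_mul, map_mul, map_mul, Module.End.mul_eq_comp, Module.End.mul_eq_comp,
      LinearMap.comp_assoc, ihb, ← LinearMap.comp_assoc, iha, LinearMap.comp_assoc]
  | add a b iha ihb =>
    rw [map_add, map_add, map_add, LinearMap.add_comp, iha, ihb, LinearMap.comp_add]

/-- The functional `p ↦ φ(p Ω)`, with `Ω` the vector with label `0, 0, 0`. -/
noncomputable def modelState (q : ℂ) : Poly →ₗ[ℂ] ℂ :=
  coeffZero ∘ₗ LinearMap.applyₗ (basisVec 0 0 0) ∘ₗ (modelRep q).toLinearMap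

theorem modelState_apply (q : ℂ) (p : Poly) :
    modelState q p = coeffZero (modelRep q p (basisVec 0 0 0)) := rfl

theorem modelRep_lid_map_modelState (q : ℂ) (t : Poly ⊗[ℂ] Poly) :
    modelRep q (TensorProduct.lid ℂ _ (TensorProduct.map (modelState q) LinearMap.id t))
        (basisVec 0 0 0) =
      TensorProduct.lid ℂ _ (TensorProduct.map coeffZero LinearMap.id
        (modelRepTensor q t (basisVec 0 0 0 ⊗ₜ[ℂ] basisVec 0 0 0))) := by
  induction t with
  | zero => simp
  | tmul a b =>
    rw [modelRepTensor_tmul, TensorProduct.map_tmul, TensorProduct.map_tmul, TensorProduct.map_tmul,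
      TensorProduct.lid_tmul, TensorProduct.lid_tmul, map_smul, LinearMap.id_apply,
      LinearMap.id_apply, LinearMap.smul_apply, modelState_apply]
  | add a b ha hb => simp only [map_add, LinearMap.add_apply, ha, hb]

theorem modelRep_rid_map_modelState (q : ℂ) (t : Poly ⊗[ℂ] Poly) :
    modelRep q (TensorProduct.rid ℂ _ (TensorProduct.map LinearMap.id (modelState q) t))
        (basisVec 0 0 0) =
      TensorProduct.rid ℂ _ (TensorProduct.map LinearMap.id coeffZero
        (modelRepTensor q t (basisVec 0 0 0 ⊗ₜ[ℂ] basisVec 0 0 0))) := by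
  induction t with
  | zero => simp
  | tmul a b =>
    rw [modelRepTensor_tmul, TensorProduct.map_tmul, TensorProduct.map_tmul, TensorProduct.map_tmul,
      TensorProduct.rid_tmul, TensorProduct.rid_tmul, map_smul, LinearMap.id_apply,
      LinearMap.id_apply, LinearMap.smul_apply, modelState_apply]
  | add a b ha hb => simp only [map_add, LinearMap.add_apply, ha, hb]

section

variable {q : ℝ} (hq : (q : ℂ) ≠ 0) (hq1 : ∀ n : ℕ, 1 - ((q : ℂ) ^ (n + 1)) ^ 2 ≠ 0)
include hq hq1

theorem modelRepTensor_coproduct_basisVec (p : Poly) :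
    modelRepTensor q (coproduct q p) (basisVec 0 0 0 ⊗ₜ[ℂ] basisVec 0 0 0) =
      modelCoprod q (modelRep q p (basisVec 0 0 0)) := by
  rw [← modelCoprod_basisVec_zero q]
  exact LinearMap.congr_fun (modelRepTensor_coproduct hq hq1 p) _

theorem modelRep_eq_of_apply_eq {p p' : Poly}
    (h : modelRep q p (basisVec 0 0 0) = modelRep q p' (basisVec 0 0 0)) :
    modelRep q p = modelRep q p' := by
  have hs : modelRep q (p - p') = modelRep q p - modelRep q p' :=
    map_sub (modelRep (q : ℂ)).toLinearMap p p'
  refine sub_eq_zero.1 (hs.symm.trans (modelRep_eq_zero hq hq1 ?_))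
  rw [hs, LinearMap.sub_apply, h, sub_self]

/-- Both operators agree on the vacuum, where the intertwining relation turns Δ(p) into the model
coproduct of pΩ; separation gives equality. -/
theorem modelRep_left_invariant (p : Poly) :
    modelRep q (TensorProduct.lid ℂ _
      (TensorProduct.map (modelState q) LinearMap.id (coproduct q p))) =
      modelRep q (modelState q p • 1) := by
  refine modelRep_eq_of_apply_eq hq hq1 ?_
  rw [modelRep_lid_map_modelState, modelRepTensor_coproduct_basisVec hq hq1,
    lid_map_coeffZero_modelCoprod, map_smul, map_one]
  rfl

theorem modelRep_right_invariant (p : Poly) :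
    modelRep q (TensorProduct.rid ℂ _
      (TensorProduct.map LinearMap.id (modelState q) (coproduct q p))) =
      modelRep q (modelState q p • 1) := by
  refine modelRep_eq_of_apply_eq hq hq1 ?_
  rw [modelRep_rid_map_modelState, modelRepTensor_coproduct_basisVec hq hq1,
    rid_map_coeffZero_modelCoprod, map_smul, map_one]
  rfl

end

/-! ### The Haar state -/

theorem lid_map_eq {M M' M'' : Type*} [AddCommMonoid M] [Module ℂ M] [AddCommMonoid M']
    [Module ℂ M'] [AddCommMonoid M''] [Module ℂ M''] (φ : M →ₗ[ℂ] ℂ) (f : M' →ₗ[ℂ] M'')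
    (t : M ⊗[ℂ] M') : TensorProduct.lid ℂ M'' (TensorProduct.map φ f t) =
      f (TensorProduct.lid ℂ M' (TensorProduct.map φ LinearMap.id t)) := by
  induction t with
  | zero => simp
  | tmul a b => simp
  | add a b ha hb => simp only [map_add, ha, hb]

theorem rid_map_eq {M M' M'' : Type*} [AddCommMonoid M] [Module ℂ M] [AddCommMonoid M']
    [Module ℂ M'] [AddCommMonoid M''] [Module ℂ M''] (φ : M →ₗ[ℂ] ℂ) (f : M' →ₗ[ℂ] M'')
    (t : M' ⊗[ℂ] M) : TensorProduct.rid ℂ M'' (TensorProduct.map f φ t) =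
      f (TensorProduct.rid ℂ M' (TensorProduct.map LinearMap.id φ t)) := by
  induction t with
  | zero => simp
  | tmul a b => simp
  | add a b ha hb => simp only [map_add, ha, hb]

theorem gamma_mem_contAlg (q : ℝ) (r : ℕ) : gamma q r ∈ contAlg q := by
  have hb : beta q ∈ polyAlg q := StarAlgebra.subset_adjoin ℂ _ (Or.inr rfl)
  exact StarSubalgebra.le_topologicalClosure _ (add_mem (mul_mem (pow_mem (mul_mem
    (star_mem hb) hb) r) (sub_mem hb (one_mem _))) (one_mem _))

section

variable {q : ℝ} (h0 : 0 < q) (h1 : q < 1)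
include h0 h1

/-- The factor `qInt q 1` in `modelNorm` is there for this normalisation of the vacuum. -/
theorem modelNorm_zero : modelNorm q ⟨0, 0, 0, le_rfl, le_rfl⟩ = 1 := by
  have h := (qInt_pos h0 h1 0).ne'
  rw [zero_add] at h
  simp [modelNorm, qFac, div_self h]

theorem modelEmb_basisVec_zero :
    modelEmb q (basisVec 0 0 0) = e ⟨0, 0, 0, le_rfl, le_rfl⟩ := by
  rw [show basisVec 0 0 0 = Finsupp.single _ 1 from basisVec_coe ⟨0, 0, 0, le_rfl, le_rfl⟩,
    modelEmb_single, modelNorm_zero h0 h1, Complex.ofReal_one, one_smul]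

theorem inner_e_zero_modelEmb (v : Idx →₀ ℂ) :
    inner ℂ (e ⟨0, 0, 0, le_rfl, le_rfl⟩) (modelEmb q v) = coeffZero v := by
  classical
  suffices h : (innerSL ℂ (e ⟨0, 0, 0, le_rfl, le_rfl⟩)).toLinearMap ∘ₗ modelEmb q = coeffZero from
    LinearMap.congr_fun h v
  refine Finsupp.lhom_ext' fun x => LinearMap.ext_ring ?_
  change inner ℂ (e ⟨0, 0, 0, le_rfl, le_rfl⟩) (modelEmb q (Finsupp.single x 1)) =
    Finsupp.single x (1 : ℂ) ⟨0, 0, 0, le_rfl, le_rfl⟩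
  rw [modelEmb_single, inner_smul_right, orthonormal_iff_ite.1 orthonormal_e, Finsupp.single_apply]
  by_cases hx : x = ⟨0, 0, 0, le_rfl, le_rfl⟩
  · rw [hx, modelNorm_zero h0 h1]
    simp
  · rw [if_neg (Ne.symm hx), if_neg hx, mul_zero]

theorem evalPoly_e_zero (p : Poly) :
    evalPoly (alpha q) (beta q) p (e ⟨0, 0, 0, le_rfl, le_rfl⟩) =
      modelEmb q (modelRep q p (basisVec 0 0 0)) := by
  rw [← modelEmb_basisVec_zero h0 h1, evalPoly_modelEmb h0 h1]

theorem vectorFunctional_eq_modelState :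
    vectorFunctional (alpha q) (beta q) (e ⟨0, 0, 0, le_rfl, le_rfl⟩) = modelState q := by
  refine LinearMap.ext fun p => ?_
  change inner ℂ (e _) (evalPoly (alpha q) (beta q) p (e _)) = _
  rw [evalPoly_e_zero h0 h1, inner_e_zero_modelEmb h0 h1, modelState_apply]

/-- The operators `α`, `β` and the vector `e^{(0)}_{00}` are the GNS data of the Haar state. -/
theorem isHaarGNS : IsHaarGNS q (alpha q) (beta q) (e ⟨0, 0, 0, le_rfl, le_rfl⟩) := by
  have hq : (q : ℂ) ≠ 0 := by exact_mod_cast h0.ne'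
  have hq1 := one_sub_pow_sq_ne_zero h0 h1
  obtain ⟨r1, r2, r3, r4, r5⟩ := alpha_beta_relations h0 h1
  refine ⟨r1, r2, r3, r4, r5, orthonormal_e.1 _, ?_, fun p => ?_, fun p => ?_⟩
  · refine eq_top_iff.2 fun v _ =>
      mem_of_isClosed_of_e_mem (Submodule.isClosed_topologicalClosure _) v fun x _ => ?_
    refine Submodule.le_topologicalClosure _ (Submodule.subset_span ?_)
    obtain ⟨p, hp⟩ := exists_modelRep_eq hq hq1 ((modelNorm q x : ℂ)⁻¹ • Finsupp.single x 1)
    exact ⟨p, by dsimp only; rw [evalPoly_e_zero h0 h1, hp, ← e_eq_modelEmb h0 h1]⟩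
  · rw [vectorFunctional_eq_modelState h0 h1]
    rw [lid_map_eq, AlgHom.toLinearMap_apply,
      evalPoly_eq_of_modelRep_eq h0 h1 (modelRep_left_invariant hq hq1 p), map_smul, map_one]
  · rw [vectorFunctional_eq_modelState h0 h1]
    rw [rid_map_eq, AlgHom.toLinearMap_apply,
      evalPoly_eq_of_modelRep_eq h0 h1 (modelRep_right_invariant hq hq1 p), map_smul, map_one]

/-- Invertibility is obtained in the algebra of all bounded operators; by spectral permanence the
inverse lies in the closed *-subalgebra. -/
theorem exists_unit_eq_gamma {r : ℕ} (hr : q ^ (2 * r) < 1 / 2) :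
    ∃ u : (contAlg q)ˣ, ((u : contAlg q) : L2h →L[ℂ] L2h) = gamma q r := by
  obtain ⟨r1, r2, -, -, r5⟩ := alpha_beta_relations h0 h1
  have hu : IsUnit (gamma q r) := isUnit_of_rel h0 h1 r1 r2 r5 hr
  have : IsClosed (contAlg q : Set (L2h →L[ℂ] L2h)) :=
    StarSubalgebra.isClosed_topologicalClosure _
  have hu' : IsUnit (⟨gamma q r, gamma_mem_contAlg q r⟩ : contAlg q) :=
    (StarSubalgebra.coe_isUnit (contAlg q)).1 hu
  exact ⟨hu'.unit, rfl⟩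

end

end SUq2

theorem proposition4p4 (q : ℝ) (hq0 : 0 < q) (hq1 : q < 1) :
    -- the operators `α`, `β` and the vector `e^{(0)}_{00}` realise the GNS space of the Haar state
    IsHaarGNS q (alpha q) (beta q) (e ⟨0, 0, 0, le_rfl, le_rfl⟩) ∧
    ∀ r : ℕ, q ^ (2 * r) < 1 / 2 →
      -- `γ_r` is an invertible element of `A`, so that it has a class in `K₁(A)`
      ∃ u : (contAlg q)ˣ, ((u : contAlg q) : L2h →L[ℂ] L2h) = gamma q r ∧
        -- every integer is the value of the pairing for some equivariant spectral triple
        (∀ m : ℤ, ∃ D : L2h →ₗ.[ℂ] L2h, IsEquivariantSpectralTriple q D ∧ PairingEq u D m) ∧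
        -- more precisely, the sign can be prescribed, and it determines the pairing
        (∀ (m : ℤ) (F : Finset ℕ), F.card = m.natAbs →
          (∃ D : L2h →ₗ.[ℂ] L2h, IsEquivariantSpectralTriple q D ∧
            signOp D = (if 0 ≤ m then (1 : ℂ) else -1) • (1 - (2 : ℂ) • ∑ k ∈ F, P k)) ∧
          (∀ D : L2h →ₗ.[ℂ] L2h, IsEquivariantSpectralTriple q D →
            signOp D = (if 0 ≤ m then (1 : ℂ) else -1) • (1 - (2 : ℂ) • ∑ k ∈ F, P k) →
            PairingEq u D m)) ∧
        -- the compression of `γ_r` to each `P_k` has index `-1`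
        (∀ k : ℕ, HasFredholmIndex (compress (rowSpace k) (gamma q r)) (-1)) ∧
        -- the cross terms are compact
        (∀ k l : ℕ, l ≠ k → IsCompactOperator (P l ∘L gamma q r ∘L P k)) := by
  refine ⟨isHaarGNS hq0 hq1, fun r hr => ?_⟩
  obtain ⟨u, hu⟩ := exists_unit_eq_gamma hq0 hq1 hr
  refine ⟨u, hu, fun m => ?_, fun m F hF => ⟨exists_isEquivariantSpectralTriple hq0 hq1 m F,
    fun D hD hS => pairingEq_of_signOp hq0 hq1 hr u hu hF hD.spectralTriple.selfAdjoint hS⟩,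
    hasFredholmIndex_compress_row hq0 hq1 hr,
    fun k l hkl => isCompactOperator_P_gamma_P hq0 hq1 r hkl⟩
  -- Any set of |m| rows would serve; the first |m| are taken.
  obtain ⟨D, hD, hS⟩ := exists_isEquivariantSpectralTriple hq0 hq1 m (Finset.range m.natAbs)
  exact ⟨D, hD, pairingEq_of_signOp hq0 hq1 hr u hu (Finset.card_range _)
    hD.spectralTriple.selfAdjoint hS⟩
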